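/- **Setting.** Let $S\subset\mathbb C$ be any set, $D(\tilde W):=\mathbb C\setminus S$, and let $\tilde W_\pm:D(\tilde W)\to\mathbb C$ be arbitrary functions. Put $W_\pm(\omega):=\omega^2\tilde W_\pm(\omega)$, $\tilde W(x,\omega):=\tilde W_\pm(\omega)$ for $\pm x>0$, $W(x,\omega):=\omega^2\tilde W(x,\omega)$, and $$\Omega_0:=\{\omega\in D(\tilde W): W_+(\omega)=0\text{ or }W_-(\omega)=0\}.$$ For $k\in\mathbb R$ let $\nabla_k=(\partial_x,{\rm i}k,0)^T$, so that $\nabla_k\cdot u=u_1'+{\rm i}ku_2$ and $\nabla_k\times u=({\rm i}ku_3,\,-u_3',\,u_2'-{\rm i}ku_1)^T$. All derivatives are distributional: $(\nabla_k\cdot u)(\varphi)=-\int_{\mathbb R} u\cdot\nabla_{-k}\varphi\,dx$ for $\varphi\in C_c^\infty(\mathbb R,\mathbb C)$, and $(\nabla_k\times u)(\varphi)=\int_{\mathbb R} u\cdot\nabla_{-k}\times\varphi\,dx$, $(\nabla_k\times\nabla_k\times u)(\varphi)=\int_{\mathbb R} u\cdot\nabla_{-k}\times\nabla_{-k}\times\varphi\,dx$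 for $\varphi\in C_c^\infty(\mathbb R,\mathbb C^3)$. Let $H=L^2(\mathbb R,\mathbb C^3)$, $$\mathcal D_{k,\omega}=\{u\in H:\ \nabla_k\times u,\ \nabla_k\times\nabla_k\times u\in H,\ \nabla_k\cdot(\tilde W(\cdot,\omega)u)=0\},\qquad \mathcal R_k=\{f\in H:\nabla_k\cdot f=0\},$$ the latter with the $L^2$ inner product. For $\omega\in D(\tilde W)$, $\lambda\in\mathbb C$ let $L_k(\omega;\lambda)=A(\omega)-\lambda B(\omega):\mathcal D_{k,\omega}\to\mathcal R_k$ with $A(\omega)u=\nabla_k\times\nabla_k\times u$ and $B(\omega)u=W(\cdot,\omega)u$. Write $L_k(\omega)=L_k(\omega;1)$ and $\mathcal L_k$ for the pencil. **Parts of the spectrum.** For fixed $\omega$, let $\rho(L_k(\omega;\cdot))$ be the set of $\lambda\in\mathbb C$ such that $L_k(\omega;\lambda):\mathcal D_{k,\omega}\to\mathcal R_k$ is bijective with bounded inverse. * $\rho(\mathcal L_k)=\{\omega\in D(\tilde W):1\in\rho(L_k(\omega;\cdot))\}$, $\sigma(\mathcal L_k)=D(\tilde W)\setminus\rho(\mathcal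 L_k)$, and $\sigma_p(\mathcal L_k)=\{\omega\in D(\tilde W):\ker L_k(\omega)\ne\{0\}\}$ (the eigenvalues). * An eigenvalue $\omega$ has infinite multiplicity, $\omega\in\sigma_p^{(\infty)}(\mathcal L_k)$, if $\dim\ker L_k(\omega)=\infty$ or there are linearly independent $u_0,u_1,\dots\in\mathcal D_{k,\omega}$ with $L_k(\omega)u_0=0$ and $L_k(\omega)u_{j+1}=B(\omega)u_j$ for all $j\ge0$; otherwise $\omega\in\sigma_p^{(<\infty)}(\mathcal L_k)$. It is algebraically simple if $\dim\ker L_k(\omega)=1$ and there are no linearly independent $u,v\in\mathcal D_{k,\omega}$ with $v\in\ker L_k(\omega)\setminus\{0\}$ and $L_k(\omega)u=B(\omega)v$. * $\omega\in\sigma_d(\mathcal L_k)$ iff $\omega\in\sigma_p^{(<\infty)}(\mathcal L_k)$ and $\lambda=1$ is isolated in the $\lambda$-plane: for some $\delta>0$, every $\lambda$ with $0<|\lambda-1|<\delta$ lies in $\rho(L_k(\omega;\cdot))$. * $\omega\in\sigma_{\rm Weyl}(\mathcal L_k)$ iff $\omega\in D(\tilde W)$ and there are $u^{(n)}\in\mathcal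 D_{k,\omega}$ with $\|u^{(n)}\|_H=1$, $u^{(n)}\rightharpoonup0$ in $H$ and $\|L_k(\omega)u^{(n)}\|\to0$. * An operator is semi-Fredholm if its range is closed and its kernel or its cokernel is finite-dimensional; it is Fredholm if its range is closed and both are finite-dimensional, with index $\dim\ker-\dim\operatorname{coker}$. For $\omega\in D(\tilde W)$: $\omega\in\sigma_{e,1}$ iff $L_k(\omega)$ is not semi-Fredholm; $\omega\in\sigma_{e,2}$ iff it is not semi-Fredholm with finite-dimensional kernel; $\omega\in\sigma_{e,3}$ iff it is not Fredholm; $\omega\in\sigma_{e,4}$ iff it is not Fredholm with index $0$; $\omega\in\sigma_{e,5}$ iff $\lambda=1$ does not lie in a connected component of $\{\lambda\in\mathbb C:L_k(\omega;\lambda)\text{ is semi-Fredholm}\}$ that contains a point of $\rho(L_k(\omega;\cdot))$. **Theorem.** **a)** Let $k\in\mathbb R\setminus\{0\}$. Then: 1. $\sigma(\mathcal L_k)\cap\Omega_0=\Omega_0\setminus\{0\}$ if $0\in D(\tilde W)$, $\tilde W_+(0)\neq0$, $\tilde W_-(0)\ne0$ and $\tilde W_+(0)+\tilde W_-(0)\neq0$;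 otherwise $\sigma(\mathcal L_k)\cap\Omega_0=\Omega_0$. 2. $\sigma_p^{(<\infty)}(\mathcal L_k)\cap\Omega_0=\{\omega\in\Omega_0:W_+(\omega)=W_-(\omega)=0,\ \tilde W_+(\omega)\ne0,\ \tilde W_-(\omega)\neq0,\ \tilde W_+(\omega)+\tilde W_-(\omega)=0\}$. This set is $\{0\}$ if $0\in D(\tilde W)$, $\tilde W_+(0)\neq0$, $\tilde W_-(0)\neq0$ and $\tilde W_+(0)+\tilde W_-(0)=0$, and it is empty otherwise. 3. $\sigma_p^{(\infty)}(\mathcal L_k)\cap\Omega_0=\{\omega\in\Omega_0:\tilde W_+(\omega)=0\text{ or }\tilde W_-(\omega)=0\}$, and $\sigma_p(\mathcal L_k)\cap\Omega_0=\sigma(\mathcal L_k)\cap\Omega_0$. 4. If $\sigma_p^{(<\infty)}(\mathcal L_k)\cap\Omega_0\neq\emptyset$ (so that it equals $\{0\}$), then $\omega=0$ is an algebraically simple eigenvalue, and $\operatorname{Ran}L_k(0)$ is closed with codimension $1$ in $\mathcal R_k$; in particular $L_k(0)$ is Fredholm with index $0$. 5. $\sigma_d(\mathcal L_k)\cap\Omega_0=\emptyset$.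 6. $\sigma_{e,2}(\mathcal L_k)\cap\Omega_0=\sigma_{e,3}(\mathcal L_k)\cap\Omega_0=\sigma_{e,4}(\mathcal L_k)\cap\Omega_0=\sigma_{\rm Weyl}(\mathcal L_k)\cap\Omega_0=\sigma_p^{(\infty)}(\mathcal L_k)\cap\Omega_0$. 7. $\sigma_{e,1}(\mathcal L_k)\cap\Omega_0=\{\omega\in\Omega_0:(\tilde W_+(\omega)=0,\ W_-(\omega)\in[k^2,\infty))\text{ or }(\tilde W_-(\omega)=0,\ W_+(\omega)\in[k^2,\infty))\}$. 8. $\sigma_{e,5}(\mathcal L_k)\cap\Omega_0=\sigma(\mathcal L_k)\cap\Omega_0$. **b)** Let $k=0$. Then: 1. $\sigma(\mathcal L_0)\cap\Omega_0=\Omega_0$. 2. $\sigma_p^{(<\infty)}(\mathcal L_0)\cap\Omega_0=\sigma_d(\mathcal L_0)\cap\Omega_0=\emptyset$. 3. $\sigma_p^{(\infty)}(\mathcal L_0)\cap\Omega_0=\{\omega\in\Omega_0:\tilde W_+(\omega)=0\text{ or }\tilde W_-(\omega)=0\}$. 4. $\sigma_{e,j}(\mathcal L_0)\cap\Omega_0=\sigma_{\rm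 Weyl}(\mathcal L_0)\cap\Omega_0=\Omega_0$ for $j=1,\dots,5$. -/

import Mathlib

open MeasureTheory Filter Topology

noncomputable section

/-! ## Operator pencils `P(ω;lam) = A(ω) - lam B(ω)` and their spectra -/

section LinearOperators

variable {D R : Type*} [AddCommGroup D] [Module ℂ D] [NormedAddCommGroup R] [InnerProductSpace ℂ R]

/-- Semi-Fredholm: closed range, and finite-dimensional kernel or cokernel. -/
def IsSemiFredholm (T : D →ₗ[ℂ] R) : Prop :=
  IsClosed (LinearMap.range T : Set R) ∧
    (FiniteDimensional ℂ (LinearMap.ker T) ∨ FiniteDimensional ℂ (R ⧸ LinearMap.range T))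

/-- Semi-Fredholm with finite-dimensional kernel. -/
def IsSemiFredholmFinKer (T : D →ₗ[ℂ] R) : Prop :=
  IsClosed (LinearMap.range T : Set R) ∧ FiniteDimensional ℂ (LinearMap.ker T)

/-- Fredholm: closed range, finite-dimensional kernel and cokernel. -/
def IsFredholmOp (T : D →ₗ[ℂ] R) : Prop :=
  IsClosed (LinearMap.range T : Set R) ∧
    FiniteDimensional ℂ (LinearMap.ker T) ∧ FiniteDimensional ℂ (R ⧸ LinearMap.range T)

/-- `dim ker T - dim coker T` (only used for Fredholm operators). -/
def fredholmIndex (T : D →ₗ[ℂ] R) : ℤ :=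
  (Module.finrank ℂ (LinearMap.ker T) : ℤ) - (Module.finrank ℂ (R ⧸ LinearMap.range T) : ℤ)

end LinearOperators

/-- A pencil of operators `A(ω) - lam B(ω) : H ⊇ D_ω → R`, with `ω` ranging over `Ω`.
Only the data at `ω ∈ Ω` enter the spectral notions below, which make sense for arbitrary linear
`A(ω)`, `B(ω)`; closedness of `A(ω)` and boundedness of `B(ω)` are properties of the concrete
pencil and are not needed to define them. -/
structure OperatorPencil (H R : Type*) [NormedAddCommGroup H] [InnerProductSpace ℂ H]
    [NormedAddCommGroup R] [InnerProductSpace ℂ R] where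
  /-- the set of spectral parameters -/
  Ω : Set ℂ
  /-- the domain `D_ω` -/
  dom : ℂ → Submodule ℂ H
  A : (ω : ℂ) → dom ω →ₗ[ℂ] R
  B : (ω : ℂ) → dom ω →ₗ[ℂ] R

namespace OperatorPencil

variable {H R : Type*} [NormedAddCommGroup H] [InnerProductSpace ℂ H]
  [NormedAddCommGroup R] [InnerProductSpace ℂ R]

/-- `P(ω;lam)`. -/
def op (P : OperatorPencil H R) (ω lam : ℂ) : P.dom ω →ₗ[ℂ] R := P.A ω - lam • P.B ω

/-- Resolvent set of `P(ω;·)` in the `lam`-plane, `ω` being fixed: `P(ω;lam) : D_ω → R` is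
bijective with bounded inverse. -/
def lamResolventSet (P : OperatorPencil H R) (ω : ℂ) : Set ℂ :=
  {lam | Function.Bijective (P.op ω lam) ∧
    ∃ c : ℝ, 0 < c ∧ ∀ u : P.dom ω, ‖(u : H)‖ ≤ c * ‖P.op ω lam u‖}

/-- The resolvent set `ρ(P)`. -/
def resolventSet (P : OperatorPencil H R) : Set ℂ := {ω | ω ∈ P.Ω ∧ 1 ∈ P.lamResolventSet ω}

/-- The spectrum `σ(P)`. -/
def spec (P : OperatorPencil H R) : Set ℂ := P.Ω \ P.resolventSet

/-- The point spectrum `σ_p(P)`. -/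
def pointSpec (P : OperatorPencil H R) : Set ℂ :=
  {ω | ω ∈ P.Ω ∧ ∃ u : P.dom ω, u ≠ 0 ∧ P.op ω 1 u = 0}

/-- `lam` has infinite algebraic multiplicity as an eigenvalue of `P(ω;·)`: the geometric
multiplicity is infinite, or there is an infinite chain of linearly independent associated
vectors. -/
def InfiniteAlgMult (P : OperatorPencil H R) (ω lam : ℂ) : Prop :=
  ¬ FiniteDimensional ℂ (LinearMap.ker (P.op ω lam)) ∨
    ∃ u : ℕ → P.dom ω, LinearIndependent ℂ u ∧ P.op ω lam (u 0) = 0 ∧ u 0 ≠ 0 ∧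
      ∀ j : ℕ, P.op ω lam (u (j + 1)) = P.B ω (u j)

/-- `lam` is an algebraically simple eigenvalue of `P(ω;·)`. -/
def AlgSimple (P : OperatorPencil H R) (ω lam : ℂ) : Prop :=
  Module.finrank ℂ (LinearMap.ker (P.op ω lam)) = 1 ∧
    ¬ ∃ u v : P.dom ω, P.op ω lam v = 0 ∧ v ≠ 0 ∧ P.op ω lam u = P.B ω v ∧
      LinearIndependent ℂ ![u, v]

/-- Eigenvalues of finite algebraic multiplicity. -/
def pointSpecFin (P : OperatorPencil H R) : Set ℂ :=
  {ω | ω ∈ P.pointSpec ∧ ¬ P.InfiniteAlgMult ω 1}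

/-- Eigenvalues of infinite algebraic multiplicity. -/
def pointSpecInf (P : OperatorPencil H R) : Set ℂ :=
  {ω | ω ∈ P.pointSpec ∧ P.InfiniteAlgMult ω 1}

/-- The discrete spectrum: `lam = 1` is an eigenvalue of `P(ω;·)` of finite algebraic
multiplicity which is isolated, in the `lam`-plane, from the rest of the spectrum of `P(ω;·)`. -/
def discreteSpec (P : OperatorPencil H R) : Set ℂ :=
  {ω | ω ∈ P.pointSpecFin ∧
    ∃ δ : ℝ, 0 < δ ∧ ∀ lam ∈ Metric.ball (1 : ℂ) δ, lam ≠ 1 → lam ∈ P.lamResolventSet ω}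

/-- The Weyl spectrum: there is a sequence in `D_ω` of `H`-norm one, weakly null in `H`, with
`P(ω;1) u_n → 0`. -/
def weylSpec (P : OperatorPencil H R) : Set ℂ :=
  {ω | ω ∈ P.Ω ∧ ∃ u : ℕ → P.dom ω, (∀ n, ‖(u n : H)‖ = 1) ∧
    (∀ v : H, Tendsto (fun n => inner ℂ v (u n : H)) atTop (𝓝 0)) ∧
    Tendsto (fun n => ‖P.op ω 1 (u n)‖) atTop (𝓝 0)}

def essSpec1 (P : OperatorPencil H R) : Set ℂ :=
  {ω | ω ∈ P.Ω ∧ ¬ IsSemiFredholm (P.op ω 1)}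

def essSpec2 (P : OperatorPencil H R) : Set ℂ :=
  {ω | ω ∈ P.Ω ∧ ¬ IsSemiFredholmFinKer (P.op ω 1)}

def essSpec3 (P : OperatorPencil H R) : Set ℂ :=
  {ω | ω ∈ P.Ω ∧ ¬ IsFredholmOp (P.op ω 1)}

def essSpec4 (P : OperatorPencil H R) : Set ℂ :=
  {ω | ω ∈ P.Ω ∧ ¬ (IsFredholmOp (P.op ω 1) ∧ fredholmIndex (P.op ω 1) = 0)}

/-- `Δ(P(ω;·))`: the union of those connected components of
`{lam | P(ω;lam) is semi-Fredholm}` which contain a point of the resolvent set of `P(ω;·)`. -/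
def deltaSet (P : OperatorPencil H R) (ω : ℂ) : Set ℂ :=
  {lam | (connectedComponentIn {mu : ℂ | IsSemiFredholm (P.op ω mu)} lam ∩
    P.lamResolventSet ω).Nonempty}

def essSpec5 (P : OperatorPencil H R) : Set ℂ :=
  {ω | ω ∈ P.Ω ∧ 1 ∉ P.deltaSet ω}

end OperatorPencil

/-! ## The one-dimensional Maxwell pencil -/

namespace Maxwell1D

/-- `L²(ℝ, ℂ³)`. -/
abbrev L2 : Type := Lp (EuclideanSpace ℂ (Fin 3)) 2 (volume : Measure ℝ)

/-- Test functions, `C_c^∞(ℝ, ℂ)`. -/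
def IsTest (φ : ℝ → ℂ) : Prop := ContDiff ℝ ((⊤ : ℕ∞) : WithTop ℕ∞) φ ∧ HasCompactSupport φ

/-- `∇_k φ = (φ', i k φ, 0)`. -/
def grad (k : ℝ) (φ : ℝ → ℂ) : Fin 3 → ℝ → ℂ :=
  ![deriv φ, fun x => Complex.I * k * φ x, fun _ => 0]

/-- `∇_k × φ = (i k φ₃, -φ₃', φ₂' - i k φ₁)`. -/
def curl (k : ℝ) (φ : Fin 3 → ℝ → ℂ) : Fin 3 → ℝ → ℂ :=
  ![fun x => Complex.I * k * φ 2 x, fun x => - deriv (φ 2) x,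
    fun x => deriv (φ 1) x - Complex.I * k * φ 0 x]

/-- The bilinear pairing `∫ u · φ dx`. -/
def pairing (u : L2) (φ : Fin 3 → ℝ → ℂ) : ℂ := ∫ x : ℝ, ∑ i : Fin 3, u x i * φ i x

/-- `f ∈ L²` is the weak `∇_k × u`. -/
def HasWeakCurl (k : ℝ) (u f : L2) : Prop :=
  ∀ φ : Fin 3 → ℝ → ℂ, (∀ i, IsTest (φ i)) → pairing u (curl (-k) φ) = pairing f φ

/-- `g ∈ L²` is the weak `∇_k × ∇_k × u`. -/
def HasWeakCurlCurl (k : ℝ) (u g : L2) : Prop :=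
  ∀ φ : Fin 3 → ℝ → ℂ, (∀ i, IsTest (φ i)) →
    pairing u (curl (-k) (curl (-k) φ)) = pairing g φ

/-- `∇_k · u = 0` in the sense of distributions. -/
def IsDivFree (k : ℝ) (u : L2) : Prop :=
  ∀ φ : ℝ → ℂ, IsTest φ → pairing u (grad (-k) φ) = 0

lemma IsTest.deriv {φ : ℝ → ℂ} (h : IsTest φ) : IsTest (deriv φ) :=
  ⟨(contDiff_infty_iff_deriv.mp h.1).2, h.2.deriv⟩

lemma IsTest.const_mul {φ : ℝ → ℂ} (h : IsTest φ) (c : ℂ) : IsTest (fun x => c * φ x) :=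
  ⟨contDiff_const.mul h.1, h.2.mul_left⟩

lemma IsTest.neg {φ : ℝ → ℂ} (h : IsTest φ) : IsTest (fun x => - φ x) := by
  simpa using h.const_mul (-1)

lemma IsTest.sub {φ ψ : ℝ → ℂ} (h : IsTest φ) (h' : IsTest ψ) : IsTest (fun x => φ x - ψ x) :=
  ⟨h.1.sub h'.1, h.2.sub h'.2⟩

lemma isTest_zero : IsTest (fun _ => 0) := ⟨contDiff_const, HasCompactSupport.zero⟩

lemma isTest_grad {φ : ℝ → ℂ} (h : IsTest φ) (k : ℝ) (i : Fin 3) : IsTest (grad k φ i) := by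
  fin_cases i
  · exact h.deriv
  · exact h.const_mul _
  · exact isTest_zero

lemma isTest_curl {φ : Fin 3 → ℝ → ℂ} (h : ∀ i, IsTest (φ i)) (k : ℝ) (i : Fin 3) :
    IsTest (curl k φ i) := by
  fin_cases i
  · exact (h 2).const_mul _
  · exact (h 2).deriv.neg
  · exact (h 1).deriv.sub ((h 0).const_mul _)

lemma integrable_comp_mul (u : L2) {φ : ℝ → ℂ} (h : IsTest φ) (i : Fin 3) :
    Integrable (fun x => u x i * φ x) := by
  have h1 : MemLp (fun x => u x i) 2 (volume : Measure ℝ) :=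
    (Lp.memLp u).continuousLinearMap_comp
      (EuclideanSpace.proj i : EuclideanSpace ℂ (Fin 3) →L[ℂ] ℂ)
  have h2 : MemLp φ 2 (volume : Measure ℝ) := h.1.continuous.memLp_of_hasCompactSupport h.2
  exact h1.integrable_mul h2

lemma pairing_add (u v : L2) {φ : Fin 3 → ℝ → ℂ} (h : ∀ i, IsTest (φ i)) :
    pairing (u + v) φ = pairing u φ + pairing v φ := by
  unfold pairing
  rw [← integral_add (integrable_finsetSum _ fun i _ => integrable_comp_mul u (h i) i)
    (integrable_finsetSum _ fun i _ => integrable_comp_mul v (h i) i)]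
  refine integral_congr_ae ?_
  filter_upwards [Lp.coeFn_add u v] with x hx
  rw [← Finset.sum_add_distrib]
  refine Finset.sum_congr rfl fun i _ => ?_
  rw [hx]
  simp [add_mul]

lemma pairing_smul (c : ℂ) (u : L2) (φ : Fin 3 → ℝ → ℂ) :
    pairing (c • u) φ = c * pairing u φ := by
  unfold pairing
  rw [← integral_const_mul]
  refine integral_congr_ae ?_
  filter_upwards [Lp.coeFn_smul c u] with x hx
  rw [Finset.mul_sum]
  refine Finset.sum_congr rfl fun i _ => ?_
  rw [hx]
  simp [mul_assoc]

lemma pairing_zero (φ : Fin 3 → ℝ → ℂ) : pairing 0 φ = 0 := by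
  simpa using pairing_smul 0 0 φ

/-- An `L²` function is determined by its action on test functions. -/
lemma eq_of_pairing_eq {f g : L2}
    (h : ∀ φ : Fin 3 → ℝ → ℂ, (∀ i, IsTest (φ i)) → pairing f φ = pairing g φ) : f = g := by
  have key : ∀ i : Fin 3, ∀ᵐ x : ℝ, f x i - g x i = 0 := by
    intro i
    have hm : MemLp (fun x => f x i - g x i) 2 (volume : Measure ℝ) :=
      ((Lp.memLp f).continuousLinearMap_comp
        (EuclideanSpace.proj i : EuclideanSpace ℂ (Fin 3) →L[ℂ] ℂ)).sub
      ((Lp.memLp g).continuousLinearMap_comp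
        (EuclideanSpace.proj i : EuclideanSpace ℂ (Fin 3) →L[ℂ] ℂ))
    refine ae_eq_zero_of_integral_contDiff_smul_eq_zero
      (hm.locallyIntegrable (by norm_num)) fun χ hχ hc => ?_
    have hT : IsTest (fun x => (χ x : ℂ)) :=
      ⟨Complex.ofRealCLM.contDiff.comp hχ, hc.comp_left Complex.ofReal_zero⟩
    have h1 := h (fun j => if j = i then fun x => (χ x : ℂ) else fun _ => 0) (fun j => by
      by_cases hj : j = i
      · simpa [hj] using hT
      · simpa [hj] using isTest_zero)
    have hsum : ∀ u : L2, pairing u (fun j => if j = i then fun x => (χ x : ℂ) else fun _ => 0)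
        = ∫ x : ℝ, u x i * (χ x : ℂ) := by
      intro u
      refine integral_congr_ae (Eventually.of_forall fun x => ?_)
      beta_reduce
      rw [Finset.sum_eq_single i]
      · simp
      · intro j _ hj
        simp [hj]
      · simp
    rw [hsum, hsum, ← sub_eq_zero, ← integral_sub (integrable_comp_mul f hT i)
      (integrable_comp_mul g hT i)] at h1
    rw [← h1]
    refine integral_congr_ae (Eventually.of_forall fun x => ?_)
    simp only [Complex.real_smul]
    ring
  refine Lp.ext ?_
  filter_upwards [ae_all_iff.mpr key] with x hx
  ext i
  exact sub_eq_zero.mp (hx i)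

/-- The function equal to `a` on the right half-line and to `b` on the left half-line. -/
def stepFun (a b : ℂ) (x : ℝ) : ℂ := if 0 < x then a else b

lemma memLp_step (a b : ℂ) (u : L2) :
    MemLp (fun x => stepFun a b x • u x) 2 (volume : Measure ℝ) := by
  have hmeas : Measurable (stepFun a b) :=
    Measurable.ite measurableSet_Ioi measurable_const measurable_const
  refine (Lp.memLp u).of_le_mul (c := max ‖a‖ ‖b‖)
    (hmeas.aestronglyMeasurable.smul (Lp.aestronglyMeasurable u))
    (Eventually.of_forall fun x => ?_)
  rw [norm_smul]
  refine mul_le_mul_of_nonneg_right ?_ (norm_nonneg _)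
  unfold stepFun
  split_ifs
  · exact le_max_left _ _
  · exact le_max_right _ _

/-- Multiplication by `stepFun a b` on `L²(ℝ, ℂ³)`. -/
def mulStep (a b : ℂ) : L2 →ₗ[ℂ] L2 where
  toFun u := (memLp_step a b u).toLp _
  map_add' u v := by
    refine Lp.ext ?_
    filter_upwards [(memLp_step a b (u + v)).coeFn_toLp, (memLp_step a b u).coeFn_toLp,
      (memLp_step a b v).coeFn_toLp, Lp.coeFn_add u v,
      Lp.coeFn_add ((memLp_step a b u).toLp _) ((memLp_step a b v).toLp _)] with x h1 h2 h3 h4 h5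
    rw [h1, h5, Pi.add_apply, h2, h3, h4, Pi.add_apply, smul_add]
  map_smul' c u := by
    refine Lp.ext ?_
    filter_upwards [(memLp_step a b (c • u)).coeFn_toLp, (memLp_step a b u).coeFn_toLp,
      Lp.coeFn_smul c u, Lp.coeFn_smul c ((memLp_step a b u).toLp _)] with x h1 h2 h3 h4
    rw [RingHom.id_apply, h1, h4, Pi.smul_apply, h2, h3, Pi.smul_apply, smul_comm]

/-- The range space `R_k`: the divergence-free fields in `L²(ℝ, ℂ³)`, with the `L²` inner
product. -/
def rangeSpace (k : ℝ) : Submodule ℂ L2 where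
  carrier := {f | IsDivFree k f}
  add_mem' {f g} hf hg φ hφ := by
    rw [pairing_add _ _ (isTest_grad hφ _), hf φ hφ, hg φ hφ, add_zero]
  zero_mem' φ _ := pairing_zero _
  smul_mem' c f hf φ hφ := by
    rw [pairing_smul, hf φ hφ, mul_zero]

/-- The domain `D_{k,ω}`, where `a` and `b` are the values of `W̃(·,ω)` on the right and on the
left half-line: `u, ∇_k × u, ∇_k × ∇_k × u ∈ L²` and `∇_k · (W̃ u) = 0`. -/
def domain (k : ℝ) (a b : ℂ) : Submodule ℂ L2 where
  carrier := {u | (∃ f : L2, HasWeakCurl k u f) ∧ (∃ g : L2, HasWeakCurlCurl k u g) ∧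
    IsDivFree k (mulStep a b u)}
  add_mem' := by
    rintro u v ⟨⟨f, hf⟩, ⟨g, hg⟩, hu⟩ ⟨⟨f', hf'⟩, ⟨g', hg'⟩, hv⟩
    refine ⟨⟨f + f', fun φ hφ => ?_⟩, ⟨g + g', fun φ hφ => ?_⟩, ?_⟩
    · rw [pairing_add _ _ (isTest_curl hφ _), pairing_add _ _ hφ, hf φ hφ, hf' φ hφ]
    · rw [pairing_add _ _ (isTest_curl (isTest_curl hφ _) _), pairing_add _ _ hφ, hg φ hφ,
        hg' φ hφ]
    · rw [map_add]
      exact (rangeSpace k).add_mem hu hv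
  zero_mem' := by
    refine ⟨⟨0, fun φ _ => ?_⟩, ⟨0, fun φ _ => ?_⟩, ?_⟩
    · rw [pairing_zero, pairing_zero]
    · rw [pairing_zero, pairing_zero]
    · rw [map_zero]
      exact (rangeSpace k).zero_mem
  smul_mem' := by
    rintro c u ⟨⟨f, hf⟩, ⟨g, hg⟩, hu⟩
    refine ⟨⟨c • f, fun φ hφ => ?_⟩, ⟨c • g, fun φ hφ => ?_⟩, ?_⟩
    · rw [pairing_smul, pairing_smul, hf φ hφ]
    · rw [pairing_smul, pairing_smul, hg φ hφ]
    · rw [map_smul]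
      exact (rangeSpace k).smul_mem c hu

lemma curl_grad (k : ℝ) (φ : ℝ → ℂ) : curl k (grad k φ) = fun _ _ => 0 := by
  funext i x
  fin_cases i
  · simp [curl, grad]
  · simp [curl, grad]
  · simp [curl, grad]

lemma curl_zero (k : ℝ) : curl k (fun _ _ => 0) = fun _ _ => 0 := by
  funext i x
  fin_cases i <;> simp [curl]

lemma isDivFree_of_hasWeakCurlCurl {k : ℝ} {u g : L2} (h : HasWeakCurlCurl k u g) :
    IsDivFree k g := by
  intro φ hφ
  rw [← h _ (isTest_grad hφ _), curl_grad, curl_zero]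
  simp [pairing]

lemma exists_curlCurl (k : ℝ) (a b : ℂ) (u : domain k a b) :
    ∃ g : rangeSpace k, HasWeakCurlCurl k u g :=
  let ⟨g, hg⟩ := u.2.2.1
  ⟨⟨g, isDivFree_of_hasWeakCurlCurl hg⟩, hg⟩

lemma hasWeakCurlCurl_unique {k : ℝ} {u : L2} {g g' : rangeSpace k}
    (h : HasWeakCurlCurl k u g) (h' : HasWeakCurlCurl k u g') : g = g' :=
  Subtype.ext (eq_of_pairing_eq fun φ hφ => (h φ hφ).symm.trans (h' φ hφ))

/-- `A(ω) : D_{k,ω} → R_k`, `u ↦ ∇_k × ∇_k × u` (the weak curl-curl, which is unique). -/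
def curlCurlOp (k : ℝ) (a b : ℂ) : domain k a b →ₗ[ℂ] rangeSpace k where
  toFun u := (exists_curlCurl k a b u).choose
  map_add' u v := by
    refine hasWeakCurlCurl_unique (exists_curlCurl k a b (u + v)).choose_spec fun φ hφ => ?_
    rw [Submodule.coe_add, Submodule.coe_add, pairing_add _ _ hφ,
      pairing_add _ _ (isTest_curl (isTest_curl hφ _) _),
      (exists_curlCurl k a b u).choose_spec φ hφ, (exists_curlCurl k a b v).choose_spec φ hφ]
  map_smul' c u := by
    refine hasWeakCurlCurl_unique (exists_curlCurl k a b (c • u)).choose_spec fun φ hφ => ?_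
    rw [RingHom.id_apply, Submodule.coe_smul, Submodule.coe_smul, pairing_smul, pairing_smul,
      (exists_curlCurl k a b u).choose_spec φ hφ]

lemma curlCurlOp_spec (k : ℝ) (a b : ℂ) (u : domain k a b) :
    HasWeakCurlCurl k u (curlCurlOp k a b u : L2) :=
  (exists_curlCurl k a b u).choose_spec

/-- `B(ω) : D_{k,ω} → R_k`, `u ↦ W u` with `W = ω² W̃`. -/
def multOp (k : ℝ) (ω a b : ℂ) : domain k a b →ₗ[ℂ] rangeSpace k where
  toFun u := ⟨ω ^ 2 • mulStep a b u, (rangeSpace k).smul_mem _ u.2.2.2⟩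
  map_add' u v := by
    refine Subtype.ext ?_
    simp [map_add, smul_add]
  map_smul' c u := by
    refine Subtype.ext ?_
    simp [map_smul, smul_comm c]

/-- The Maxwell pencil `L_k` of the interface problem. Here `S` is the set of singularities, so
that `D(W̃) = Sᶜ`, and `Vp`, `Vm` are the values `W̃₊`, `W̃₋` of `W̃` on the right and on the left
half-line. -/
def pencil (S : Set ℂ) (Vp Vm : ℂ → ℂ) (k : ℝ) : OperatorPencil L2 (rangeSpace k) where
  Ω := Sᶜ
  dom ω := domain k (Vp ω) (Vm ω)
  A ω := curlCurlOp k (Vp ω) (Vm ω)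
  B ω := multOp k ω (Vp ω) (Vm ω)

/-- The exceptional set `Ω₀ = {ω ∈ D(W̃) : W₊(ω) = 0 or W₋(ω) = 0}`, with `W = ω² W̃`. -/
def exceptionalSet (S : Set ℂ) (Vp Vm : ℂ → ℂ) : Set ℂ :=
  {ω | ω ∈ Sᶜ ∧ (ω ^ 2 * Vp ω = 0 ∨ ω ^ 2 * Vm ω = 0)}

/-- The interval `[k², ∞)` as a subset of `ℂ`. -/
def halfLine (k : ℝ) : Set ℂ := (fun t : ℝ => (t : ℂ)) '' Set.Ici (k ^ 2)

end Maxwell1D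

end

/-! If neither value of W̃ vanishes at a point of Ω₀, that point is ω = 0
(`eq_zero_of_mem_exceptionalSet`). So there are two regimes. Write a, b for the values of W̃ on the
right and on the left.

One value vanishes. Every gradient ∇_k φ with φ supported on the corresponding side is curl-free and
is annihilated by W̃, so it lies in the kernel of A - λB for every λ (`exists_orthonormal_kernel`).
This gives infinite multiplicity, a Weyl sequence and an empty resolvent set in the λ-plane, hence
membership in all the spectra except possibly σ_{e,1}. As the kernel is infinite-dimensional,
σ_{e,1} asks only whether the range is closed of finite codimension. If W on the other side is k² +
ξ², wave packets of frequency ξ in the third component are asymptotically annihilated by the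
adjoint, and Banach-Steinhaus excludes such a range
(`not_isClosed_range_and_finiteDimensional_quotient`). If W there avoids [k², ∞), the equation is
solved explicitly and the operator is onto (`maxwellOp_surjective_of_half`).

Both values are nonzero and ω = 0. Then B(0) = 0, so the pencil is the curl-curl operator for every
λ. Its λ-resolvent set is everything or empty, and Jordan chains stay in the kernel. For k ≠ 0,
solve ∇_k × ∇_k × g = f with g divergence-free on the whole line and add c ∇_k exp(-|k||x|), which
is curl-free. The divergence of W̃ times the sum sits at the interface with strength (b - a) g₁(0) +
c |k| (a + b) (`inner_div_add_gradExp`). If a + b ≠ 0, this fixes c and the operator is boundedly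
invertible (`curlCurlOp_bijective`). If a + b = 0, the exponential field spans the kernel, and f is
in the range exactly when g₁(0) = 0, which is one continuous linear condition on f
(`range_curlCurlOp`). The operator is then Fredholm of index 0 with a simple eigenvalue. For k = 0
the curl-curl operator is injective with dense range, and wave packets of frequency 0 show that the
range is not closed.

The analysis uses H¹(ℝ) only through weak derivatives in L². Density of test functions comes from
Riesz representation and the absence of L² solutions of u' = ±u
(`HasWeakDeriv.inner_add_inner_eq_zero`). Integration by parts and the trace at 0 then extend from
test functions. -/

noncomputable section

namespace Maxwell1D

open scoped ComplexConjugate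

/-! ### Scalar functions on the line and weak derivatives -/

/-- `L²(ℝ, ℂ)`. -/
abbrev X : Type := Lp ℂ 2 (volume : Measure ℝ)

lemma IsTest.memLp {φ : ℝ → ℂ} (h : IsTest φ) : MemLp φ 2 (volume : Measure ℝ) :=
  h.1.continuous.memLp_of_hasCompactSupport h.2

lemma IsTest.integrable {φ : ℝ → ℂ} (h : IsTest φ) : Integrable φ :=
  h.1.continuous.integrable_of_hasCompactSupport h.2

lemma IsTest.differentiable {φ : ℝ → ℂ} (h : IsTest φ) : Differentiable ℝ φ :=
  h.1.differentiable (by simp)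

lemma IsTest.mul_left {φ ψ : ℝ → ℂ} (h : ContDiff ℝ ((⊤ : ℕ∞) : WithTop ℕ∞) φ) (h' : IsTest ψ) :
    IsTest (fun x => φ x * ψ x) :=
  ⟨h.mul h'.1, h'.2.mul_left⟩

lemma IsTest.conj {φ : ℝ → ℂ} (h : IsTest φ) : IsTest (fun x => conj (φ x)) :=
  ⟨Complex.conjCLE.contDiff.comp h.1, h.2.comp_left (map_zero _)⟩

lemma deriv_conj {φ : ℝ → ℂ} (h : Differentiable ℝ φ) :
    deriv (fun x => conj (φ x)) = fun x => conj (deriv φ x) := by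
  funext x
  exact (Complex.conjCLE.hasFDerivAt.comp_hasDerivAt x (h x).hasDerivAt).deriv

/-- The class in `L²` of a square integrable function (and `0` for other functions). -/
def lpOf (f : ℝ → ℂ) : X := by
  classical
  exact if h : MemLp f 2 (volume : Measure ℝ) then h.toLp f else 0

lemma coeFn_lpOf {f : ℝ → ℂ} (h : MemLp f 2 (volume : Measure ℝ)) : lpOf f =ᵐ[volume] f := by
  rw [lpOf, dif_pos h]
  exact h.coeFn_toLp

lemma lpOf_congr {f g : ℝ → ℂ} (hf : MemLp f 2 (volume : Measure ℝ)) (h : f =ᵐ[volume] g) :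
    lpOf f = lpOf g :=
  Lp.ext ((coeFn_lpOf hf).trans (h.trans (coeFn_lpOf (hf.ae_eq h)).symm))

lemma lpOf_add {f g : ℝ → ℂ} (hf : MemLp f 2 (volume : Measure ℝ))
    (hg : MemLp g 2 (volume : Measure ℝ)) : lpOf (fun x => f x + g x) = lpOf f + lpOf g := by
  refine Lp.ext ?_
  filter_upwards [coeFn_lpOf (hf.add hg), coeFn_lpOf hf, coeFn_lpOf hg,
    Lp.coeFn_add (lpOf f) (lpOf g)] with x h1 h2 h3 h4
  rw [h4, Pi.add_apply, h2, h3]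
  exact h1

lemma lpOf_const_mul {f : ℝ → ℂ} (hf : MemLp f 2 (volume : Measure ℝ)) (c : ℂ) :
    lpOf (fun x => c * f x) = c • lpOf f := by
  refine Lp.ext ?_
  filter_upwards [coeFn_lpOf (hf.const_mul c), coeFn_lpOf hf,
    Lp.coeFn_smul c (lpOf f)] with x h1 h2 h4
  rw [h4, Pi.smul_apply, h2, smul_eq_mul]
  exact h1

lemma inner_eq_integral (u v : X) : inner ℂ u v = ∫ x, v x * conj (u x) := by
  rw [L2.inner_def]
  rfl

lemma inner_lpOf_left {f : ℝ → ℂ} (hf : MemLp f 2 (volume : Measure ℝ)) (u : X) :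
    inner ℂ (lpOf f) u = ∫ x, u x * conj (f x) := by
  rw [inner_eq_integral]
  refine integral_congr_ae ?_
  filter_upwards [coeFn_lpOf hf] with x hx
  rw [hx]

lemma inner_lpOf_lpOf {f g : ℝ → ℂ} (hf : MemLp f 2 (volume : Measure ℝ))
    (hg : MemLp g 2 (volume : Measure ℝ)) :
    inner ℂ (lpOf f) (lpOf g) = ∫ x, g x * conj (f x) := by
  rw [inner_lpOf_left hf]
  refine integral_congr_ae ?_
  filter_upwards [coeFn_lpOf hg] with x hx
  rw [hx]

lemma integrable_mul_memLp (u : X) {f : ℝ → ℂ} (hf : MemLp f 2 (volume : Measure ℝ)) :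
    Integrable (fun x => u x * f x) :=
  (Lp.memLp u).integrable_mul hf

/-- `v` is the distributional derivative of `u`. -/
def HasWeakDeriv (u v : X) : Prop :=
  ∀ φ : ℝ → ℂ, IsTest φ → inner ℂ (lpOf (deriv φ)) u = -inner ℂ (lpOf φ) v

/-- Test functions are closed under conjugation, so the sesquilinear and bilinear formulations
agree. The inner product form suits Hilbert space arguments, the integral form explicit computation.
-/
lemma hasWeakDeriv_iff_integral {u v : X} :
    HasWeakDeriv u v ↔ ∀ φ : ℝ → ℂ, IsTest φ → ∫ x, u x * deriv φ x = -∫ x, v x * φ x := by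
  constructor
  · intro h φ hφ
    have := h _ hφ.conj
    rw [inner_lpOf_left hφ.conj.deriv.memLp, inner_lpOf_left hφ.conj.memLp,
      deriv_conj hφ.differentiable] at this
    simpa using this
  · intro h φ hφ
    have := h _ hφ.conj
    rwa [deriv_conj hφ.differentiable, ← inner_lpOf_left hφ.deriv.memLp,
      ← inner_lpOf_left hφ.memLp] at this

namespace HasWeakDeriv

variable {u v u' v' : X}

lemma add (h : HasWeakDeriv u u') (h' : HasWeakDeriv v v') : HasWeakDeriv (u + v) (u' + v') := by
  intro φ hφ
  rw [inner_add_right, inner_add_right, h φ hφ, h' φ hφ]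
  ring

lemma smul (c : ℂ) (h : HasWeakDeriv u u') : HasWeakDeriv (c • u) (c • u') := by
  intro φ hφ
  rw [inner_smul_right, inner_smul_right, h φ hφ]
  ring

lemma neg (h : HasWeakDeriv u u') : HasWeakDeriv (-u) (-u') := by
  simpa using h.smul (-1)

lemma sub (h : HasWeakDeriv u u') (h' : HasWeakDeriv v v') : HasWeakDeriv (u - v) (u' - v') := by
  simpa [sub_eq_add_neg] using h.add h'.neg

end HasWeakDeriv

lemma hasWeakDeriv_zero : HasWeakDeriv 0 0 := by
  intro φ _
  simp

lemma integral_deriv_eq_zero {φ : ℝ → ℂ} (hφ : IsTest φ) : ∫ x, deriv φ x = 0 :=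
  integral_eq_zero_of_hasDerivAt_of_integrable (fun x => (hφ.differentiable x).hasDerivAt)
    hφ.deriv.integrable hφ.integrable

lemma hasWeakDeriv_test {φ : ℝ → ℂ} (hφ : IsTest φ) : HasWeakDeriv (lpOf φ) (lpOf (deriv φ)) := by
  rw [hasWeakDeriv_iff_integral]
  intro ψ hψ
  have h1 : ∫ x, (lpOf φ) x * deriv ψ x = ∫ x, φ x * deriv ψ x :=
    integral_congr_ae (by filter_upwards [coeFn_lpOf hφ.memLp] with x hx; rw [hx])
  have h2 : ∫ x, (lpOf (deriv φ)) x * ψ x = ∫ x, deriv φ x * ψ x :=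
    integral_congr_ae (by filter_upwards [coeFn_lpOf hφ.deriv.memLp] with x hx; rw [hx])
  rw [h1, h2]
  have h3 := integral_deriv_eq_zero (IsTest.mul_left hφ.1 hψ)
  have h4 : deriv (fun x => φ x * ψ x) = fun x => deriv φ x * ψ x + φ x * deriv ψ x := by
    funext x
    exact ((hφ.differentiable x).hasDerivAt.mul (hψ.differentiable x).hasDerivAt).deriv
  rw [h4, integral_add (IsTest.mul_left hφ.deriv.1 hψ).integrable
    (IsTest.mul_left hφ.1 hψ.deriv).integrable] at h3
  linear_combination h3

/-- A test function with vanishing integral is the derivative of a test function. -/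
lemma exists_isTest_deriv_eq {g : ℝ → ℂ} (hg : IsTest g) (h0 : ∫ x, g x = 0) :
    ∃ φ, IsTest φ ∧ deriv φ = g := by
  obtain ⟨R, hR⟩ := hg.2.isCompact.isBounded.subset_closedBall 0
  have hz : ∀ x, x ∉ Set.Icc (-R) R → g x = 0 := by
    intro x hx
    refine image_eq_zero_of_notMem_tsupport fun h => hx ?_
    have := hR h
    rwa [Real.closedBall_eq_Icc, zero_sub, zero_add] at this
  have hI : ∀ a b, IntervalIntegrable g volume a b := fun a b => hg.1.continuous.intervalIntegrable a b
  have hd : ∀ x, HasDerivAt (fun x => ∫ t in (-R)..x, g t) (g x) x := fun x =>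
    intervalIntegral.integral_hasDerivAt_right (hI _ _)
      (hg.1.continuous.stronglyMeasurableAtFilter _ _) hg.1.continuous.continuousAt
  have hder : deriv (fun x => ∫ t in (-R)..x, g t) = g := funext fun x => (hd x).deriv
  -- The support of `g` lies in [-R, R]. Starting at -R makes the primitive vanish to the left, and
  -- the zero total integral makes it vanish to the right of R.
  refine ⟨fun x => ∫ t in (-R)..x, g t, ⟨?_, ?_⟩, hder⟩
  · rw [contDiff_infty_iff_deriv, hder]
    exact ⟨fun x => (hd x).differentiableAt, hg.1⟩
  · refine HasCompactSupport.of_support_subset_isCompact (isCompact_Icc (a := -R) (b := R)) ?_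
    intro x hx
    by_contra hxR
    apply hx
    rw [Set.mem_Icc, not_and_or, not_le, not_le] at hxR
    beta_reduce
    rcases hxR with hxR | hxR
    · rw [intervalIntegral.integral_symm, intervalIntegral.integral_of_le hxR.le,
        integral_Ioc_eq_integral_Ioo, setIntegral_eq_zero_of_forall_eq_zero, neg_zero]
      intro t ht
      exact hz t fun h => absurd h.1 (not_le.mpr ht.2)
    · rcases le_total (-R) x with hle | hle
      · rw [intervalIntegral.integral_of_le hle, ← h0]
        refine setIntegral_eq_integral_of_ae_compl_eq_zero ?_
        have hne : ∀ᵐ t : ℝ, t ≠ -R := by simp [ae_iff]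
        filter_upwards [hne] with t ht0 ht
        refine hz t fun h => ht ⟨lt_of_le_of_ne h.1 (Ne.symm ht0), h.2.trans hxR.le⟩
      · rw [intervalIntegral.integral_symm, intervalIntegral.integral_of_le hle,
          setIntegral_eq_zero_of_forall_eq_zero, neg_zero]
        intro t ht
        exact hz t fun h => absurd (h.2.trans hxR.le) (not_le.mpr ht.1)

/-- **du Bois-Reymond**: a locally integrable function with vanishing distributional derivative is
constant. -/
lemma ae_eq_const_of_integral_mul_deriv_eq_zero {f : ℝ → ℂ} (hf : LocallyIntegrable f)
    (h : ∀ φ : ℝ → ℂ, IsTest φ → ∫ x, f x * deriv φ x = 0) : ∃ c : ℂ, ∀ᵐ x, f x = c := by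
  let b : ContDiffBump (0 : ℝ) := default
  have hχ : IsTest (fun x => (b.normed volume x : ℂ)) :=
    ⟨Complex.ofRealCLM.contDiff.comp b.contDiff_normed,
      b.hasCompactSupport_normed.comp_left Complex.ofReal_zero⟩
  have hχ1 : ∫ x, (b.normed volume x : ℂ) = 1 := by
    rw [integral_complex_ofReal, b.integral_normed, Complex.ofReal_one]
  have hint : ∀ φ : ℝ → ℂ, IsTest φ → Integrable (fun x => f x * φ x) := by
    intro φ hφ
    have := hf.integrable_smul_left_of_hasCompactSupport hφ.1.continuous hφ.2
    simpa [mul_comm] using this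
  set c : ℂ := ∫ x, f x * (b.normed volume x : ℂ) with hc
  refine ⟨c, ?_⟩
  have key : ∀ᵐ x, f x - c = 0 := by
    refine ae_eq_zero_of_integral_contDiff_smul_eq_zero
      (hf.sub (locallyIntegrable_const c)) fun g hg hgs => ?_
    have hG : IsTest (fun x => (g x : ℂ)) :=
      ⟨Complex.ofRealCLM.contDiff.comp hg, hgs.comp_left Complex.ofReal_zero⟩
    set I : ℂ := ∫ x, (g x : ℂ) with hI
    -- Removing from `g` its integral times the normalised bump leaves a function of mean zero,
    -- hence a derivative on which `f` vanishes. So ∫ f g = c ∫ g, where c is the integral of `f`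
    -- against the bump.
    obtain ⟨φ, hφ, hφ'⟩ := exists_isTest_deriv_eq (hG.sub (hχ.const_mul I)) (by
      rw [integral_sub hG.integrable (hχ.const_mul I).integrable, integral_const_mul, hχ1]
      simp [hI])
    have h1 := h φ hφ
    rw [hφ'] at h1
    have h2 : (fun x => f x * ((g x : ℂ) - I * (b.normed volume x : ℂ)))
        = fun x => f x * (g x : ℂ) - I * (f x * (b.normed volume x : ℂ)) := by
      funext x
      ring
    rw [h2, integral_sub (hint _ hG) ((hint _ hχ).const_mul I), integral_const_mul, ← hc] at h1
    have h3 : (fun x => g x • (f x - c)) = fun x => f x * (g x : ℂ) - c * (g x : ℂ) := by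
      funext x
      rw [Complex.real_smul]
      ring
    change ∫ x, g x • (f x - c) = 0
    rw [h3, integral_sub (hint _ hG) (hG.integrable.const_mul c), integral_const_mul, ← hI]
    linear_combination h1
  filter_upwards [key] with x hx
  exact sub_eq_zero.mp hx

/-- The equation `u' = c u` has no nontrivial solution in `L²`. -/
lemma HasWeakDeriv.eq_zero_of_deriv_eq_smul {u : X} {c : ℝ} (h : HasWeakDeriv u ((c : ℂ) • u)) :
    u = 0 := by
  have hE : ContDiff ℝ ((⊤ : ℕ∞) : WithTop ℕ∞) (fun x : ℝ => Complex.exp (-(c * x : ℝ))) :=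
    (Complex.ofRealCLM.contDiff.comp (contDiff_const.mul contDiff_id)).neg.cexp
  have hEd : ∀ x : ℝ, HasDerivAt (fun x : ℝ => Complex.exp (-(c * x : ℝ)))
      (-c * Complex.exp (-(c * x : ℝ))) x := by
    intro x
    have h1 : HasDerivAt (fun x : ℝ => -((c * x : ℝ) : ℂ)) (-c) x := by
      have := ((hasDerivAt_id x).const_mul c).ofReal_comp.neg
      rwa [mul_one] at this
    simpa [mul_comm] using h1.cexp
  rw [hasWeakDeriv_iff_integral] at h
  have hloc : LocallyIntegrable (fun x : ℝ => u x * Complex.exp (-(c * x : ℝ))) := by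
    have h1 : LocallyIntegrable (fun x => u x) := (Lp.memLp u).locallyIntegrable (by norm_num)
    rw [← locallyIntegrableOn_univ] at h1 ⊢
    exact h1.mul_continuousOn hE.continuous.continuousOn isOpen_univ.isLocallyClosed
  -- With the integrating factor, exp(-c x) u has weak derivative zero, so it is a constant C.
  obtain ⟨C, hC⟩ := ae_eq_const_of_integral_mul_deriv_eq_zero hloc (by
    intro φ hφ
    have hψ := IsTest.mul_left hE hφ
    have h1 := h _ hψ
    have h2 : deriv (fun x : ℝ => Complex.exp (-(c * x : ℝ)) * φ x) =
        fun x => -c * Complex.exp (-(c * x : ℝ)) * φ x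
          + Complex.exp (-(c * x : ℝ)) * deriv φ x := by
      funext x
      exact ((hEd x).mul (hφ.differentiable x).hasDerivAt).deriv
    have h3 : ∫ x, ((c : ℂ) • u) x * (Complex.exp (-(c * x : ℝ)) * φ x) =
        c * ∫ x, u x * (Complex.exp (-(c * x : ℝ)) * φ x) := by
      rw [← integral_const_mul]
      refine integral_congr_ae ?_
      filter_upwards [Lp.coeFn_smul (c : ℂ) u] with x hx
      rw [hx, Pi.smul_apply, smul_eq_mul, mul_assoc]
    rw [h3, h2] at h1
    have h4 : ∀ x : ℝ, u x * Complex.exp (-(c * x : ℝ)) * deriv φ x =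
        u x * (-c * Complex.exp (-(c * x : ℝ)) * φ x
          + Complex.exp (-(c * x : ℝ)) * deriv φ x) +
        c * (u x * (Complex.exp (-(c * x : ℝ)) * φ x)) := by
      intro x
      ring
    rw [integral_congr_ae (Eventually.of_forall h4), integral_add _
      ((integrable_mul_memLp u hψ.memLp).const_mul _), integral_const_mul, h1]
    · ring
    · have := integrable_mul_memLp u hψ.deriv.memLp
      rwa [h2] at this)
  by_cases hC0 : C = 0
  · refine Lp.ext ?_
    filter_upwards [hC, Lp.coeFn_zero ℂ 2 (volume : Measure ℝ)] with x hx hx0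
    rw [hC0] at hx
    rw [hx0, Pi.zero_apply]
    exact (mul_eq_zero.mp hx).resolve_right (Complex.exp_ne_zero _)
  -- If C ≠ 0, then |u|² = |C|² exp(2 c x) is at least |C|² on a half-line chosen by the sign of c.
  -- That set has infinite measure, which contradicts integrability.
  exfalso
  have hnorm : ∀ᵐ x : ℝ, ‖u x‖ ^ 2 = ‖C‖ ^ 2 * Real.exp (c * x) ^ 2 := by
    filter_upwards [hC] with x hx
    have : u x = C * Complex.exp ((c * x : ℝ)) := by
      rw [← hx, mul_assoc, ← Complex.exp_add]
      simp
    rw [this, norm_mul, Complex.norm_exp_ofReal]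
    ring
  have hi : Integrable (fun x : ℝ => ‖C‖ ^ 2 * Real.exp (c * x) ^ 2) :=
    ((memLp_two_iff_integrable_sq_norm (Lp.aestronglyMeasurable u)).mp (Lp.memLp u)).congr hnorm
  have hfin := hi.measure_norm_ge_lt_top (ε := ‖C‖ ^ 2) (by positivity)
  have hsub : ∀ s : Set ℝ, (∀ x ∈ s, 0 ≤ c * x) → volume s < ⊤ := by
    intro s hs
    refine (measure_mono fun x hx => ?_).trans_lt hfin
    rw [Set.mem_ofPred_eq, Real.norm_of_nonneg (by positivity)]
    have := Real.one_le_exp (hs x hx)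
    exact le_mul_of_one_le_right (sq_nonneg _) (one_le_pow₀ this)
  rcases le_total 0 c with hc | hc
  · have := hsub (Set.Ioi 0) fun x hx => mul_nonneg hc (le_of_lt hx)
    simp at this
  · have := hsub (Set.Iio 0) fun x hx => mul_nonneg_of_nonpos_of_nonpos hc (le_of_lt hx)
    simp at this

end Maxwell1D

end

noncomputable section

namespace Maxwell1D

open scoped ComplexConjugate

/-! ### Integration by parts on `H¹` -/

/-- The graph of the weak derivative, as a subspace of `L² × L²`. -/
def weakGraph : Submodule ℂ (WithLp 2 (X × X)) where
  carrier := {z | HasWeakDeriv z.fst z.snd}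
  add_mem' h h' := HasWeakDeriv.add h h'
  zero_mem' := hasWeakDeriv_zero
  smul_mem' c _ h := HasWeakDeriv.smul c h

/-- Each test function imposes one continuous linear condition. Thus the graph, which is H¹(ℝ) with
its Hilbert norm, is complete and orthogonal projection onto it is available. -/
lemma isClosed_weakGraph : IsClosed (weakGraph : Set (WithLp 2 (X × X))) := by
  have : (weakGraph : Set (WithLp 2 (X × X))) = ⋂ φ : {φ : ℝ → ℂ // IsTest φ},
      {z | inner ℂ (lpOf (deriv φ)) z.fst = -inner ℂ (lpOf φ) z.snd} := by
    ext z
    simp only [Set.mem_iInter, Subtype.forall]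
    rfl
  rw [this]
  refine isClosed_iInter fun φ => isClosed_eq ?_ ?_ <;> fun_prop

instance : CompleteSpace weakGraph := isClosed_weakGraph.completeSpace_coe

/-- Riesz representation of the functionals on `H¹`. -/
lemma exists_weakGraph_inner_eq (p q : X) : ∃ v v' : X, HasWeakDeriv v v' ∧
    ∀ u u' : X, HasWeakDeriv u u' → inner ℂ p u + inner ℂ q u' = inner ℂ v u + inner ℂ v' u' := by
  refine ⟨(weakGraph.starProjection (WithLp.toLp 2 (p, q))).fst,
    (weakGraph.starProjection (WithLp.toLp 2 (p, q))).snd,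
    weakGraph.starProjection_apply_mem _, fun u u' hu => ?_⟩
  have h := Submodule.starProjection_inner_eq_zero (K := weakGraph) (WithLp.toLp 2 (p, q))
    (WithLp.toLp 2 (u, u')) hu
  rw [inner_sub_left, sub_eq_zero, WithLp.prod_inner_apply, WithLp.prod_inner_apply] at h
  exact h

/-- A functional on `H¹` which vanishes on test functions is zero: test functions are dense. -/
lemma HasWeakDeriv.inner_add_inner_eq_zero {p q u u' : X}
    (h : ∀ φ : ℝ → ℂ, IsTest φ → inner ℂ p (lpOf φ) + inner ℂ q (lpOf (deriv φ)) = 0)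
    (hu : HasWeakDeriv u u') : inner ℂ p u + inner ℂ q u' = 0 := by
  obtain ⟨v, v', hv, hpq⟩ := exists_weakGraph_inner_eq p q
  -- The representative (v, v') is orthogonal in H¹ to all test functions, which says v'' = v
  -- weakly. Then v' + v and v' - v solve u' = u and u' = -u in L², so both vanish.
  have hv' : HasWeakDeriv v' v := by
    intro φ hφ
    have h3 := h φ hφ
    rw [hpq _ _ (hasWeakDeriv_test hφ)] at h3
    rw [← inner_conj_symm, ← inner_conj_symm (lpOf φ), ← map_neg]
    congr 1
    linear_combination h3
  have h1 : v' + v = 0 := by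
    refine HasWeakDeriv.eq_zero_of_deriv_eq_smul (c := 1) ?_
    have := hv'.add hv
    rwa [Complex.ofReal_one, one_smul, add_comm v' v] at *
  have h2 : v' - v = 0 := by
    refine HasWeakDeriv.eq_zero_of_deriv_eq_smul (c := -1) ?_
    have := hv'.sub hv
    rwa [Complex.ofReal_neg, Complex.ofReal_one, neg_smul, one_smul, neg_sub]
  have hf : v = 0 := by
    have : (2 : ℂ) • v = 0 := by
      rw [two_smul]
      calc v + v = (v' + v) - (v' - v) := by abel
        _ = 0 := by rw [h1, h2, sub_zero]
    exact (smul_eq_zero.mp this).resolve_left two_ne_zero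
  have hs : v' = 0 := by rwa [hf, add_zero] at h1
  rw [hpq u u' hu, hf, hs, inner_zero_left, inner_zero_left, add_zero]

/-- Integration by parts in `H¹(ℝ)`. -/
lemma HasWeakDeriv.inner_eq {u u' v v' : X} (hu : HasWeakDeriv u u') (hv : HasWeakDeriv v v') :
    inner ℂ u' v = -inner ℂ u v' := by
  have := HasWeakDeriv.inner_add_inner_eq_zero (p := u') (q := u) (fun φ hφ => by
    have := hu φ hφ
    rw [← inner_conj_symm u, this, map_neg, inner_conj_symm, add_neg_cancel]) hv
  exact eq_neg_of_add_eq_zero_left this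

/-! ### Multiplication by step functions -/

lemma measurable_stepFun (a b : ℂ) : Measurable (stepFun a b) :=
  Measurable.ite measurableSet_Ioi measurable_const measurable_const

lemma norm_stepFun_le (a b : ℂ) (x : ℝ) : ‖stepFun a b x‖ ≤ max ‖a‖ ‖b‖ := by
  unfold stepFun
  split_ifs
  · exact le_max_left _ _
  · exact le_max_right _ _

lemma memLp_stepFun_mul (a b : ℂ) {f : ℝ → ℂ} (hf : MemLp f 2 (volume : Measure ℝ)) :
    MemLp (fun x => stepFun a b x * f x) 2 (volume : Measure ℝ) := by
  refine hf.of_le_mul (c := max ‖a‖ ‖b‖)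
    ((measurable_stepFun a b).aestronglyMeasurable.mul hf.1) (Eventually.of_forall fun x => ?_)
  rw [norm_mul]
  exact mul_le_mul_of_nonneg_right (norm_stepFun_le a b x) (norm_nonneg _)

/-- Multiplication by `stepFun a b` on `L²(ℝ, ℂ)`. -/
def mulS (a b : ℂ) : X →L[ℂ] X :=
  LinearMap.mkContinuous
    { toFun := fun u => lpOf (fun x => stepFun a b x * u x)
      map_add' := fun u v => by
        rw [← lpOf_add (memLp_stepFun_mul a b (Lp.memLp u)) (memLp_stepFun_mul a b (Lp.memLp v))]
        refine lpOf_congr (memLp_stepFun_mul a b (Lp.memLp (u + v))) ?_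
        filter_upwards [Lp.coeFn_add u v] with x hx
        rw [hx, Pi.add_apply, mul_add]
      map_smul' := fun c u => by
        rw [RingHom.id_apply, ← lpOf_const_mul (memLp_stepFun_mul a b (Lp.memLp u))]
        refine lpOf_congr (memLp_stepFun_mul a b (Lp.memLp (c • u))) ?_
        filter_upwards [Lp.coeFn_smul c u] with x hx
        rw [hx, Pi.smul_apply, smul_eq_mul]
        ring }
    (max ‖a‖ ‖b‖) fun u => by
      refine Lp.norm_le_mul_norm_of_ae_le_mul ?_
      filter_upwards [coeFn_lpOf (memLp_stepFun_mul a b (Lp.memLp u))] with x hx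
      change ‖(lpOf (fun x => stepFun a b x * u x)) x‖ ≤ _
      rw [hx, norm_mul]
      exact mul_le_mul_of_nonneg_right (norm_stepFun_le a b x) (norm_nonneg _)

lemma coeFn_mulS (a b : ℂ) (u : X) : mulS a b u =ᵐ[volume] fun x => stepFun a b x * u x :=
  coeFn_lpOf (memLp_stepFun_mul a b (Lp.memLp u))

lemma stepFun_mul (a b c d : ℂ) (x : ℝ) :
    stepFun a b x * stepFun c d x = stepFun (a * c) (b * d) x := by
  unfold stepFun
  split_ifs <;> rfl

lemma mulS_mulS (a b c d : ℂ) (u : X) : mulS a b (mulS c d u) = mulS (a * c) (b * d) u := by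
  refine Lp.ext ?_
  filter_upwards [coeFn_mulS a b (mulS c d u), coeFn_mulS c d u, coeFn_mulS (a * c) (b * d) u]
    with x h1 h2 h3
  rw [h1, h2, h3, ← mul_assoc, stepFun_mul]

lemma mulS_self (c : ℂ) (u : X) : mulS c c u = c • u := by
  refine Lp.ext ?_
  filter_upwards [coeFn_mulS c c u, Lp.coeFn_smul c u] with x h1 h2
  rw [h1, h2, Pi.smul_apply, smul_eq_mul, stepFun, ite_self]

lemma mulS_add_mulS (a b c d : ℂ) (u : X) : mulS a b u + mulS c d u = mulS (a + c) (b + d) u := by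
  refine Lp.ext ?_
  filter_upwards [coeFn_mulS a b u, coeFn_mulS c d u, coeFn_mulS (a + c) (b + d) u,
    Lp.coeFn_add (mulS a b u) (mulS c d u)] with x h1 h2 h3 h4
  rw [h4, Pi.add_apply, h1, h2, h3, ← add_mul]
  congr 1
  unfold stepFun
  split_ifs <;> rfl

lemma smul_mulS (c a b : ℂ) (u : X) : c • mulS a b u = mulS (c * a) (c * b) u := by
  rw [← mulS_self, mulS_mulS]

lemma inner_mulS_left (a b : ℂ) (u v : X) :
    inner ℂ (mulS a b u) v = inner ℂ u (mulS (conj a) (conj b) v) := by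
  rw [inner_eq_integral, inner_eq_integral]
  refine integral_congr_ae ?_
  filter_upwards [coeFn_mulS a b u, coeFn_mulS (conj a) (conj b) v] with x h1 h2
  rw [h1, h2, map_mul]
  unfold stepFun
  split_ifs <;> ring

lemma inner_mulS (a b : ℂ) {f g : ℝ → ℂ} (hf : MemLp f 2 (volume : Measure ℝ))
    (hg : MemLp g 2 (volume : Measure ℝ)) :
    inner ℂ (lpOf f) (mulS a b (lpOf g)) =
      a * (∫ x in Set.Ioi 0, g x * conj (f x)) + b * ∫ x in Set.Iic 0, g x * conj (f x) := by
  have hfc : MemLp (fun x => conj (f x)) 2 (volume : Measure ℝ) := hf.star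
  have hi : Integrable (fun x => g x * conj (f x)) := hg.integrable_mul hfc
  have hi' : Integrable (fun x => stepFun a b x * g x * conj (f x)) :=
    (memLp_stepFun_mul a b hg).integrable_mul hfc
  have h1 : inner ℂ (lpOf f) (mulS a b (lpOf g)) = ∫ x, stepFun a b x * g x * conj (f x) := by
    rw [inner_lpOf_left hf]
    refine integral_congr_ae ?_
    filter_upwards [coeFn_mulS a b (lpOf g), coeFn_lpOf hg] with x h1 h2
    rw [h1, h2]
  rw [h1, ← integral_add_compl measurableSet_Ioi hi', Set.compl_Ioi, ← integral_const_mul,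
    ← integral_const_mul]
  congr 1
  · refine setIntegral_congr_fun measurableSet_Ioi fun x hx => ?_
    rw [Set.mem_Ioi] at hx
    simp only [stepFun, if_pos hx, mul_assoc]
  · refine setIntegral_congr_fun measurableSet_Iic fun x hx => ?_
    rw [Set.mem_Iic] at hx
    simp only [stepFun, if_neg (not_lt.mpr hx), mul_assoc]

/-! ### The trace at the interface -/

lemma IsTest.integral_Ioi_deriv {φ : ℝ → ℂ} (h : IsTest φ) :
    ∫ x in Set.Ioi 0, _root_.deriv φ x = -φ 0 := by
  have := integral_Ioi_of_hasDerivAt_of_tendsto' (f := φ) (a := 0) (m := 0)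
    (fun x _ => (h.differentiable x).hasDerivAt) h.deriv.integrable.integrableOn
    ((h.2.is_zero_at_infty).mono_left (by rw [cocompact_eq_atBot_atTop]; exact le_sup_right))
  rw [this, zero_sub]

lemma IsTest.integral_Iic_deriv {φ : ℝ → ℂ} (h : IsTest φ) :
    ∫ x in Set.Iic 0, _root_.deriv φ x = φ 0 := by
  have := integral_Iic_of_hasDerivAt_of_tendsto' (f := φ) (a := 0) (m := 0)
    (fun x _ => (h.differentiable x).hasDerivAt) h.deriv.integrable.integrableOn
    ((h.2.is_zero_at_infty).mono_left (by rw [cocompact_eq_atBot_atTop]; exact le_sup_left))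
  rw [this, sub_zero]

/-- A test function with value one at the interface. -/
def cutoff (x : ℝ) : ℂ := ((default : ContDiffBump (0 : ℝ)) x : ℂ)

lemma isTest_cutoff : IsTest cutoff :=
  ⟨Complex.ofRealCLM.contDiff.comp (default : ContDiffBump (0 : ℝ)).contDiff,
    (default : ContDiffBump (0 : ℝ)).hasCompactSupport.comp_left Complex.ofReal_zero⟩

lemma cutoff_zero : cutoff 0 = 1 := by
  rw [cutoff, ContDiffBump.one_of_mem_closedBall, Complex.ofReal_one]
  exact Metric.mem_closedBall_self (default : ContDiffBump (0 : ℝ)).rIn_pos.le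

/-- The trace at `0` of an `H¹` function `u` with derivative `u'`. -/
def trace (u u' : X) : ℂ :=
  -(inner ℂ (lpOf (deriv cutoff)) (mulS 1 0 u) + inner ℂ (lpOf cutoff) (mulS 1 0 u'))

lemma inner_half_test {φ ψ : ℝ → ℂ} (hφ : IsTest φ) (hψ : IsTest ψ) :
    inner ℂ (lpOf (deriv φ)) (mulS 1 0 (lpOf ψ)) + inner ℂ (lpOf φ) (mulS 1 0 (lpOf (deriv ψ)))
      = -(conj (φ 0) * ψ 0) := by
  rw [inner_mulS 1 0 hφ.deriv.memLp hψ.memLp, inner_mulS 1 0 hφ.memLp hψ.deriv.memLp]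
  have h := IsTest.integral_Ioi_deriv (IsTest.mul_left hψ.1 hφ.conj)
  have h4 : deriv (fun x => ψ x * conj (φ x)) =
      fun x => deriv ψ x * conj (φ x) + ψ x * conj (deriv φ x) := by
    funext x
    rw [← congrFun (deriv_conj hφ.differentiable) x]
    exact ((hψ.differentiable x).hasDerivAt.mul (hφ.conj.differentiable x).hasDerivAt).deriv
  have hd := hφ.conj.deriv
  rw [deriv_conj hφ.differentiable] at hd
  rw [h4, integral_add (IsTest.mul_left hψ.deriv.1 hφ.conj).integrable.integrableOn
    (IsTest.mul_left hψ.1 hd).integrable.integrableOn] at h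
  linear_combination h

lemma trace_test {φ : ℝ → ℂ} (hφ : IsTest φ) : trace (lpOf φ) (lpOf (deriv φ)) = φ 0 := by
  rw [trace, inner_half_test isTest_cutoff hφ, cutoff_zero, map_one, one_mul, neg_neg]

lemma inner_mulS_one_zero (u v : X) : inner ℂ (mulS 1 0 u) v = inner ℂ u (mulS 1 0 v) := by
  rw [inner_mulS_left, map_one, map_zero]

lemma trace_eq (u u' : X) : trace u u' =
    -(inner ℂ (mulS 1 0 (lpOf (deriv cutoff))) u + inner ℂ (mulS 1 0 (lpOf cutoff)) u') := by
  rw [trace, inner_mulS_one_zero, inner_mulS_one_zero]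

/-- Integration by parts on the right half-line, against a test function. -/
lemma HasWeakDeriv.inner_half_test {φ : ℝ → ℂ} (hφ : IsTest φ) {v v' : X}
    (hv : HasWeakDeriv v v') :
    inner ℂ (lpOf (deriv φ)) (mulS 1 0 v) + inner ℂ (lpOf φ) (mulS 1 0 v') =
      -(conj (φ 0) * trace v v') := by
  -- The boundary terms of `φ` and of φ(0) times the cutoff coincide, so the difference of the two
  -- functionals vanishes on test functions, hence on all of H¹.
  have key := HasWeakDeriv.inner_add_inner_eq_zero
    (p := mulS 1 0 (lpOf (deriv φ)) - φ 0 • mulS 1 0 (lpOf (deriv cutoff)))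
    (q := mulS 1 0 (lpOf φ) - φ 0 • mulS 1 0 (lpOf cutoff)) (fun ψ hψ => by
      have h1 := Maxwell1D.inner_half_test hφ hψ
      have h2 := trace_test hψ
      rw [trace_eq] at h2
      rw [inner_sub_left, inner_sub_left, inner_smul_left, inner_smul_left, inner_mulS_one_zero,
        inner_mulS_one_zero (lpOf φ)]
      linear_combination h1 + conj (φ 0) * h2) hv
  rw [inner_sub_left, inner_sub_left, inner_smul_left, inner_smul_left, inner_mulS_one_zero,
        inner_mulS_one_zero (lpOf φ)] at key
  rw [trace_eq]
  linear_combination key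

/-- Integration by parts on the right half-line. -/
lemma HasWeakDeriv.inner_half {u u' v v' : X} (hu : HasWeakDeriv u u') (hv : HasWeakDeriv v v') :
    inner ℂ u' (mulS 1 0 v) + inner ℂ u (mulS 1 0 v') = -(conj (trace u u') * trace v v') := by
  -- The same density argument in the other variable: `v` is now fixed, and the test function is
  -- replaced by an arbitrary `u` in H¹.
  have key := HasWeakDeriv.inner_add_inner_eq_zero
    (p := mulS 1 0 v' - trace v v' • mulS 1 0 (lpOf (deriv cutoff)))
    (q := mulS 1 0 v - trace v v' • mulS 1 0 (lpOf cutoff)) (fun φ hφ => by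
      have h1 := congrArg conj (HasWeakDeriv.inner_half_test hφ hv)
      have h2 := trace_test hφ
      rw [trace_eq] at h2
      rw [map_add, inner_conj_symm, inner_conj_symm, map_neg, map_mul, Complex.conj_conj] at h1
      rw [inner_sub_left, inner_sub_left, inner_smul_left, inner_smul_left]
      linear_combination h1 + conj (trace v v') * h2) hu
  rw [inner_sub_left, inner_sub_left, inner_smul_left, inner_smul_left] at key
  have key2 := congrArg conj key
  simp only [map_add, map_sub, map_mul, map_zero, Complex.conj_conj, inner_conj_symm] at key2
  have h3 := congrArg conj (trace_eq u u')
  simp only [map_add, map_neg, inner_conj_symm] at h3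
  rw [h3]
  linear_combination key2

/-- Integration by parts against a step function. -/
lemma HasWeakDeriv.inner_mulS {u u' v v' : X} (hu : HasWeakDeriv u u') (hv : HasWeakDeriv v v')
    (a b : ℂ) : inner ℂ u' (mulS a b v) + inner ℂ u (mulS a b v') =
      (b - a) * (conj (trace u u') * trace v v') := by
  have h1 := hu.inner_half hv
  have h2 := hu.inner_eq hv
  -- A step function is a multiple of the indicator of the right half-line plus a constant; only the
  -- first term produces a boundary contribution.
  have h3 : ∀ z : X, mulS a b z = (a - b) • mulS 1 0 z + b • z := by
    intro z
    rw [smul_mulS, ← mulS_self b z, mulS_add_mulS]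
    congr 2 <;> ring
  rw [h3, h3, inner_add_right, inner_add_right, inner_smul_right, inner_smul_right,
    inner_smul_right, inner_smul_right]
  linear_combination (a - b) * h1 + b * h2

lemma HasWeakDeriv.inner_mulS_test {φ : ℝ → ℂ} (hφ : IsTest φ) {v v' : X}
    (hv : HasWeakDeriv v v') (a b : ℂ) :
    inner ℂ (lpOf (deriv φ)) (mulS a b v) + inner ℂ (lpOf φ) (mulS a b v') =
      (b - a) * (conj (φ 0) * trace v v') := by
  rw [(hasWeakDeriv_test hφ).inner_mulS hv, trace_test hφ]

/-- The only defect in differentiating step times `v` is a point mass at 0 of strength (a - b) v(0),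
which the Dirichlet condition removes. -/
lemma HasWeakDeriv.mulS {v v' : X} (hv : HasWeakDeriv v v') (h0 : trace v v' = 0) (a b : ℂ) :
    HasWeakDeriv (mulS a b v) (mulS a b v') := by
  intro φ hφ
  have := hv.inner_mulS_test hφ a b
  rw [h0, mul_zero, mul_zero] at this
  exact eq_neg_of_add_eq_zero_left this

lemma trace_smul (c : ℂ) (u u' : X) : trace (c • u) (c • u') = c * trace u u' := by
  simp only [trace, map_smul, inner_smul_right]
  ring

lemma trace_sub (u u' v v' : X) : trace (u - v) (u' - v') = trace u u' - trace v v' := by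
  simp only [trace, map_sub, inner_sub_right]
  ring

/-! ### Decaying exponentials -/

/-- The function `exp (-κ |x|)`. -/
def expAbs (κ : ℂ) (x : ℝ) : ℂ := Complex.exp (-κ * |x|)

lemma memLp_expAbs {κ : ℂ} (hκ : 0 < κ.re) : MemLp (expAbs κ) 2 (volume : Measure ℝ) := by
  have hc : Continuous (expAbs κ) := by
    unfold expAbs
    fun_prop
  rw [memLp_two_iff_integrable_sq_norm hc.aestronglyMeasurable]
  have h : ∀ x : ℝ, ‖expAbs κ x‖ ^ 2 = Real.exp (-(2 * κ.re) * |x|) := by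
    intro x
    rw [expAbs, Complex.norm_exp, ← Real.exp_nat_mul]
    congr 1
    simp
    ring
  simp_rw [h]
  rw [← integrableOn_univ, ← Set.Iic_union_Ioi (a := (0 : ℝ)), integrableOn_union]
  constructor
  · refine (integrableOn_exp_mul_Iic (a := 2 * κ.re) (by positivity) 0).congr_fun (fun x hx => ?_)
      measurableSet_Iic
    simp only [abs_of_nonpos (Set.mem_Iic.mp hx), neg_mul_neg]
  · refine (exp_neg_integrableOn_Ioi 0 (b := 2 * κ.re) (by positivity)).congr_fun (fun x hx => ?_)
      measurableSet_Ioi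
    simp only [abs_of_pos (Set.mem_Ioi.mp hx)]

/-- The class of `exp (-κ |x|)` in `L²`. -/
def expLp (κ : ℂ) : X := lpOf (expAbs κ)

lemma contDiff_cexp_mul (c : ℂ) :
    ContDiff ℝ ((⊤ : ℕ∞) : WithTop ℕ∞) (fun x : ℝ => Complex.exp (c * x)) :=
  (contDiff_const.mul Complex.ofRealCLM.contDiff).cexp

lemma hasDerivAt_cexp_mul (c : ℂ) (x : ℝ) :
    HasDerivAt (fun x : ℝ => Complex.exp (c * x)) (c * Complex.exp (c * x)) x := by
  have h1 : HasDerivAt (fun x : ℝ => c * (x : ℂ)) c x := by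
    simpa using (hasDerivAt_id x).ofReal_comp.const_mul c
  simpa [mul_comm] using h1.cexp

lemma deriv_cexp_mul {ψ : ℝ → ℂ} (hψ : IsTest ψ) (c : ℂ) :
    deriv (fun x : ℝ => Complex.exp (c * x) * ψ x) =
      fun x : ℝ => c * (Complex.exp (c * x) * ψ x) + Complex.exp (c * x) * deriv ψ x := by
  funext x
  refine ((hasDerivAt_cexp_mul c x).mul (hψ.differentiable x).hasDerivAt).deriv.trans ?_
  ring

/-- Integration by parts on each half-line, with the jump of the step at 0 as boundary term.
Different choices of (a, b) yield the weak derivative of exp(-κ|x|), its trace, and the jump of its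
derivative. -/
lemma expAbs_test {κ : ℂ} (hκ : 0 < κ.re) {φ : ℝ → ℂ} (hφ : IsTest φ) (a b : ℂ) :
    inner ℂ (lpOf (deriv φ)) (mulS a b (expLp κ)) +
      inner ℂ (lpOf φ) (mulS (-κ * a) (κ * b) (expLp κ)) = (b - a) * conj (φ 0) := by
  have hd := hφ.conj.deriv
  rw [deriv_conj hφ.differentiable] at hd
  have hr := IsTest.integral_Ioi_deriv (IsTest.mul_left (contDiff_cexp_mul (-κ)) hφ.conj)
  have hl := IsTest.integral_Iic_deriv (IsTest.mul_left (contDiff_cexp_mul κ) hφ.conj)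
  rw [deriv_cexp_mul hφ.conj, deriv_conj hφ.differentiable, integral_add
    ((IsTest.mul_left (contDiff_cexp_mul (-κ)) hφ.conj).const_mul _).integrable.integrableOn
    (IsTest.mul_left (contDiff_cexp_mul (-κ)) hd).integrable.integrableOn,
    integral_const_mul] at hr
  rw [deriv_cexp_mul hφ.conj, deriv_conj hφ.differentiable, integral_add
    ((IsTest.mul_left (contDiff_cexp_mul κ) hφ.conj).const_mul _).integrable.integrableOn
    (IsTest.mul_left (contDiff_cexp_mul κ) hd).integrable.integrableOn,
    integral_const_mul] at hl
  have er : ∀ ψ : ℝ → ℂ, ∫ x in Set.Ioi (0 : ℝ), expAbs κ x * ψ x =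
      ∫ x in Set.Ioi (0 : ℝ), Complex.exp (-κ * x) * ψ x := by
    intro ψ
    refine setIntegral_congr_fun measurableSet_Ioi fun x hx => ?_
    simp only [expAbs, abs_of_pos (Set.mem_Ioi.mp hx)]
  have el : ∀ ψ : ℝ → ℂ, ∫ x in Set.Iic (0 : ℝ), expAbs κ x * ψ x =
      ∫ x in Set.Iic (0 : ℝ), Complex.exp (κ * x) * ψ x := by
    intro ψ
    refine setIntegral_congr_fun measurableSet_Iic fun x hx => ?_
    simp only [expAbs, abs_of_nonpos (Set.mem_Iic.mp hx), Complex.ofReal_neg, neg_mul_neg]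
  rw [expLp, Maxwell1D.inner_mulS _ _ hφ.deriv.memLp (memLp_expAbs hκ),
    Maxwell1D.inner_mulS _ _ hφ.memLp (memLp_expAbs hκ), er, er, el, el]
  simp only [Complex.ofReal_zero, mul_zero, Complex.exp_zero, one_mul] at hr hl
  linear_combination a * hr + b * hl

lemma hasWeakDeriv_expLp {κ : ℂ} (hκ : 0 < κ.re) :
    HasWeakDeriv (expLp κ) (mulS (-κ) κ (expLp κ)) := by
  intro φ hφ
  have := expAbs_test hκ hφ 1 1
  rw [sub_self, zero_mul, mul_one, mul_one, mulS_self, one_smul] at this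
  exact eq_neg_of_add_eq_zero_left this

lemma trace_expLp {κ : ℂ} (hκ : 0 < κ.re) : trace (expLp κ) (mulS (-κ) κ (expLp κ)) = 1 := by
  have := expAbs_test hκ isTest_cutoff 1 0
  rw [mul_one, mul_zero, cutoff_zero, map_one] at this
  rw [trace, mulS_mulS, one_mul, zero_mul, this]
  ring

/-- The trace of the solution of `-v'' + κ² v = f`. -/
lemma trace_resolvent {κ : ℂ} (hκ : 0 < κ.re) {v v' f : X} (hv : HasWeakDeriv v v')
    (hv' : HasWeakDeriv v' (κ ^ 2 • v - f)) :
    2 * κ * trace v v' = inner ℂ (expLp (conj κ)) f := by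
  have hκ' : 0 < (conj κ).re := by simpa using hκ
  have he := hasWeakDeriv_expLp hκ'
  -- Test the equation with exp(-κ̄|x|), conjugated because the inner product is conjugate-linear on
  -- the left, and integrate by parts twice. The bulk terms cancel, and the jump of the derivative
  -- of the exponential leaves 2κ v(0).
  have h1 := he.inner_eq hv'
  have h2 := he.inner_mulS hv (-κ) κ
  rw [trace_expLp hκ', map_one, one_mul] at h2
  rw [inner_mulS_left, mulS_mulS] at h2
  rw [inner_mulS_left, inner_sub_right, inner_smul_right] at h1
  simp only [map_neg, Complex.conj_conj] at h1 h2
  have h3 : (-κ * -κ) = κ * κ := by ring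
  rw [h3, mulS_self, inner_smul_right] at h2
  linear_combination h1 - h2

end Maxwell1D

end

noncomputable section

namespace Maxwell1D

open scoped ComplexConjugate

/-! ### Solvability of `-v'' + M v = f` -/

/-- **Lax-Milgram** on a closed subspace of a complex Hilbert space. -/
lemma exists_inner_eq_of_coercive {E : Type*} [NormedAddCommGroup E] [InnerProductSpace ℂ E]
    [CompleteSpace E] (V : Submodule ℂ E) [CompleteSpace V] (N : E →L[ℂ] E) (θ : ℂ) {c : ℝ}
    (hc : 0 < c) (h : ∀ v ∈ V, c * ‖v‖ ^ 2 ≤ (θ * inner ℂ v (N v)).re) (f : E) :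
    ∃ u ∈ V, ∀ v ∈ V, inner ℂ v (N u) = inner ℂ v f := by
  set T : V →L[ℂ] V := V.orthogonalProjectionOnto ∘L N ∘L V.subtypeL with hT
  have hTi : ∀ u v : V, inner ℂ v (T u) = inner ℂ (v : E) (N u) := fun u v =>
    V.inner_orthogonalProjectionOnto_eq_of_mem_left v (N u)
  have hcoer : ∀ v : V, c * ‖v‖ ^ 2 ≤ ‖θ‖ * (‖v‖ * ‖T v‖) := by
    intro v
    calc c * ‖v‖ ^ 2 ≤ (θ * inner ℂ (v : E) (N v)).re := h v v.2
      _ ≤ ‖θ * inner ℂ (v : E) (N v)‖ := Complex.re_le_norm _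
      _ = ‖θ‖ * ‖inner ℂ v (T v)‖ := by rw [norm_mul, hTi]
      _ ≤ ‖θ‖ * (‖v‖ * ‖T v‖) := by gcongr; exact norm_inner_le_norm _ _
  have hbd : ∀ v : V, ‖v‖ ≤ ‖θ‖ / c * ‖T v‖ := by
    intro v
    rcases eq_or_ne v 0 with rfl | hv
    · rw [norm_zero]
      positivity
    · have hv' : 0 < ‖v‖ := norm_pos_iff.mpr hv
      rw [div_mul_eq_mul_div, le_div_iff₀ hc]
      refine le_of_mul_le_mul_right ?_ hv'
      nlinarith [hcoer v]
  have hanti : AntilipschitzWith (‖θ‖ / c).toNNReal T := by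
    refine T.antilipschitz_of_bound fun v => ?_
    rw [Real.coe_toNNReal _ (by positivity)]
    exact hbd v
  have hclosed : IsClosed (LinearMap.range (T : V →ₗ[ℂ] V) : Set V) :=
    hanti.isClosed_range T.uniformContinuous
  have hcs : CompleteSpace (LinearMap.range (T : V →ₗ[ℂ] V)) := hclosed.completeSpace_coe
  have htop : LinearMap.range (T : V →ₗ[ℂ] V) = ⊤ := by
    rw [← Submodule.orthogonal_eq_bot_iff, Submodule.eq_bot_iff]
    intro w hw
    have h0 : inner ℂ w (T w) = 0 :=
      (Submodule.mem_orthogonal' _ _).mp hw _ (LinearMap.mem_range_self _ w)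
    have h1 := h w w.2
    rw [← hTi, h0, mul_zero, Complex.zero_re] at h1
    have h2 : ‖(w : E)‖ ^ 2 ≤ 0 := by
      by_contra hlt
      exact absurd h1 (not_le.mpr (mul_pos hc (not_le.mp hlt)))
    have h3 : ‖(w : E)‖ = 0 := by
      have := sq_nonneg ‖(w : E)‖
      exact pow_eq_zero_iff two_ne_zero |>.mp (le_antisymm h2 this)
    exact Subtype.ext (norm_eq_zero.mp h3)
  obtain ⟨u, hu⟩ := LinearMap.range_eq_top.mp htop (V.orthogonalProjectionOnto f)
  refine ⟨u, u.2, fun v hv => ?_⟩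
  have h1 := hTi u ⟨v, hv⟩
  rw [← h1]
  change inner ℂ _ ((T : V →ₗ[ℂ] V) u) = _
  rw [hu]
  exact V.inner_orthogonalProjectionOnto_eq_of_mem_left ⟨v, hv⟩ f

/-- Solvability of `-v'' + M v = f` in `H²(ℝ)` for a bounded coercive operator `M`. -/
lemma exists_resolvent (M : X →L[ℂ] X) (θ : ℂ) {c : ℝ} (hc : 0 < c) (hθ : c ≤ θ.re)
    (hM : ∀ u : X, c * ‖u‖ ^ 2 ≤ (θ * inner ℂ u (M u)).re) (f : X) :
    ∃ v v' : X, HasWeakDeriv v v' ∧ HasWeakDeriv v' (M v - f) := by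
  -- On the graph the form is ⟨v, M u⟩ + ⟨v', u'⟩, that is, diag(M, 1) on pairs. The derivative part
  -- is coercive after rotation by θ because c ≤ Re θ.
  obtain ⟨z, hz, h⟩ := exists_inner_eq_of_coercive weakGraph
    ((WithLp.prodContinuousLinearEquiv 2 ℂ X X).symm.toContinuousLinearMap ∘L
      (M.prodMap (ContinuousLinearMap.id ℂ X)) ∘L
      (WithLp.prodContinuousLinearEquiv 2 ℂ X X).toContinuousLinearMap) θ hc (by
        intro v _
        rw [WithLp.prod_norm_sq_eq_of_L2, WithLp.prod_inner_apply]
        change c * (‖v.fst‖ ^ 2 + ‖v.snd‖ ^ 2) ≤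
          (θ * (inner ℂ v.fst (M v.fst) + inner ℂ v.snd v.snd)).re
        have h1 := hM v.fst
        have h2 : c * ‖v.snd‖ ^ 2 ≤ (θ * inner ℂ v.snd v.snd).re := by
          rw [inner_self_eq_norm_sq_to_K]
          have : (θ * ((‖v.snd‖ : ℝ) : ℂ) ^ 2).re = θ.re * ‖v.snd‖ ^ 2 := by
            rw [← Complex.ofReal_pow, Complex.re_mul_ofReal]
          exact (mul_le_mul_of_nonneg_right hθ (sq_nonneg _)).trans this.ge
        rw [mul_add, mul_add, Complex.add_re]
        exact add_le_add h1 h2) (WithLp.toLp 2 (f, 0))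
  refine ⟨z.fst, z.snd, hz, fun φ hφ => ?_⟩
  have h1 := h (WithLp.toLp 2 (lpOf φ, lpOf (deriv φ))) (hasWeakDeriv_test hφ)
  rw [WithLp.prod_inner_apply, WithLp.prod_inner_apply] at h1
  have h2 : inner ℂ (lpOf φ) (M z.fst) + inner ℂ (lpOf (deriv φ)) z.snd =
      inner ℂ (lpOf φ) f + inner ℂ (lpOf (deriv φ)) (0 : X) := h1
  rw [inner_zero_right] at h2
  rw [inner_sub_right]
  linear_combination h2

/-- The restrictions of `u` to the two half-lines are orthogonal, so the form splits as p‖u₊‖² +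
q‖u₋‖². -/
lemma re_mul_inner_mulS (θ p q : ℂ) {c : ℝ} (hp : c ≤ (θ * p).re) (hq : c ≤ (θ * q).re) (u : X) :
    c * ‖u‖ ^ 2 ≤ (θ * inner ℂ u (mulS p q u)).re := by
  have hself : ∀ v : X, inner ℂ v v = ((‖v‖ ^ 2 : ℝ) : ℂ) := by
    intro v
    rw [inner_self_eq_norm_sq_to_K]
    norm_cast
  have hP : inner ℂ u (mulS 1 0 u) = ((‖mulS 1 0 u‖ ^ 2 : ℝ) : ℂ) := by
    rw [← hself, inner_mulS_left, mulS_mulS]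
    simp
  have hQ : inner ℂ u (mulS 0 1 u) = ((‖mulS 0 1 u‖ ^ 2 : ℝ) : ℂ) := by
    rw [← hself, inner_mulS_left, mulS_mulS]
    simp
  have hsum : ‖u‖ ^ 2 = ‖mulS 1 0 u‖ ^ 2 + ‖mulS 0 1 u‖ ^ 2 := by
    have : ((‖u‖ ^ 2 : ℝ) : ℂ) = ((‖mulS 1 0 u‖ ^ 2 + ‖mulS 0 1 u‖ ^ 2 : ℝ) : ℂ) := by
      rw [Complex.ofReal_add, ← hP, ← hQ, ← hself, ← inner_add_right, mulS_add_mulS]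
      simp [mulS_self]
    exact_mod_cast this
  have hd : mulS p q u = p • mulS 1 0 u + q • mulS 0 1 u := by
    rw [smul_mulS, smul_mulS, mulS_add_mulS]
    simp
  have hre : (θ * inner ℂ u (mulS p q u)).re =
      (θ * p).re * ‖mulS 1 0 u‖ ^ 2 + (θ * q).re * ‖mulS 0 1 u‖ ^ 2 := by
    rw [hd, inner_add_right, inner_smul_right, inner_smul_right, hP, hQ, mul_add, ← mul_assoc,
      ← mul_assoc, Complex.add_re, Complex.re_mul_ofReal, Complex.re_mul_ofReal]
  rw [hre, hsum, mul_add]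
  gcongr

/-- Solvability of `-v'' + W v = f` in `H²(ℝ)`, where `W` is the step function with
values `p` and `q`, provided that one rotation makes the form coercive. -/
lemma exists_resolvent_step (θ p q : ℂ) (hθ : 0 < θ.re) (hp : 0 < (θ * p).re)
    (hq : 0 < (θ * q).re) (f : X) :
    ∃ v v' : X, HasWeakDeriv v v' ∧ HasWeakDeriv v' (mulS p q v - f) :=
  exists_resolvent (mulS p q) θ (c := min θ.re (min (θ * p).re (θ * q).re))
    (lt_min hθ (lt_min hp hq)) (min_le_left _ _)
    (re_mul_inner_mulS θ p q ((min_le_right _ _).trans (min_le_left _ _))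
      ((min_le_right _ _).trans (min_le_right _ _))) f

/-- Since κ̄ κ² = |κ|² κ, the rotation by κ̄ makes the form of -∂² + κ² coercive. -/
lemma re_conj_mul_sq_pos {κ : ℂ} (hκ : 0 < κ.re) : 0 < (conj κ * κ ^ 2).re := by
  have h : conj κ * κ ^ 2 = κ * ((Complex.normSq κ : ℝ) : ℂ) := by
    rw [Complex.normSq_eq_conj_mul_self]
    ring
  rw [h, Complex.re_mul_ofReal]
  refine mul_pos hκ (Complex.normSq_pos.mpr ?_)
  rintro rfl
  simp at hκ

/-- Solvability of `-v'' + κ² v = f` in `H²(ℝ)`. -/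
lemma exists_resolvent_const {κ : ℂ} (hκ : 0 < κ.re) (f : X) :
    ∃ v v' : X, HasWeakDeriv v v' ∧ HasWeakDeriv v' (κ ^ 2 • v - f) := by
  have h := exists_resolvent_step (conj κ) (κ ^ 2) (κ ^ 2) (by simpa using hκ)
    (re_conj_mul_sq_pos hκ) (re_conj_mul_sq_pos hκ) f
  simpa only [mulS_self] using h

/-- The energy identity for `-v'' + r v = f`. -/
lemma energy_identity {r : ℂ} {v v' f : X} (hv : HasWeakDeriv v v')
    (hv' : HasWeakDeriv v' (r • v - f)) :
    ((‖v'‖ ^ 2 : ℝ) : ℂ) + r * ((‖v‖ ^ 2 : ℝ) : ℂ) = inner ℂ v f := by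
  have h := hv.inner_eq hv'
  rw [inner_sub_right, inner_smul_right, inner_self_eq_norm_sq_to_K,
    inner_self_eq_norm_sq_to_K] at h
  have h1 : ∀ t : ℝ, ((t ^ 2 : ℝ) : ℂ) = ((t : ℝ) : ℂ) ^ 2 := fun t => by push_cast; rfl
  rw [h1, h1]
  change ((‖v'‖ : ℝ) : ℂ) ^ 2 = -(r * ((‖v‖ : ℝ) : ℂ) ^ 2 - inner ℂ v f) at h
  linear_combination h

lemma energy_identity_real {r : ℝ} {v v' f : X} (hv : HasWeakDeriv v v')
    (hv' : HasWeakDeriv v' ((r : ℂ) • v - f)) :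
    ‖v'‖ ^ 2 + r * ‖v‖ ^ 2 ≤ ‖v‖ * ‖f‖ := by
  have h := energy_identity hv hv'
  have h1 : (inner ℂ v f : ℂ) = ((‖v'‖ ^ 2 + r * ‖v‖ ^ 2 : ℝ) : ℂ) := by
    rw [← h]
    push_cast
    rfl
  calc ‖v'‖ ^ 2 + r * ‖v‖ ^ 2 = (inner ℂ v f : ℂ).re := by rw [h1, Complex.ofReal_re]
    _ ≤ ‖(inner ℂ v f : ℂ)‖ := Complex.re_le_norm _
    _ ≤ ‖v‖ * ‖f‖ := norm_inner_le_norm _ _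

/-- A priori bounds for `-v'' + k² v = f`. -/
lemma resolvent_bounds {k : ℝ} (hk : k ≠ 0) {v v' f : X} (hv : HasWeakDeriv v v')
    (hv' : HasWeakDeriv v' ((k : ℂ) ^ 2 • v - f)) :
    k ^ 2 * ‖v‖ ≤ ‖f‖ ∧ |k| * ‖v'‖ ≤ ‖f‖ := by
  have hk2 : 0 < k ^ 2 := by positivity
  have h := energy_identity_real (r := k ^ 2) hv (by push_cast; exact hv')
  have h1 : k ^ 2 * ‖v‖ ≤ ‖f‖ := by
    rcases eq_or_lt_of_le (norm_nonneg v) with h0 | h0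
    · rw [← h0, mul_zero]
      exact norm_nonneg f
    · refine le_of_mul_le_mul_left ?_ h0
      nlinarith [sq_nonneg ‖v'‖]
  refine ⟨h1, abs_le_of_sq_le_sq' ?_ (norm_nonneg f) |>.2⟩
  rw [mul_pow, sq_abs]
  have h2 : ‖v'‖ ^ 2 ≤ ‖v‖ * ‖f‖ := by nlinarith [sq_nonneg ‖v‖, mul_nonneg hk2.le (sq_nonneg ‖v‖)]
  calc k ^ 2 * ‖v'‖ ^ 2 ≤ k ^ 2 * (‖v‖ * ‖f‖) := by gcongr
    _ = (k ^ 2 * ‖v‖) * ‖f‖ := by ring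
    _ ≤ ‖f‖ * ‖f‖ := by gcongr
    _ = ‖f‖ ^ 2 := by ring

end Maxwell1D

end

noncomputable section

namespace Maxwell1D

open scoped ComplexConjugate

/-! ### Components of vector fields -/

/-- The `i`-th component of a vector field. -/
def comp (i : Fin 3) : L2 →L[ℂ] X :=
  (EuclideanSpace.proj i : EuclideanSpace ℂ (Fin 3) →L[ℂ] ℂ).compLpL 2 volume

lemma coeFn_comp (i : Fin 3) (u : L2) : comp i u =ᵐ[volume] fun x => u x i :=
  ContinuousLinearMap.coeFn_compLpL _ _

/-- The vector field with only the `i`-th component different from zero. -/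
def single (i : Fin 3) : X →L[ℂ] L2 :=
  (ContinuousLinearMap.toSpanSingleton ℂ (EuclideanSpace.single i (1 : ℂ))).compLpL 2 volume

lemma coeFn_single (i : Fin 3) (u : X) :
    single i u =ᵐ[volume] fun x => u x • EuclideanSpace.single i (1 : ℂ) :=
  ContinuousLinearMap.coeFn_compLpL _ _

lemma comp_single_self (i : Fin 3) (u : X) : comp i (single i u) = u := by
  refine Lp.ext ?_
  filter_upwards [coeFn_comp i (single i u), coeFn_single i u] with x h1 h2
  rw [h1, h2]
  simp

lemma comp_single_of_ne {i j : Fin 3} (h : i ≠ j) (u : X) : comp i (single j u) = 0 := by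
  refine Lp.ext ?_
  filter_upwards [coeFn_comp i (single j u), coeFn_single j u,
    Lp.coeFn_zero ℂ 2 (volume : Measure ℝ)] with x h1 h2 h3
  rw [h1, h2, h3]
  simp [h]

/-- The vector field with given components. -/
def vec (u₁ u₂ u₃ : X) : L2 := single 0 u₁ + single 1 u₂ + single 2 u₃

@[simp] lemma comp_zero_vec (u₁ u₂ u₃ : X) : comp 0 (vec u₁ u₂ u₃) = u₁ := by
  rw [vec, map_add, map_add, comp_single_self, comp_single_of_ne (by decide),
    comp_single_of_ne (by decide), add_zero, add_zero]

@[simp] lemma comp_one_vec (u₁ u₂ u₃ : X) : comp 1 (vec u₁ u₂ u₃) = u₂ := by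
  rw [vec, map_add, map_add, comp_single_self, comp_single_of_ne (by decide),
    comp_single_of_ne (by decide), add_zero, zero_add]

@[simp] lemma comp_two_vec (u₁ u₂ u₃ : X) : comp 2 (vec u₁ u₂ u₃) = u₃ := by
  rw [vec, map_add, map_add, comp_single_self, comp_single_of_ne (by decide),
    comp_single_of_ne (by decide), zero_add, zero_add]

lemma ext_comp {u v : L2} (h0 : comp 0 u = comp 0 v) (h1 : comp 1 u = comp 1 v)
    (h2 : comp 2 u = comp 2 v) : u = v := by
  refine Lp.ext ?_
  have h : ∀ i, comp i u = comp i v := by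
    intro i
    fin_cases i
    exacts [h0, h1, h2]
  have h' : ∀ i, ∀ᵐ x : ℝ, u x i = v x i := by
    intro i
    filter_upwards [coeFn_comp i u, coeFn_comp i v] with x hu hv
    rw [← hu, ← hv, h i]
  filter_upwards [ae_all_iff.mpr h'] with x hx
  ext i
  exact hx i

lemma inner_eq_sum_comp (u v : L2) : inner ℂ u v = ∑ i, inner ℂ (comp i u) (comp i v) := by
  simp_rw [L2.inner_def]
  rw [← integral_finsetSum _ fun i _ => L2.integrable_inner (comp i u) (comp i v)]
  refine integral_congr_ae ?_
  filter_upwards [ae_all_iff.mpr fun i => coeFn_comp i u, ae_all_iff.mpr fun i => coeFn_comp i v]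
    with x hu hv
  rw [PiLp.inner_apply]
  exact Finset.sum_congr rfl fun i _ => by rw [hu i, hv i]

lemma norm_sq_eq_sum_comp (u : L2) :
    ‖u‖ ^ 2 = ‖comp 0 u‖ ^ 2 + ‖comp 1 u‖ ^ 2 + ‖comp 2 u‖ ^ 2 := by
  have h := inner_eq_sum_comp u u
  simp only [inner_self_eq_norm_sq_to_K, Fin.sum_univ_three] at h
  exact_mod_cast h

lemma norm_comp_le (i : Fin 3) (u : L2) : ‖comp i u‖ ≤ ‖u‖ := by
  refine le_of_sq_le_sq ?_ (norm_nonneg u)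
  rw [norm_sq_eq_sum_comp u]
  fin_cases i <;> simp <;> nlinarith [sq_nonneg ‖comp 0 u‖, sq_nonneg ‖comp 1 u‖, sq_nonneg ‖comp 2 u‖]

lemma norm_le_sum_comp (u : L2) : ‖u‖ ≤ ‖comp 0 u‖ + ‖comp 1 u‖ + ‖comp 2 u‖ := by
  refine le_of_sq_le_sq ?_ (by positivity)
  rw [norm_sq_eq_sum_comp u]
  nlinarith [mul_nonneg (norm_nonneg (comp 0 u)) (norm_nonneg (comp 1 u)),
    mul_nonneg (norm_nonneg (comp 0 u)) (norm_nonneg (comp 2 u)),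
    mul_nonneg (norm_nonneg (comp 1 u)) (norm_nonneg (comp 2 u))]

lemma comp_mulStep (a b : ℂ) (i : Fin 3) (u : L2) :
    comp i (mulStep a b u) = mulS a b (comp i u) := by
  refine Lp.ext ?_
  have h : mulStep a b u =ᵐ[volume] fun x => stepFun a b x • u x :=
    (memLp_step a b u).coeFn_toLp
  filter_upwards [coeFn_comp i (mulStep a b u), coeFn_mulS a b (comp i u), coeFn_comp i u, h]
    with x h1 h2 h3 h4
  rw [h1, h2, h3, h4]
  rfl

/-- The distributional definitions use a bilinear pairing. Conjugating the test field turns it into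
inner products of components and, by `curl_neg_conj` and `grad_neg_conj`, turns -k into k. -/
lemma pairing_conj (u : L2) {ψ : Fin 3 → ℝ → ℂ} (hψ : ∀ i, IsTest (ψ i)) :
    pairing u (fun i x => conj (ψ i x)) = ∑ i, inner ℂ (lpOf (ψ i)) (comp i u) := by
  simp_rw [fun i => inner_lpOf_left (hψ i).memLp (comp i u)]
  rw [← integral_finsetSum _ fun i _ => integrable_mul_memLp (comp i u) (hψ i).conj.memLp]
  refine integral_congr_ae ?_
  filter_upwards [ae_all_iff.mpr fun i => coeFn_comp i u] with x hu
  exact Finset.sum_congr rfl fun i _ => by rw [hu i]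

lemma curl_neg_conj (k : ℝ) {ψ : Fin 3 → ℝ → ℂ} (hψ : ∀ i, IsTest (ψ i)) :
    curl (-k) (fun i x => conj (ψ i x)) = fun i x => conj (curl k ψ i x) := by
  funext i x
  fin_cases i
  · simp [curl]
  · simp [curl, deriv_conj (hψ 2).differentiable]
  · simp [curl, deriv_conj (hψ 1).differentiable]

lemma grad_neg_conj (k : ℝ) {ψ : ℝ → ℂ} (hψ : IsTest ψ) :
    grad (-k) (fun x => conj (ψ x)) = fun i x => conj (grad k ψ i x) := by
  funext i x
  fin_cases i
  · simp [grad, deriv_conj hψ.differentiable]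
  · simp [grad]
  · simp [grad]

lemma forall_isTest_conj {p : (Fin 3 → ℝ → ℂ) → Prop} :
    (∀ φ : Fin 3 → ℝ → ℂ, (∀ i, IsTest (φ i)) → p φ) ↔
      ∀ ψ : Fin 3 → ℝ → ℂ, (∀ i, IsTest (ψ i)) → p (fun i x => conj (ψ i x)) := by
  refine ⟨fun h ψ hψ => h _ fun i => (hψ i).conj, fun h φ hφ => ?_⟩
  simpa using h (fun i x => conj (φ i x)) fun i => (hφ i).conj

lemma lpOf_zero : lpOf (fun _ => 0) = 0 := by
  have := lpOf_const_mul (f := fun _ => 0) (MemLp.zero') 0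
  simpa using this

lemma lpOf_neg {f : ℝ → ℂ} (hf : MemLp f 2 (volume : Measure ℝ)) :
    lpOf (fun x => -f x) = -lpOf f := by
  simpa using lpOf_const_mul hf (-1)

lemma lpOf_sub {f g : ℝ → ℂ} (hf : MemLp f 2 (volume : Measure ℝ))
    (hg : MemLp g 2 (volume : Measure ℝ)) : lpOf (fun x => f x - g x) = lpOf f - lpOf g := by
  have h := lpOf_add hf (g := fun x => -g x) hg.neg
  rw [lpOf_neg hg] at h
  simpa only [← sub_eq_add_neg] using h

/-- Orthogonality to the derivatives of test functions says z' = 0, and L² contains no nonzero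
constant. -/
lemma eq_zero_of_inner_test {z : X} (h : ∀ φ : ℝ → ℂ, IsTest φ → inner ℂ (lpOf φ) z = 0) :
    z = 0 := by
  refine HasWeakDeriv.eq_zero_of_deriv_eq_smul (c := 0) fun φ hφ => ?_
  rw [h _ hφ.deriv]
  simp

lemma sum_inner_curl (k : ℝ) {ψ : Fin 3 → ℝ → ℂ} (hψ : ∀ i, IsTest (ψ i)) (u : L2) :
    ∑ i, inner ℂ (lpOf (curl k ψ i)) (comp i u) =
      -(Complex.I * k) * inner ℂ (lpOf (ψ 2)) (comp 0 u)
        - inner ℂ (lpOf (deriv (ψ 2))) (comp 1 u) + inner ℂ (lpOf (deriv (ψ 1))) (comp 2 u)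
        + Complex.I * k * inner ℂ (lpOf (ψ 0)) (comp 2 u) := by
  have h0 : lpOf (curl k ψ 0) = (Complex.I * k) • lpOf (ψ 2) := lpOf_const_mul (hψ 2).memLp _
  have h1 : lpOf (curl k ψ 1) = -lpOf (deriv (ψ 2)) := lpOf_neg (hψ 2).deriv.memLp
  have h2 : lpOf (curl k ψ 2) = lpOf (deriv (ψ 1)) - (Complex.I * k) • lpOf (ψ 0) := by
    rw [← lpOf_const_mul (hψ 0).memLp]
    exact lpOf_sub (hψ 1).deriv.memLp ((hψ 0).const_mul _).memLp
  rw [Fin.sum_univ_three, h0, h1, h2, inner_smul_left, inner_neg_left, inner_sub_left,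
    inner_smul_left]
  simp only [map_mul, Complex.conj_I, Complex.conj_ofReal]
  ring

/-- Test with one nonzero component at a time. The first equation is algebraic, and the derivative
of u₁ never enters, so u₁ may jump at the interface. -/
lemma hasWeakCurl_iff {k : ℝ} {u f : L2} : HasWeakCurl k u f ↔
    comp 0 f = (Complex.I * k) • comp 2 u ∧ HasWeakDeriv (comp 2 u) (-comp 1 f) ∧
      HasWeakDeriv (comp 1 u) (comp 2 f + (Complex.I * k) • comp 0 u) := by
  have key : HasWeakCurl k u f ↔ ∀ ψ : Fin 3 → ℝ → ℂ, (∀ i, IsTest (ψ i)) →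
      -(Complex.I * k) * inner ℂ (lpOf (ψ 2)) (comp 0 u)
        - inner ℂ (lpOf (deriv (ψ 2))) (comp 1 u) + inner ℂ (lpOf (deriv (ψ 1))) (comp 2 u)
        + Complex.I * k * inner ℂ (lpOf (ψ 0)) (comp 2 u) =
      inner ℂ (lpOf (ψ 0)) (comp 0 f) + inner ℂ (lpOf (ψ 1)) (comp 1 f)
        + inner ℂ (lpOf (ψ 2)) (comp 2 f) := by
    rw [HasWeakCurl, forall_isTest_conj]
    refine forall₂_congr fun ψ hψ => ?_
    rw [curl_neg_conj k hψ, pairing_conj u (fun i => isTest_curl hψ k i), pairing_conj f hψ,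
      sum_inner_curl k hψ, Fin.sum_univ_three]
  have hz : IsTest (fun _ => 0) := isTest_zero
  have hdz : deriv (fun _ : ℝ => (0 : ℂ)) = fun _ => 0 := by
    funext x
    simp
  rw [key]
  constructor
  · intro h
    refine ⟨?_, fun φ hφ => ?_, fun φ hφ => ?_⟩
    · rw [← sub_eq_zero]
      refine eq_zero_of_inner_test fun φ hφ => ?_
      have := h ![φ, fun _ => 0, fun _ => 0] (by
        intro i
        fin_cases i
        exacts [hφ, hz, hz])
      simp only [Matrix.cons_val_zero, Matrix.cons_val_one, Matrix.cons_val, hdz, lpOf_zero,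
        inner_zero_left] at this
      rw [inner_sub_right, inner_smul_right]
      linear_combination -this
    · have := h ![fun _ => 0, φ, fun _ => 0] (by
        intro i
        fin_cases i
        exacts [hz, hφ, hz])
      simp only [Matrix.cons_val_zero, Matrix.cons_val_one, Matrix.cons_val, hdz, lpOf_zero,
        inner_zero_left] at this
      rw [inner_neg_right]
      linear_combination this
    · have := h ![fun _ => 0, fun _ => 0, φ] (by
        intro i
        fin_cases i
        exacts [hz, hz, hφ])
      simp only [Matrix.cons_val_zero, Matrix.cons_val_one, Matrix.cons_val, hdz, lpOf_zero,
        inner_zero_left] at this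
      rw [inner_add_right, inner_smul_right]
      linear_combination -this
  · rintro ⟨h0, h1, h2⟩ ψ hψ
    have e1 := h1 _ (hψ 1)
    have e2 := h2 _ (hψ 2)
    rw [inner_neg_right] at e1
    rw [inner_add_right, inner_smul_right] at e2
    rw [h0, inner_smul_right]
    linear_combination e1 - e2

lemma isDivFree_iff {k : ℝ} {v : L2} :
    IsDivFree k v ↔ HasWeakDeriv (comp 0 v) (-(Complex.I * k) • comp 1 v) := by
  have key : ∀ ψ : ℝ → ℂ, IsTest ψ → pairing v (grad (-k) fun x => conj (ψ x)) =
      inner ℂ (lpOf (deriv ψ)) (comp 0 v) - Complex.I * k * inner ℂ (lpOf ψ) (comp 1 v) := by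
    intro ψ hψ
    rw [grad_neg_conj k hψ, pairing_conj v fun i => isTest_grad hψ k i, Fin.sum_univ_three]
    have h0 : lpOf (grad k ψ 0) = lpOf (deriv ψ) := rfl
    have h1 : lpOf (grad k ψ 1) = (Complex.I * k) • lpOf ψ := lpOf_const_mul hψ.memLp _
    have h2 : lpOf (grad k ψ 2) = 0 := lpOf_zero
    rw [h0, h1, h2, inner_smul_left, inner_zero_left]
    simp only [map_mul, Complex.conj_I, Complex.conj_ofReal]
    ring
  constructor
  · intro h ψ hψ
    have h1 := h _ hψ.conj
    rw [key ψ hψ] at h1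
    rw [inner_smul_right]
    linear_combination h1
  · intro h φ hφ
    have h1 := h _ hφ.conj
    have h2 := key _ hφ.conj
    simp only [Complex.conj_conj] at h2
    rw [inner_smul_right] at h1
    rw [h2]
    linear_combination h1

lemma HasWeakCurl.hasWeakCurlCurl_iff {k : ℝ} {u f g : L2} (h : HasWeakCurl k u f) :
    HasWeakCurlCurl k u g ↔ HasWeakCurl k f g :=
  forall₂_congr fun φ hφ => by rw [h _ (isTest_curl hφ _)]

/-- The componentwise form of `∇_k × ∇_k × u = g`, where `m` is the third component of `∇_k × u`
and `p` is the derivative of `u₃`. -/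
structure CurlCurlData (k : ℝ) (u g : L2) (m p : X) : Prop where
  deriv_one : HasWeakDeriv (comp 1 u) (m + (Complex.I * k) • comp 0 u)
  deriv_m : HasWeakDeriv m (-comp 1 g)
  zero_eq : comp 0 g = (Complex.I * k) • m
  deriv_two : HasWeakDeriv (comp 2 u) p
  deriv_p : HasWeakDeriv p ((k : ℂ) ^ 2 • comp 2 u - comp 2 g)

lemma I_mul_mul_self (k : ℝ) : Complex.I * k * (Complex.I * k) = -(k : ℂ) ^ 2 := by
  linear_combination (k : ℂ) ^ 2 * Complex.I_mul_I

/-- The intermediate field is ∇_k × u = (i k u₃, -p, m). As it belongs to L², the second order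
problem is a first order system in which u₃ decouples from (u₁, u₂); all later arguments use this
system. -/
lemma exists_curlCurlData_iff {k : ℝ} {u g : L2} :
    (∃ m p, CurlCurlData k u g m p) ↔ (∃ f, HasWeakCurl k u f) ∧ HasWeakCurlCurl k u g := by
  constructor
  · rintro ⟨m, p, h⟩
    have hf : HasWeakCurl k u (vec ((Complex.I * k) • comp 2 u) (-p) m) := by
      rw [hasWeakCurl_iff]
      simp only [comp_zero_vec, comp_one_vec, comp_two_vec, neg_neg]
      exact ⟨trivial, h.deriv_two, h.deriv_one⟩
    refine ⟨⟨_, hf⟩, hf.hasWeakCurlCurl_iff.mpr ?_⟩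
    rw [hasWeakCurl_iff]
    simp only [comp_zero_vec, comp_one_vec, comp_two_vec]
    refine ⟨h.zero_eq, h.deriv_m, ?_⟩
    convert h.deriv_p.neg using 1
    rw [smul_smul, I_mul_mul_self, neg_smul, neg_sub, sub_eq_add_neg]
  · rintro ⟨⟨f, hf⟩, hg⟩
    rw [hf.hasWeakCurlCurl_iff, hasWeakCurl_iff] at hg
    rw [hasWeakCurl_iff] at hf
    refine ⟨comp 2 f, -comp 1 f, hf.2.2, hg.2.1, hg.1, hf.2.1, ?_⟩
    convert hg.2.2.neg using 1
    rw [hf.1, smul_smul, I_mul_mul_self, neg_smul, neg_add, neg_neg, add_comm, sub_eq_add_neg]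

lemma mem_domain_iff {k : ℝ} {a b : ℂ} {u : L2} : u ∈ domain k a b ↔
    (∃ g m p, CurlCurlData k u g m p) ∧
      HasWeakDeriv (mulS a b (comp 0 u)) (-(Complex.I * k) • mulS a b (comp 1 u)) := by
  have h : IsDivFree k (mulStep a b u) ↔
      HasWeakDeriv (mulS a b (comp 0 u)) (-(Complex.I * k) • mulS a b (comp 1 u)) := by
    rw [isDivFree_iff, comp_mulStep, comp_mulStep]
  change ((∃ f : L2, HasWeakCurl k u f) ∧ (∃ g : L2, HasWeakCurlCurl k u g) ∧
    IsDivFree k (mulStep a b u)) ↔ _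
  rw [h, ← and_assoc]
  refine and_congr_left fun _ => ?_
  simp_rw [exists_curlCurlData_iff]
  exact ⟨fun ⟨h1, g, hg⟩ => ⟨g, h1, hg⟩, fun ⟨g, h1, hg⟩ => ⟨h1, g, hg⟩⟩

lemma curlCurlOp_eq_iff {k : ℝ} {a b : ℂ} {u : domain k a b} {g : rangeSpace k} :
    curlCurlOp k a b u = g ↔ ∃ m p, CurlCurlData k u g m p := by
  rw [exists_curlCurlData_iff]
  constructor
  · rintro rfl
    exact ⟨u.2.1, curlCurlOp_spec k a b u⟩
  · intro h
    exact hasWeakCurlCurl_unique (curlCurlOp_spec k a b u) h.2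

lemma exists_curlCurlData {k : ℝ} {a b : ℂ} (u : domain k a b) :
    ∃ m p, CurlCurlData k u (curlCurlOp k a b u : L2) m p :=
  curlCurlOp_eq_iff.mp rfl

lemma mem_rangeSpace_iff {k : ℝ} {f : L2} :
    f ∈ rangeSpace k ↔ HasWeakDeriv (comp 0 f) (-(Complex.I * k) • comp 1 f) :=
  isDivFree_iff

lemma hasWeakDeriv_mulS_of_mem_domain {k : ℝ} {a b : ℂ} (u : domain k a b) :
    HasWeakDeriv (mulS a b (comp 0 u.1)) (-(Complex.I * k) • mulS a b (comp 1 u.1)) :=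
  (mem_domain_iff.mp u.2).2

/-- It is the preimage of the closed graph of the weak derivative under a continuous map.
Completeness of the target space is needed for projections onto closed ranges. -/
lemma isClosed_rangeSpace (k : ℝ) : IsClosed (rangeSpace k : Set L2) := by
  have h : (rangeSpace k : Set L2) = (fun f : L2 =>
      (WithLp.toLp 2 (comp 0 f, -(Complex.I * k) • comp 1 f) : WithLp 2 (X × X))) ⁻¹'
        (weakGraph : Set (WithLp 2 (X × X))) := by
    ext f
    exact mem_rangeSpace_iff
  rw [h]
  refine isClosed_weakGraph.preimage ?_
  fun_prop

instance (k : ℝ) : CompleteSpace (rangeSpace k) := (isClosed_rangeSpace k).completeSpace_coe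

end Maxwell1D

end

noncomputable section

/-! ### Orthonormal sequences and ranges of operators -/

lemma Orthonormal.tendsto_inner_zero {E : Type*} [NormedAddCommGroup E] [InnerProductSpace ℂ E]
    {h : ℕ → E} (hh : Orthonormal ℂ h) (v : E) :
    Tendsto (fun n => inner ℂ v (h n)) atTop (𝓝 0) := by
  rw [tendsto_zero_iff_norm_tendsto_zero]
  have h1 := (hh.inner_products_summable v).tendsto_atTop_zero
  have h2 := h1.sqrt
  simpa [norm_inner_symm] using h2

/-- If an orthonormal sequence is asymptotically annihilated by the adjoint of `T`, then the range
of `T` is not a closed subspace of finite codimension. -/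
lemma not_isClosed_range_and_finiteDimensional_quotient {D R : Type*} [AddCommGroup D] [Module ℂ D]
    [NormedAddCommGroup R] [InnerProductSpace ℂ R] [CompleteSpace R] (T : D →ₗ[ℂ] R) {h : ℕ → R}
    (hh : Orthonormal ℂ h) {ε : ℕ → ℝ} (hε : Tendsto ε atTop (𝓝 0))
    (hT : ∀ u, ∃ C : ℝ, ∀ n, ‖inner ℂ (h n) (T u)‖ ≤ C * ε n) :
    ¬(IsClosed (LinearMap.range T : Set R) ∧ FiniteDimensional ℂ (R ⧸ LinearMap.range T)) := by
  rintro ⟨hcl, hfin⟩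
  set K := LinearMap.range T with hK
  have hKc : CompleteSpace K := hcl.completeSpace_coe
  have hKo : FiniteDimensional ℂ Kᗮ := K.quotientEquivOrthogonal.toLinearEquiv.finiteDimensional
  -- A strictly positive null sequence dominating `ε`, so that dividing by it is allowed.
  set δ : ℕ → ℝ := fun n => |ε n| + 1 / ((n : ℝ) + 1) with hδ
  have hδ0 : ∀ n, 0 < δ n := fun n => by positivity
  have hδt : Tendsto δ atTop (𝓝 0) := by
    have := hε.abs.add (tendsto_one_div_add_atTop_nhds_zero_nat (𝕜 := ℝ))
    rwa [abs_zero, add_zero] at this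
  set ℓ : ℕ → K →L[ℂ] ℂ := fun n =>
    (((δ n)⁻¹ : ℝ) : ℂ) • (innerSL ℂ (h n) ∘L K.subtypeL) with hℓ
  have hℓa : ∀ n (x : K), ‖ℓ n x‖ = (δ n)⁻¹ * ‖inner ℂ (h n) (x : R)‖ := by
    intro n x
    change ‖(((δ n)⁻¹ : ℝ) : ℂ) * inner ℂ (h n) (x : R)‖ = _
    rw [norm_mul, Complex.norm_real, Real.norm_of_nonneg (inv_nonneg.mpr (hδ0 n).le)]
  -- The functionals ⟨h n, ·⟩ / δ n are pointwise bounded on the range, which is complete when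
  -- closed. So they are uniformly bounded, and the projection of `h n` onto the range has norm at
  -- most C δ n.
  obtain ⟨C, hC⟩ := banach_steinhaus (g := ℓ) (by
    rintro ⟨x, u, rfl⟩
    obtain ⟨C, hC⟩ := hT u
    refine ⟨|C|, fun n => ?_⟩
    rw [hℓa, inv_mul_le_iff₀ (hδ0 n)]
    calc ‖inner ℂ (h n) (T u)‖ ≤ C * ε n := hC n
      _ ≤ |C * ε n| := le_abs_self _
      _ = |ε n| * |C| := by rw [abs_mul, mul_comm]
      _ ≤ δ n * |C| := by
        gcongr
        rw [hδ]
        have : (0 : ℝ) ≤ 1 / ((n : ℝ) + 1) := by positivity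
        linarith)
  have hproj : ∀ n, ‖K.starProjection (h n)‖ ≤ δ n * C := by
    intro n
    rcases eq_or_ne (K.starProjection (h n)) 0 with h0 | h0
    · rw [h0, norm_zero]
      exact mul_nonneg (hδ0 n).le ((norm_nonneg _).trans (hC n))
    · have hp : 0 < ‖K.starProjection (h n)‖ := norm_pos_iff.mpr h0
      have hin : inner ℂ (h n) (K.starProjection (h n)) =
          ((‖K.starProjection (h n)‖ : ℝ) : ℂ) ^ 2 := by
        have h1 := Submodule.starProjection_inner_eq_zero (K := K) (h n) (K.starProjection (h n))
          (K.starProjection_apply_mem _)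
        rw [inner_sub_left, sub_eq_zero] at h1
        rw [h1, inner_self_eq_norm_sq_to_K]
        rfl
      have h2 := (ℓ n).le_of_opNorm_le (hC n) ⟨K.starProjection (h n), K.starProjection_apply_mem _⟩
      rw [hℓa, inv_mul_le_iff₀ (hδ0 n), hin, norm_pow, Complex.norm_real, norm_norm] at h2
      refine le_of_mul_le_mul_right ?_ hp
      rw [← sq]
      calc ‖K.starProjection (h n)‖ ^ 2 ≤ δ n * (C * ‖K.starProjection (h n)‖) := h2
        _ = _ := by ring
  have hproj0 : Tendsto (fun n => ‖K.starProjection (h n)‖ ^ 2) atTop (𝓝 0) := by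
    have h1 : Tendsto (fun n => δ n * C) atTop (𝓝 0) := by simpa using hδt.mul_const C
    have h2 := squeeze_zero (fun n => norm_nonneg _) hproj h1
    simpa using h2.pow 2
  -- The complement is finite-dimensional and orthonormal sequences are weakly null. Both
  -- projections tend to zero, which is impossible for unit vectors.
  have horth0 : Tendsto (fun n => ‖Kᗮ.starProjection (h n)‖ ^ 2) atTop (𝓝 0) := by
    set b := stdOrthonormalBasis ℂ Kᗮ
    have h1 : ∀ n, ‖Kᗮ.starProjection (h n)‖ ^ 2 = ∑ i, ‖inner ℂ ((b i : Kᗮ) : R) (h n)‖ ^ 2 := by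
      intro n
      have := b.sum_sq_norm_inner_right (Kᗮ.orthogonalProjectionOnto (h n))
      change ‖(Kᗮ.orthogonalProjectionOnto (h n))‖ ^ 2 = _
      rw [← this]
      refine Finset.sum_congr rfl fun i _ => ?_
      rw [Submodule.inner_orthogonalProjectionOnto_eq_of_mem_left]
    simp_rw [h1]
    have h2 : Tendsto (fun n => ∑ i, ‖inner ℂ ((b i : Kᗮ) : R) (h n)‖ ^ 2) atTop
        (𝓝 (∑ i : Fin (Module.finrank ℂ Kᗮ), (0 : ℝ))) := by
      refine tendsto_finsetSum _ fun i _ => ?_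
      simpa using ((hh.tendsto_inner_zero ((b i : Kᗮ) : R)).norm).pow 2
    simpa using h2
  have hone : ∀ n, ‖K.starProjection (h n)‖ ^ 2 + ‖Kᗮ.starProjection (h n)‖ ^ 2 = 1 := by
    intro n
    rw [← Submodule.norm_sq_eq_add_norm_sq_starProjection, hh.1 n, one_pow]
  have hlim := hproj0.add horth0
  simp_rw [hone] at hlim
  have := tendsto_nhds_unique hlim tendsto_const_nhds
  norm_num at this

namespace Maxwell1D

open scoped ComplexConjugate

/-! ### Wave packets -/

/-- The modulated and dilated profile `β (c x) exp (i ξ x)`. -/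
def packet (β : ℝ → ℂ) (ξ c : ℝ) (x : ℝ) : ℂ := Complex.exp (Complex.I * ξ * x) * β (c * x)

lemma IsTest.packet {β : ℝ → ℂ} (hβ : IsTest β) (ξ : ℝ) {c : ℝ} (hc : c ≠ 0) :
    IsTest (packet β ξ c) := by
  refine IsTest.mul_left (contDiff_cexp_mul _) ⟨hβ.1.comp (contDiff_const.mul contDiff_id), ?_⟩
  exact hβ.2.comp_homeomorph (Homeomorph.mulLeft₀ c hc)

lemma deriv_packet {β : ℝ → ℂ} (hβ : IsTest β) (ξ c : ℝ) :
    deriv (packet β ξ c) = fun x =>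
      (c : ℂ) * packet (deriv β) ξ c x + Complex.I * ξ * packet β ξ c x := by
  funext x
  have h1 : HasDerivAt (fun x => β (c * x)) ((c : ℂ) * deriv β (c * x)) x := by
    have h2 : HasDerivAt (fun x : ℝ => c * x) c x := by
      simpa using (hasDerivAt_id x).const_mul c
    have h3 := (hβ.differentiable (c * x)).hasDerivAt.scomp x h2
    rwa [Complex.real_smul] at h3
  refine ((hasDerivAt_cexp_mul _ x).mul h1).deriv.trans ?_
  unfold packet
  ring

lemma norm_sq_lpOf {f : ℝ → ℂ} (hf : MemLp f 2 (volume : Measure ℝ)) :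
    ‖lpOf f‖ ^ 2 = ∫ x, ‖f x‖ ^ 2 := by
  have h := inner_lpOf_lpOf hf hf
  rw [inner_self_eq_norm_sq_to_K] at h
  have h1 : ∀ x, f x * conj (f x) = ((‖f x‖ ^ 2 : ℝ) : ℂ) := by
    intro x
    rw [Complex.mul_conj, Complex.normSq_eq_norm_sq]
  simp_rw [h1, integral_complex_ofReal] at h
  refine Complex.ofReal_injective ?_
  rw [← h, Complex.ofReal_pow]
  rfl

lemma norm_sq_packet {β : ℝ → ℂ} (hβ : IsTest β) (ξ : ℝ) {c : ℝ} (hc : c ≠ 0) :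
    ‖lpOf (packet β ξ c)‖ ^ 2 = |c|⁻¹ * ‖lpOf β‖ ^ 2 := by
  rw [norm_sq_lpOf (hβ.packet ξ hc).memLp, norm_sq_lpOf hβ.memLp]
  have h : ∀ x, ‖packet β ξ c x‖ ^ 2 = ‖β (c * x)‖ ^ 2 := by
    intro x
    rw [packet, norm_mul, Complex.norm_exp]
    simp
  simp_rw [h]
  rw [Measure.integral_comp_mul_left (fun y => ‖β y‖ ^ 2) c, abs_inv, smul_eq_mul]

lemma norm_packet {β : ℝ → ℂ} (hβ : IsTest β) (ξ : ℝ) {c : ℝ} (hc : c ≠ 0) :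
    ‖lpOf (packet β ξ c)‖ = √(|c|⁻¹) * ‖lpOf β‖ := by
  rw [← Real.sqrt_sq (norm_nonneg (lpOf (packet β ξ c))), norm_sq_packet hβ ξ hc,
    Real.sqrt_mul (by positivity), Real.sqrt_sq (norm_nonneg _)]

/-- The terms in which both derivatives fall on exp(iξx) cancel against ξ². Each derivative of the
envelope costs a factor c, so the defect is O(|c|) relative to the norm of the packet. -/
lemma norm_packet_defect_le {β : ℝ → ℂ} (hβ : IsTest β) (ξ : ℝ) {c : ℝ} (hc : c ≠ 0)
    (hc1 : |c| ≤ 1) :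
    ‖lpOf (deriv (deriv (packet β ξ c))) + ((ξ : ℂ) ^ 2) • lpOf (packet β ξ c)‖ ≤
      |c| * (√(|c|⁻¹) * (‖lpOf (deriv (deriv β))‖ + 2 * |ξ| * ‖lpOf (deriv β)‖)) := by
  have hp : ∀ {γ : ℝ → ℂ}, IsTest γ → MemLp (packet γ ξ c) 2 (volume : Measure ℝ) :=
    fun hγ => (hγ.packet ξ hc).memLp
  have hd : ∀ {γ : ℝ → ℂ}, IsTest γ → lpOf (deriv (packet γ ξ c)) =
      (c : ℂ) • lpOf (packet (deriv γ) ξ c) + (Complex.I * ξ) • lpOf (packet γ ξ c) := by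
    intro γ hγ
    rw [deriv_packet hγ, lpOf_add ((hp hγ.deriv).const_mul _) ((hp hγ).const_mul _),
      lpOf_const_mul (hp hγ.deriv), lpOf_const_mul (hp hγ)]
  have h2 : lpOf (deriv (deriv (packet β ξ c))) =
      (c : ℂ) • lpOf (deriv (packet (deriv β) ξ c)) +
        (Complex.I * ξ) • lpOf (deriv (packet β ξ c)) := by
    have e : deriv (deriv (packet β ξ c)) = fun x => (c : ℂ) * deriv (packet (deriv β) ξ c) x
        + Complex.I * ξ * deriv (packet β ξ c) x := by
      rw [deriv_packet hβ]
      funext x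
      exact ((((hβ.deriv.packet ξ hc).differentiable x).hasDerivAt.const_mul _).add
        (((hβ.packet ξ hc).differentiable x).hasDerivAt.const_mul _)).deriv.trans
          (by rw [deriv_packet hβ])
    rw [e, lpOf_add ((hβ.deriv.packet ξ hc).deriv.memLp.const_mul _)
      ((hβ.packet ξ hc).deriv.memLp.const_mul _),
      lpOf_const_mul (hβ.deriv.packet ξ hc).deriv.memLp,
      lpOf_const_mul (hβ.packet ξ hc).deriv.memLp]
  have h3 : lpOf (deriv (deriv (packet β ξ c))) + ((ξ : ℂ) ^ 2) • lpOf (packet β ξ c) =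
      ((c : ℂ) ^ 2) • lpOf (packet (deriv (deriv β)) ξ c) +
        (2 * (c : ℂ) * (Complex.I * ξ)) • lpOf (packet (deriv β) ξ c) := by
    rw [h2, hd hβ, hd hβ.deriv]
    match_scalars <;> ring_nf <;> simp [Complex.I_sq]
  rw [h3]
  have hc0 : 0 ≤ |c| := abs_nonneg c
  calc _ ≤ |c| ^ 2 * (√(|c|⁻¹) * ‖lpOf (deriv (deriv β))‖) +
        2 * |c| * |ξ| * (√(|c|⁻¹) * ‖lpOf (deriv β)‖) := by
        refine (norm_add_le _ _).trans (le_of_eq ?_)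
        rw [norm_smul, norm_smul, norm_packet hβ.deriv ξ hc, norm_packet hβ.deriv.deriv ξ hc]
        simp only [norm_pow, norm_mul, Complex.norm_real, Complex.norm_I, Real.norm_eq_abs,
          one_mul, RCLike.norm_ofNat]
    _ ≤ |c| * 1 * (√(|c|⁻¹) * ‖lpOf (deriv (deriv β))‖) +
        2 * |c| * |ξ| * (√(|c|⁻¹) * ‖lpOf (deriv β)‖) := by
        rw [sq]
        gcongr
    _ = |c| * (√(|c|⁻¹) * (‖lpOf (deriv (deriv β))‖ + 2 * |ξ| * ‖lpOf (deriv β)‖)) := by ring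

/-- A fixed bump function supported in `(1, 2)`. -/
def profileBump : ContDiffBump (3 / 2 : ℝ) where
  rIn := 1 / 4
  rOut := 1 / 2
  rIn_pos := by norm_num
  rIn_lt_rOut := by norm_num

/-- The profile of the wave packets. -/
def profile (x : ℝ) : ℂ := (profileBump x : ℂ)

lemma isTest_profile : IsTest profile :=
  ⟨Complex.ofRealCLM.contDiff.comp profileBump.contDiff,
    profileBump.hasCompactSupport.comp_left Complex.ofReal_zero⟩

lemma profile_ne_zero_iff {x : ℝ} : profile x ≠ 0 ↔ 1 < x ∧ x < 2 := by
  have h1 : profile x ≠ 0 ↔ x ∈ Function.support profileBump := by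
    rw [Function.mem_support, profile, Ne, Complex.ofReal_eq_zero]
  rw [h1, ContDiffBump.support_eq, Real.ball_eq_Ioo, Set.mem_Ioo]
  change 3 / 2 - 1 / 2 < x ∧ x < 3 / 2 + 1 / 2 ↔ _
  norm_num

lemma lpOf_ne_zero {f : ℝ → ℂ} (hf : IsTest f) {x : ℝ} (hx : f x ≠ 0) : lpOf f ≠ 0 := by
  intro h0
  have h1 : f =ᵐ[volume] fun _ => (0 : ℂ) := by
    have := coeFn_lpOf hf.memLp
    rw [h0] at this
    exact this.symm.trans (Lp.coeFn_zero ℂ 2 (volume : Measure ℝ))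
  have h2 := Continuous.ae_eq_iff_eq (volume : Measure ℝ) hf.1.continuous continuous_const |>.mp h1
  exact hx (congrFun h2 x)

lemma lpOf_profile_pos : 0 < ‖lpOf profile‖ :=
  norm_pos_iff.mpr (lpOf_ne_zero isTest_profile (profile_ne_zero_iff.mpr
    (by norm_num : (1 : ℝ) < 3 / 2 ∧ (3 / 2 : ℝ) < 2)))

lemma inner_lpOf_eq_zero {f g : ℝ → ℂ} (hf : IsTest f) (hg : IsTest g)
    (h : ∀ x, f x = 0 ∨ g x = 0) : inner ℂ (lpOf f) (lpOf g) = 0 := by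
  rw [inner_lpOf_lpOf hf.memLp hg.memLp, ← integral_zero ℝ ℂ (μ := volume)]
  refine integral_congr_ae (Eventually.of_forall fun x => ?_)
  rcases h x with h | h <;> simp [h]

/-- Normalised wave packets of frequency `ξ` on one side (given by the sign `σ`) of the
interface, with disjoint supports. -/
lemma exists_wavePackets (ξ : ℝ) {σ : ℝ} (hσ : σ = 1 ∨ σ = -1) : ∃ h : ℕ → ℝ → ℂ,
    (∀ n, IsTest (h n)) ∧ (∀ n, ‖lpOf (h n)‖ = 1) ∧ (∀ n x, σ * x < 1 → h n x = 0) ∧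
    (∀ n m, n ≠ m → ∀ x, h n x = 0 ∨ h m x = 0) ∧
    Tendsto (fun n => ‖lpOf (deriv (deriv (h n))) + ((ξ : ℂ) ^ 2) • lpOf (h n)‖) atTop (𝓝 0) := by
  have hσ0 : σ ≠ 0 := by rcases hσ with rfl | rfl <;> norm_num
  have hσ2 : σ * σ = 1 := by rcases hσ with rfl | rfl <;> norm_num
  have hσa : |σ| = 1 := by rcases hσ with rfl | rfl <;> norm_num
  -- The profile lives on (1, 2), so these dyadic dilations live on 2ⁿ < σx < 2ⁿ⁺¹: disjoint, on the
  -- chosen side, and at distance at least 1 from the interface.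
  set c : ℕ → ℝ := fun n => σ / 2 ^ n with hc
  have hc0 : ∀ n, c n ≠ 0 := fun n => div_ne_zero hσ0 (by positivity)
  have hca : ∀ n, |c n| = (1 / 2) ^ n := by
    intro n
    rw [hc, abs_div, hσa, abs_of_pos (by positivity : (0 : ℝ) < 2 ^ n), one_div_pow]
  have hc1 : ∀ n, |c n| ≤ 1 := fun n => by
    rw [hca]
    exact pow_le_one₀ (by norm_num) (by norm_num)
  set N : ℕ → ℝ := fun n => √(|c n|⁻¹) * ‖lpOf profile‖ with hN
  have hN0 : ∀ n, 0 < N n := fun n =>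
    mul_pos (Real.sqrt_pos.mpr (inv_pos.mpr (abs_pos.mpr (hc0 n)))) lpOf_profile_pos
  have hsupp : ∀ n x, packet profile ξ (c n) x ≠ 0 → (2 : ℝ) ^ n < σ * x ∧ σ * x < 2 ^ (n + 1) := by
    intro n x hx
    have h1 := profile_ne_zero_iff.mp (right_ne_zero_of_mul hx)
    have h2 : c n * x = σ * x / 2 ^ n := by rw [hc]; ring
    rw [h2, lt_div_iff₀ (by positivity), div_lt_iff₀ (by positivity), one_mul] at h1
    exact ⟨h1.1, by rw [pow_succ']; exact h1.2⟩
  set C : ℝ := ‖lpOf (deriv (deriv profile))‖ + 2 * |ξ| * ‖lpOf (deriv profile)‖ with hC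
  have hpk : ∀ n, IsTest (packet profile ξ (c n)) := fun n => isTest_profile.packet ξ (hc0 n)
  refine ⟨fun n x => (((N n)⁻¹ : ℝ) : ℂ) * packet profile ξ (c n) x, fun n => (hpk n).const_mul _,
    fun n => ?_, fun n x hx => ?_, fun n m hnm x => ?_, ?_⟩
  · rw [lpOf_const_mul (hpk n).memLp, norm_smul, norm_packet isTest_profile ξ (hc0 n),
      Complex.norm_real, norm_inv, Real.norm_of_nonneg (hN0 n).le]
    exact inv_mul_cancel₀ (hN0 n).ne'
  · by_contra h0
    have h1 := (hsupp n x (right_ne_zero_of_mul h0)).1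
    have h2 : (1 : ℝ) ≤ 2 ^ n := one_le_pow₀ (by norm_num)
    linarith
  · by_contra hcon
    rw [not_or] at hcon
    have h1 := hsupp n x (right_ne_zero_of_mul hcon.1)
    have h2 := hsupp m x (right_ne_zero_of_mul hcon.2)
    rcases lt_or_gt_of_ne hnm with h | h
    · have : (2 : ℝ) ^ (n + 1) ≤ 2 ^ m := pow_le_pow_right₀ (by norm_num) h
      linarith [h1.2, h2.1]
    · have : (2 : ℝ) ^ (m + 1) ≤ 2 ^ n := pow_le_pow_right₀ (by norm_num) h
      linarith [h2.2, h1.1]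
  · have hlim : Tendsto (fun n => (1 / 2 : ℝ) ^ n * (C / ‖lpOf profile‖)) atTop (𝓝 0) := by
      have := (tendsto_pow_atTop_nhds_zero_of_lt_one (r := (1 / 2 : ℝ)) (by norm_num)
        (by norm_num)).mul_const (C / ‖lpOf profile‖)
      simpa using this
    refine squeeze_zero (fun n => norm_nonneg _) (fun n => ?_) hlim
    have hd : deriv (deriv (fun x => (((N n)⁻¹ : ℝ) : ℂ) * packet profile ξ (c n) x)) =
        fun x => (((N n)⁻¹ : ℝ) : ℂ) * deriv (deriv (packet profile ξ (c n))) x := by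
      have e : deriv (fun x => (((N n)⁻¹ : ℝ) : ℂ) * packet profile ξ (c n) x) =
          fun x => (((N n)⁻¹ : ℝ) : ℂ) * deriv (packet profile ξ (c n)) x := by
        funext x
        exact (((hpk n).differentiable x).hasDerivAt.const_mul _).deriv
      rw [e]
      funext x
      exact (((hpk n).deriv.differentiable x).hasDerivAt.const_mul _).deriv
    rw [hd, lpOf_const_mul (hpk n).memLp, lpOf_const_mul (hpk n).deriv.deriv.memLp, smul_comm,
      ← smul_add, norm_smul, Complex.norm_real, norm_inv, Real.norm_of_nonneg (hN0 n).le,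
      inv_mul_le_iff₀ (hN0 n)]
    refine (norm_packet_defect_le isTest_profile ξ (hc0 n) (hc1 n)).trans (le_of_eq ?_)
    rw [← hC, hN, ← hca n]
    field_simp [lpOf_profile_pos.ne']

end Maxwell1D

end

noncomputable section

namespace Maxwell1D

open scoped ComplexConjugate

/-! ### Approximate kernels of the Maxwell operator -/

/-- The operator `A(ω) - lam B(ω)` of the Maxwell pencil. -/
def maxwellOp (k : ℝ) (ω a b lam : ℂ) : domain k a b →ₗ[ℂ] rangeSpace k :=
  curlCurlOp k a b - lam • multOp k ω a b

lemma coe_maxwellOp (k : ℝ) (ω a b lam : ℂ) (u : domain k a b) :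
    (maxwellOp k ω a b lam u : L2) =
      (curlCurlOp k a b u : L2) - (lam * ω ^ 2) • mulStep a b (u : L2) := by
  rw [mul_smul]
  rfl

lemma maxwellOp_eq_iff {k : ℝ} {ω a b lam : ℂ} {u : domain k a b} {f : rangeSpace k} :
    maxwellOp k ω a b lam u = f ↔
      ∃ m p, CurlCurlData k u ((f : L2) + (lam * ω ^ 2) • mulStep a b (u : L2)) m p := by
  have hmem : (f : L2) + (lam * ω ^ 2) • mulStep a b (u : L2) ∈ rangeSpace k :=
    (rangeSpace k).add_mem f.2 ((rangeSpace k).smul_mem _ u.2.2.2)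
  have h := curlCurlOp_eq_iff (u := u) (g := ⟨_, hmem⟩)
  rw [← h, Subtype.ext_iff, coe_maxwellOp, sub_eq_iff_eq_add]
  exact ⟨fun h => Subtype.ext h, fun h => congrArg Subtype.val h⟩

lemma exists_maxwellOp_eq {k : ℝ} {ω a b lam : ℂ} {u : L2} {f : rangeSpace k} {m p : X}
    (h : CurlCurlData k u ((f : L2) + (lam * ω ^ 2) • mulStep a b u) m p)
    (hdiv : HasWeakDeriv (mulS a b (comp 0 u)) (-(Complex.I * k) • mulS a b (comp 1 u))) :
    ∃ u' : domain k a b, (u' : L2) = u ∧ maxwellOp k ω a b lam u' = f :=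
  ⟨⟨u, mem_domain_iff.mpr ⟨⟨_, m, p, h⟩, hdiv⟩⟩, rfl, maxwellOp_eq_iff.mpr ⟨m, p, h⟩⟩

lemma deriv_eq_zero_or {f g : ℝ → ℂ} (hf : Continuous f) (h : ∀ x, f x = 0 ∨ g x = 0) (x : ℝ) :
    f x = 0 ∨ deriv g x = 0 := by
  by_cases hx : f x = 0
  · exact Or.inl hx
  · have hev : g =ᶠ[𝓝 x] fun _ => 0 := by
      filter_upwards [hf.continuousAt.eventually_ne hx] with y hy
      exact (h y).resolve_left hy
    right
    rw [hev.deriv_eq, deriv_const]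

lemma deriv_eq_zero_of_side {σ : ℝ} {g : ℝ → ℂ} (h : ∀ x, σ * x < 1 → g x = 0) (x : ℝ)
    (hx : σ * x < 1) : deriv g x = 0 := by
  have hopen : IsOpen {y : ℝ | σ * y < 1} := isOpen_lt (by fun_prop) continuous_const
  have hev : g =ᶠ[𝓝 x] fun _ => 0 := by
    filter_upwards [hopen.mem_nhds hx] with y hy
    exact h y hy
  rw [hev.deriv_eq, deriv_const]

lemma mulS_lpOf_of_side (a b : ℂ) {σ : ℝ} (hσ : σ = 1 ∨ σ = -1) {f : ℝ → ℂ}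
    (hf : MemLp f 2 (volume : Measure ℝ)) (h : ∀ x, σ * x < 1 → f x = 0) :
    mulS a b (lpOf f) = stepFun a b σ • lpOf f := by
  refine Lp.ext ?_
  filter_upwards [coeFn_mulS a b (lpOf f), coeFn_lpOf hf, Lp.coeFn_smul (stepFun a b σ) (lpOf f)]
    with x h1 h2 h3
  rw [h1, h3, Pi.smul_apply, h2, smul_eq_mul]
  by_cases hx : σ * x < 1
  · rw [h x hx, mul_zero, mul_zero]
  · rw [not_lt] at hx
    congr 1
    unfold stepFun
    rcases hσ with rfl | rfl
    · rw [if_pos (by linarith), if_pos one_pos]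
    · rw [if_neg (by linarith), if_neg (by norm_num)]

/-- If the coefficient vanishes on one side, then the gradients supported on that side form an
infinite dimensional common kernel. -/
lemma exists_orthonormal_kernel (k : ℝ) {a b : ℂ} {σ : ℝ} (hσ : σ = 1 ∨ σ = -1)
    (h0 : stepFun a b σ = 0) : ∃ E : ℕ → domain k a b, Orthonormal ℂ (fun n => (E n : L2)) ∧
      ∀ ω lam n, maxwellOp k ω a b lam (E n) = 0 := by
  obtain ⟨h, ht, h1, hs, hd, -⟩ := exists_wavePackets 0 hσ
  -- These are the gradients ∇_k (h n): curl-free, and annihilated by the coefficient because of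
  -- their support. The frequency of the packets plays no role here and is taken to be 0.
  set G : ℕ → L2 := fun n => vec (lpOf (deriv (h n))) ((Complex.I * k) • lpOf (h n)) 0 with hG
  have hz : ∀ n, mulS a b (comp 0 (G n)) = 0 ∧ mulS a b (comp 1 (G n)) = 0 := by
    intro n
    rw [hG, comp_zero_vec, comp_one_vec, map_smul,
      mulS_lpOf_of_side a b hσ (ht n).deriv.memLp (deriv_eq_zero_of_side (hs n)),
      mulS_lpOf_of_side a b hσ (ht n).memLp (hs n), h0, zero_smul, zero_smul, smul_zero]
    exact ⟨rfl, rfl⟩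
  have hmul : ∀ n, mulStep a b (G n) = 0 := by
    intro n
    refine ext_comp ?_ ?_ ?_
    · rw [comp_mulStep, (hz n).1, map_zero]
    · rw [comp_mulStep, (hz n).2, map_zero]
    · rw [comp_mulStep, hG, comp_two_vec, map_zero, map_zero]
  have hdata : ∀ n, CurlCurlData k (G n) 0 0 0 := by
    intro n
    constructor
    · rw [hG, comp_one_vec, comp_zero_vec, zero_add]
      exact (hasWeakDeriv_test (ht n)).smul _
    · rw [map_zero, neg_zero]
      exact hasWeakDeriv_zero
    · rw [map_zero, smul_zero]
    · rw [hG, comp_two_vec]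
      exact hasWeakDeriv_zero
    · rw [hG, comp_two_vec, map_zero, smul_zero, sub_zero]
      exact hasWeakDeriv_zero
  have hker : ∀ n, ∃ u : domain k a b, (u : L2) = G n := by
    intro n
    refine ⟨⟨G n, mem_domain_iff.mpr ⟨⟨0, 0, 0, hdata n⟩, ?_⟩⟩, rfl⟩
    rw [(hz n).1, (hz n).2, smul_zero]
    exact hasWeakDeriv_zero
  choose u hu using hker
  have hTu : ∀ ω lam n, maxwellOp k ω a b lam (u n) = 0 := by
    intro ω lam n
    rw [maxwellOp_eq_iff]
    refine ⟨0, 0, ?_⟩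
    rw [hu, hmul, smul_zero, ZeroMemClass.coe_zero, add_zero]
    exact hdata n
  -- Only the first component is used, so that k = 0 is covered: if the derivative of `h n`
  -- vanished, `h n` would be zero in L².
  have hne : ∀ n, 0 < ‖G n‖ := by
    intro n
    rw [norm_pos_iff]
    intro hGn
    have h2 : lpOf (deriv (h n)) = 0 := by
      have := congrArg (comp 0) hGn
      rwa [hG, comp_zero_vec, map_zero] at this
    have h3 : HasWeakDeriv (lpOf (h n)) (((0 : ℝ) : ℂ) • lpOf (h n)) := by
      rw [Complex.ofReal_zero, zero_smul, ← h2]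
      exact hasWeakDeriv_test (ht n)
    have h4 := h3.eq_zero_of_deriv_eq_smul
    have h5 := h1 n
    rw [h4, norm_zero] at h5
    exact zero_ne_one h5
  have horth : ∀ n m, n ≠ m → inner ℂ (G n) (G m) = 0 := by
    intro n m hnm
    have h1 : ∀ x, h n x = 0 ∨ deriv (h m) x = 0 :=
      deriv_eq_zero_or (ht n).1.continuous (hd n m hnm)
    have h2 : ∀ x, deriv (h n) x = 0 ∨ deriv (h m) x = 0 := fun x =>
      (deriv_eq_zero_or (ht m).deriv.1.continuous (fun y => (h1 y).symm) x).symm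
    rw [inner_eq_sum_comp, Fin.sum_univ_three, hG]
    simp only [comp_zero_vec, comp_one_vec, comp_two_vec, inner_zero_left]
    rw [inner_lpOf_eq_zero (ht n).deriv (ht m).deriv h2, inner_smul_left, inner_smul_right,
      inner_lpOf_eq_zero (ht n) (ht m) (hd n m hnm)]
    simp
  refine ⟨fun n => (((‖G n‖)⁻¹ : ℝ) : ℂ) • u n, ⟨fun n => ?_, fun n m hnm => ?_⟩, fun ω lam n => ?_⟩
  · beta_reduce
    rw [Submodule.coe_smul, hu, norm_smul, Complex.norm_real, norm_inv, norm_norm]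
    exact inv_mul_cancel₀ (hne n).ne'
  · simp only [Submodule.coe_smul, hu]
    rw [inner_smul_left, inner_smul_right, horth n m hnm, mul_zero, mul_zero]
  · rw [map_smul, hTu, smul_zero]

/-- If `W - k²` is nonnegative on one side, then wave packets polarised in the third direction form
a singular sequence, both for the operator and for its adjoint. -/
lemma exists_orthonormal_approx_kernel {k ξ : ℝ} {ω a b : ℂ} {σ : ℝ} (hσ : σ = 1 ∨ σ = -1)
    (hc : ω ^ 2 * stepFun a b σ = (k : ℂ) ^ 2 + (ξ : ℂ) ^ 2) :
    ∃ (E : ℕ → domain k a b) (F : ℕ → rangeSpace k), Orthonormal ℂ (fun n => (E n : L2)) ∧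
      Orthonormal ℂ F ∧ Tendsto (fun n => ‖maxwellOp k ω a b 1 (E n)‖) atTop (𝓝 0) ∧
      ∀ u n, ‖inner ℂ (F n) (maxwellOp k ω a b 1 u)‖ ≤ ‖(u : L2)‖ * ‖maxwellOp k ω a b 1 (E n)‖ := by
  obtain ⟨h, ht, h1, hs, hd, hlim⟩ := exists_wavePackets ξ hσ
  -- A field in the third direction meets the divergence conditions trivially. The operator sends it
  -- to -(h'' + ξ² h) in that direction, because W = k² + ξ² on its support.
  set G : ℕ → L2 := fun n => vec 0 0 (lpOf (h n)) with hG
  set r : ℕ → X := fun n => lpOf (deriv (deriv (h n))) + ((ξ : ℂ) ^ 2) • lpOf (h n) with hr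
  have hmS : ∀ n, mulS a b (lpOf (h n)) = stepFun a b σ • lpOf (h n) := fun n =>
    mulS_lpOf_of_side a b hσ (ht n).memLp (hs n)
  have hF : ∀ g : X, vec 0 0 g ∈ rangeSpace k := by
    intro g
    rw [mem_rangeSpace_iff, comp_zero_vec, comp_one_vec, smul_zero]
    exact hasWeakDeriv_zero
  have hdata : ∀ n, CurlCurlData k (G n) (vec 0 0 (-r n) + (1 * ω ^ 2) • mulStep a b (G n)) 0
      (lpOf (deriv (h n))) := by
    intro n
    have e : ∀ i, comp i (vec 0 0 (-r n) + (1 * ω ^ 2) • mulStep a b (G n)) =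
        comp i (vec 0 0 (-r n)) + ω ^ 2 • mulS a b (comp i (G n)) := by
      intro i
      rw [map_add, map_smul, comp_mulStep, one_mul]
    constructor
    · rw [hG, comp_one_vec, comp_zero_vec, zero_add, smul_zero]
      exact hasWeakDeriv_zero
    · rw [e, hG, comp_one_vec, comp_one_vec, map_zero, smul_zero, add_zero, neg_zero]
      exact hasWeakDeriv_zero
    · rw [e, hG, comp_zero_vec, comp_zero_vec, map_zero, smul_zero, add_zero, smul_zero]
    · rw [hG, comp_two_vec]
      exact hasWeakDeriv_test (ht n)
    · rw [e, hG, comp_two_vec, comp_two_vec, hmS, smul_smul, hc]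
      convert hasWeakDeriv_test (ht n).deriv using 1
      rw [hr]
      module
  have hex : ∀ n, ∃ u : domain k a b, (u : L2) = G n ∧
      maxwellOp k ω a b 1 u = ⟨vec 0 0 (-r n), hF _⟩ := by
    intro n
    refine exists_maxwellOp_eq (hdata n) ?_
    rw [hG, comp_zero_vec, comp_one_vec, map_zero, smul_zero]
    exact hasWeakDeriv_zero
  choose E hE hTE using hex
  have hnorm : ∀ g : X, ‖vec 0 0 g‖ = ‖g‖ := by
    intro g
    have := norm_sq_eq_sum_comp (vec 0 0 g)
    simp only [comp_zero_vec, comp_one_vec, comp_two_vec, norm_zero] at this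
    have h2 : ‖vec 0 0 g‖ ^ 2 = ‖g‖ ^ 2 := by rw [this]; ring
    exact (pow_left_inj₀ (norm_nonneg _) (norm_nonneg _) two_ne_zero).mp h2
  have horth : Orthonormal ℂ G := by
    refine ⟨fun n => by rw [hG, hnorm, h1], fun n m hnm => ?_⟩
    beta_reduce
    rw [inner_eq_sum_comp, Fin.sum_univ_three, hG]
    simp only [comp_zero_vec, comp_one_vec, comp_two_vec, inner_zero_left, zero_add]
    exact inner_lpOf_eq_zero (ht n) (ht m) (hd n m hnm)
  have hTn : ∀ n, ‖maxwellOp k ω a b 1 (E n)‖ = ‖r n‖ := by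
    intro n
    rw [hTE]
    change ‖vec 0 0 (-r n)‖ = _
    rw [hnorm, norm_neg]
  refine ⟨E, fun n => ⟨G n, hF _⟩, ?_, ?_, ?_, fun u n => ?_⟩
  · simp_rw [hE]
    exact horth
  · exact ⟨fun n => horth.1 n, fun n m hnm => horth.2 hnm⟩
  · simp_rw [hTn]
    exact hlim
  · obtain ⟨m, p, hu⟩ := maxwellOp_eq_iff.mp (rfl : maxwellOp k ω a b 1 u = _)
    set f := maxwellOp k ω a b 1 u with hf
    -- Moving both derivatives onto `h n` gives ⟨h n, f₃⟩ = -⟨r n, u₃⟩. The packet is almost in the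
    -- kernel of the adjoint too, since W is real on its support.
    have e1 := hu.deriv_p _ (ht n)
    have e2 := hu.deriv_two _ (ht n).deriv
    have e3 : inner ℂ (lpOf (h n)) (ω ^ 2 • mulS a b (comp 2 (u : L2))) =
        ((k : ℂ) ^ 2 + (ξ : ℂ) ^ 2) * inner ℂ (lpOf (h n)) (comp 2 (u : L2)) := by
      have e4 := inner_mulS_left (conj a) (conj b) (lpOf (h n)) (comp 2 (u : L2))
      rw [Complex.conj_conj, Complex.conj_conj,
        mulS_lpOf_of_side _ _ hσ (ht n).memLp (hs n), inner_smul_left] at e4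
      have e5 : conj (stepFun (conj a) (conj b) σ) = stepFun a b σ := by
        unfold stepFun
        split_ifs <;> simp
      rw [inner_smul_right, ← e4, e5, ← mul_assoc, hc]
    have e6 : inner ℂ (lpOf (h n)) (comp 2 (f : L2)) = -inner ℂ (r n) (comp 2 (u : L2)) := by
      rw [map_add, map_smul, comp_mulStep, one_mul, inner_sub_right, inner_add_right, e3,
        inner_smul_right] at e1
      rw [hr, inner_add_left, inner_smul_left, map_pow, Complex.conj_ofReal]
      linear_combination e2 - e1
    have e7 : inner ℂ (⟨G n, hF _⟩ : rangeSpace k) f = inner ℂ (lpOf (h n)) (comp 2 (f : L2)) := by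
      change inner ℂ (G n) (f : L2) = _
      rw [inner_eq_sum_comp, Fin.sum_univ_three, hG]
      simp only [comp_zero_vec, comp_one_vec, comp_two_vec, inner_zero_left, zero_add]
    rw [e7, e6, norm_neg, hTn, mul_comm]
    exact (norm_inner_le_norm _ _).trans (by gcongr; exact norm_comp_le 2 _)

end Maxwell1D

end

noncomputable section

namespace Maxwell1D

open scoped ComplexConjugate

/-! ### Surjectivity when the coefficient vanishes on a half-line -/

lemma hasWeakDeriv_comp_zero {k : ℝ} (f : rangeSpace k) :
    HasWeakDeriv (comp 0 (f : L2)) (-(Complex.I * k) • comp 1 (f : L2)) :=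
  mem_rangeSpace_iff.mp f.2

lemma exists_sq_eq_of_mem_slitPlane {z : ℂ} (hz : z ∈ Complex.slitPlane) :
    ∃ κ : ℂ, 0 < κ.re ∧ κ ^ 2 = z := by
  refine ⟨Complex.exp (Complex.log z / 2), ?_, ?_⟩
  · rw [Complex.exp_re]
    refine mul_pos (Real.exp_pos _) (Real.cos_pos_of_mem_Ioo ?_)
    have h1 := Complex.neg_pi_lt_arg z
    have h2 := (Complex.arg_le_pi z).lt_of_ne (Complex.mem_slitPlane_iff_arg.mp hz).1
    have h3 : (Complex.log z / 2).im = z.arg / 2 := by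
      rw [Complex.div_ofNat_im, Complex.log_im]
    rw [h3]
    constructor <;> linarith
  · rw [← Complex.exp_nat_mul]
    have : ((2 : ℕ) : ℂ) * (Complex.log z / 2) = Complex.log z := by push_cast; ring
    rw [this, Complex.exp_log (Complex.slitPlane_ne_zero hz)]

lemma sub_mem_slitPlane_of_notMem_halfLine {k : ℝ} {μ : ℂ} (hμ : μ ∉ halfLine k) :
    (k : ℂ) ^ 2 - μ ∈ Complex.slitPlane := by
  rw [Complex.mem_slitPlane_iff]
  by_contra h
  rw [not_or, not_lt, not_not] at h
  refine hμ ⟨μ.re, ?_, ?_⟩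
  · have := h.1
    rw [Complex.sub_re, ← Complex.ofReal_pow, Complex.ofReal_re] at this
    exact sub_nonpos.mp this
  · have := h.2
    rw [Complex.sub_im, ← Complex.ofReal_pow, Complex.ofReal_im] at this
    apply Complex.ext
    · simp
    · simp
      linarith

/-- The product jumps by r - s at 0, which `expAbs_test` detects. -/
lemma mulS_expLp_ne_zero {κ : ℂ} (hκ : 0 < κ.re) {r s : ℂ} (hrs : r ≠ s) :
    mulS r s (expLp κ) ≠ 0 := by
  intro h0
  have h := expAbs_test hκ isTest_cutoff r s
  rw [← mulS_mulS, h0, map_zero, inner_zero_right, inner_zero_right, cutoff_zero, map_one,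
    mul_one, add_zero] at h
  exact hrs (sub_eq_zero.mp h.symm).symm

/-- Solution of `-v'' + κ² v = f` on the half-line where `P = mulS p q` is the identity, with
homogeneous Dirichlet condition at the interface. -/
lemma exists_dirichlet_resolvent {κ p q : ℂ} (hκ : 0 < κ.re) (hp : p * p = p) (hq : q * q = q)
    (hpq : p ≠ q) (f : X) : ∃ v v' h : X, HasWeakDeriv v v' ∧ trace v v' = 0 ∧
      HasWeakDeriv v' (κ ^ 2 • v - f + h) ∧ mulS p q h = 0 := by
  have hκ0 : κ ≠ 0 := by
    rintro rfl
    simp at hκ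
  have hκ' : 0 < (conj κ).re := by simpa using hκ
  obtain ⟨v, v', hv, hv'⟩ := exists_resolvent_const hκ f
  -- A source on the complementary half-line, where the equation need not hold, is used to correct
  -- the trace. By `trace_resolvent` its response has trace ‖h‖² / (2κ) ≠ 0, so subtracting a
  -- multiple gives v(0) = 0.
  set h : X := mulS (1 - p) (1 - q) (expLp (conj κ)) with hh
  obtain ⟨w, w', hw, hw'⟩ := exists_resolvent_const hκ h
  have htr : trace w w' ≠ 0 := by
    intro h0
    have h1 := trace_resolvent hκ hw hw'
    have hpc : conj (1 - p) * (1 - p) = 1 - p := by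
      have : p = 0 ∨ p = 1 := by
        have : p * (p - 1) = 0 := by linear_combination hp
        rcases mul_eq_zero.mp this with h | h
        · exact Or.inl h
        · exact Or.inr (sub_eq_zero.mp h)
      rcases this with rfl | rfl <;> simp
    have hqc : conj (1 - q) * (1 - q) = 1 - q := by
      have : q = 0 ∨ q = 1 := by
        have : q * (q - 1) = 0 := by linear_combination hq
        rcases mul_eq_zero.mp this with h | h
        · exact Or.inl h
        · exact Or.inr (sub_eq_zero.mp h)
      rcases this with rfl | rfl <;> simp
    have h2 : inner ℂ h h = inner ℂ (expLp (conj κ)) h := by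
      rw [hh, inner_mulS_left, mulS_mulS, hpc, hqc]
    rw [h0, mul_zero, ← h2, eq_comm, inner_self_eq_zero] at h1
    exact mulS_expLp_ne_zero hκ' (fun e => hpq (by linear_combination -e)) h1
  set c : ℂ := trace v v' / trace w w' with hc
  refine ⟨v - c • w, v' - c • w', c • h, hv.sub (hw.smul c), ?_, ?_, ?_⟩
  · rw [trace_sub, trace_smul, hc, div_mul_cancel₀ _ htr, sub_self]
  · convert hv'.sub (hw'.smul c) using 1
    module
  · rw [map_smul, hh, mulS_mulS]
    have e1 : p * (1 - p) = 0 := by linear_combination -hp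
    have e2 : q * (1 - q) = 0 := by linear_combination -hq
    rw [e1, e2, mulS_self, zero_smul, smul_zero]

/-- Where W̃ ≠ 0, u₁ solves -v'' + (k² - μ)v = f₁ and u₂ is fixed by the divergence; continuity of
W̃u₁ across the interface forces v(0) = 0. On the other side there is no divergence constraint, so
u₁ is free to absorb the error made by extending v. The component u₃ solves a separate scalar
equation. -/
lemma maxwellOp_surjective_of_half {k : ℝ} (hk : k ≠ 0) {ω β p q : ℂ}
    (hpq : p = 1 ∧ q = 0 ∨ p = 0 ∧ q = 1) (hμ : ω ^ 2 * β ∉ halfLine k) :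
    Function.Surjective (maxwellOp k ω (β * p) (β * q) 1) := by
  intro f
  have hk' : (k : ℂ) ≠ 0 := Complex.ofReal_ne_zero.mpr hk
  have hpp : p * p = p := by rcases hpq with ⟨rfl, rfl⟩ | ⟨rfl, rfl⟩ <;> simp
  have hqq : q * q = q := by rcases hpq with ⟨rfl, rfl⟩ | ⟨rfl, rfl⟩ <;> simp
  have hne : p ≠ q := by rcases hpq with ⟨rfl, rfl⟩ | ⟨rfl, rfl⟩ <;> simp
  set μ : ℂ := ω ^ 2 * β with hμd
  obtain ⟨κ, hκ, hκ2⟩ := exists_sq_eq_of_mem_slitPlane (sub_mem_slitPlane_of_notMem_halfLine hμ)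
  have hκk : 0 < (conj κ * (k : ℂ) ^ 2).re := by
    rw [← Complex.ofReal_pow, Complex.re_mul_ofReal, Complex.conj_re]
    positivity
  -- The single rotation κ̄, with κ² = k² - μ, serves both half-lines, on which the coefficient of
  -- the equation for u₃ is κ² and k².
  have hpos : ∀ r : ℂ, r = 0 ∨ r = 1 → 0 < (conj κ * ((k : ℂ) ^ 2 - μ * r)).re := by
    rintro r (rfl | rfl)
    · rwa [mul_zero, sub_zero]
    · rw [mul_one, ← hκ2]
      exact re_conj_mul_sq_pos hκ
  obtain ⟨y, y', hy, hy'⟩ := exists_resolvent_step (conj κ) ((k : ℂ) ^ 2 - μ * p)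
    ((k : ℂ) ^ 2 - μ * q) (by simpa using hκ)
    (hpos p (by rcases hpq with h | h <;> simp [h.1]))
    (hpos q (by rcases hpq with h | h <;> simp [h.2])) (comp 2 (f : L2))
  obtain ⟨v, v', h, hv, htr, hv', hPh⟩ :=
    exists_dirichlet_resolvent hκ hpp hqq hne (comp 0 (f : L2))
  set P : X →L[ℂ] X := mulS p q with hP
  have hPP : ∀ z, P (P z) = P z := fun z => by rw [hP, mulS_mulS, hpp, hqq]
  have hβ : ∀ z, mulS (β * p) (β * q) z = β • P z := fun z => by rw [hP, smul_mulS]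
  have hPv : HasWeakDeriv (P v) (P v') := hv.mulS htr p q
  -- Off the support of W̃ the value is read off from u₂' = m + i k u₁, with u₂ = (i/k) v' and m
  -- forced by i k m = f₁ + μ P v.
  set u₁ : X := P v + ((k : ℂ) ^ 2)⁻¹ • (κ ^ 2 • (v - P v) + h) with hu₁
  have hPu : P u₁ = P v := by
    rw [hu₁, map_add, map_smul, map_add, map_smul, map_sub, hPP, hPh, sub_self, smul_zero,
      add_zero, smul_zero, add_zero]
  have hg : ∀ (u : L2) i, comp i ((f : L2) + (1 * ω ^ 2) • mulStep (β * p) (β * q) u) =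
      comp i (f : L2) + μ • P (comp i u) := by
    intro u i
    rw [map_add, map_smul, comp_mulStep, hβ, smul_smul, one_mul]
  obtain ⟨u, -, hu⟩ := exists_maxwellOp_eq (k := k) (ω := ω) (a := β * p) (b := β * q) (lam := 1)
    (u := vec u₁ ((Complex.I / k) • v') y) (f := f)
    (m := -(Complex.I / k) • (comp 0 (f : L2) + μ • P v)) (p := y') (by
      constructor
      · rw [comp_one_vec, comp_zero_vec]
        convert hv'.smul (Complex.I / k) using 1
        rw [hu₁, hκ2]
        match_scalars <;> field_simp <;> ring
      · rw [hg, comp_one_vec]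
        convert ((hasWeakDeriv_comp_zero f).add (hPv.smul μ)).smul (-(Complex.I / k)) using 1
        rw [map_smul]
        match_scalars <;> field_simp
        linear_combination (-1 : ℂ) * Complex.I_sq
      · rw [hg, comp_zero_vec, hPu, smul_smul]
        convert (one_smul ℂ _).symm using 2
        field_simp
        linear_combination (-1 : ℂ) * Complex.I_sq
      · rwa [comp_two_vec]
      · rw [hg, comp_two_vec]
        convert hy' using 1
        have e : mulS ((k : ℂ) ^ 2 - μ * p) ((k : ℂ) ^ 2 - μ * q) y =
            (k : ℂ) ^ 2 • y - μ • P y := by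
          rw [hP, smul_mulS, ← mulS_self, eq_sub_iff_add_eq, mulS_add_mulS]
          simp
        rw [e]
        abel) (by
      rw [hβ, hβ, comp_zero_vec, comp_one_vec, hPu]
      convert hPv.smul β using 1
      rw [map_smul]
      match_scalars
      field_simp
      linear_combination (-β) * Complex.I_sq)
  exact ⟨u, hu⟩

end Maxwell1D

end

noncomputable section

namespace Maxwell1D

open scoped ComplexConjugate

/-! ### The curl-curl operator with nonvanishing coefficients -/

lemma ofReal_abs_sq (k : ℝ) : ((|k| : ℝ) : ℂ) ^ 2 = (k : ℂ) ^ 2 := by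
  rw [← Complex.ofReal_pow, sq_abs, Complex.ofReal_pow]

lemma ofReal_abs_re_pos {k : ℝ} (hk : k ≠ 0) : 0 < ((|k| : ℝ) : ℂ).re := by
  rw [Complex.ofReal_re]
  exact abs_pos.mpr hk

/-- The field `∇_k exp (-|k| |x|)`. -/
def gradExp (k : ℝ) : L2 :=
  vec (mulS (-((|k| : ℝ) : ℂ)) ((|k| : ℝ) : ℂ) (expLp ((|k| : ℝ) : ℂ)))
    ((Complex.I * k) • expLp ((|k| : ℝ) : ℂ)) 0

lemma curlCurlData_gradExp {k : ℝ} (hk : k ≠ 0) : CurlCurlData k (gradExp k) 0 0 0 := by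
  constructor
  · rw [gradExp, comp_one_vec, comp_zero_vec, zero_add]
    exact (hasWeakDeriv_expLp (ofReal_abs_re_pos hk)).smul _
  · rw [map_zero, neg_zero]
    exact hasWeakDeriv_zero
  · rw [map_zero, smul_zero]
  · rw [gradExp, comp_two_vec]
    exact hasWeakDeriv_zero
  · rw [gradExp, comp_two_vec, map_zero, smul_zero, sub_zero]
    exact hasWeakDeriv_zero

lemma CurlCurlData.add {k : ℝ} {u g u' g' : L2} {m p m' p' : X} (h : CurlCurlData k u g m p)
    (h' : CurlCurlData k u' g' m' p') : CurlCurlData k (u + u') (g + g') (m + m') (p + p') := by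
  constructor
  · rw [map_add, map_add]
    convert h.deriv_one.add h'.deriv_one using 1
    module
  · rw [map_add]
    convert h.deriv_m.add h'.deriv_m using 1
    module
  · rw [map_add, h.zero_eq, h'.zero_eq, smul_add]
  · rw [map_add]
    exact h.deriv_two.add h'.deriv_two
  · rw [map_add, map_add]
    convert h.deriv_p.add h'.deriv_p using 1
    module

lemma CurlCurlData.smul {k : ℝ} {u g : L2} {m p : X} (c : ℂ) (h : CurlCurlData k u g m p) :
    CurlCurlData k (c • u) (c • g) (c • m) (c • p) := by
  constructor
  · rw [map_smul, map_smul]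
    convert h.deriv_one.smul c using 1
    module
  · rw [map_smul]
    convert h.deriv_m.smul c using 1
    module
  · rw [map_smul, h.zero_eq, smul_comm]
  · rw [map_smul]
    exact h.deriv_two.smul c
  · rw [map_smul, map_smul]
    convert h.deriv_p.smul c using 1
    module

/-- The divergence of `W̃ u` for a divergence free field `g ∈ H²` plus a multiple of
`∇_k exp (-|k| |x|)`: it is concentrated at the interface. -/
lemma inner_div_add_gradExp {k : ℝ} (hk : k ≠ 0) (a b : ℂ) {g : L2} {g' : X}
    (hg : HasWeakDeriv (comp 0 g) g') (hg1 : comp 1 g = (Complex.I / k) • g') (c : ℂ)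
    {φ : ℝ → ℂ} (hφ : IsTest φ) :
    inner ℂ (lpOf (deriv φ)) (mulS a b (comp 0 (g + c • gradExp k))) +
      inner ℂ (lpOf φ) (-(Complex.I * k) • mulS a b (comp 1 (g + c • gradExp k))) =
    ((b - a) * trace (comp 0 g) g' + c * ((|k| : ℝ) : ℂ) * (a + b)) * conj (φ 0) := by
  have hk' : (k : ℂ) ≠ 0 := Complex.ofReal_ne_zero.mpr hk
  have hK := ofReal_abs_sq k
  set K : ℂ := ((|k| : ℝ) : ℂ) with hKd
  have h1 := hg.inner_mulS_test hφ a b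
  -- The first component of W̃ ∇_k exp(-K|x|) is the exponential times the step (-K a, K b), whose
  -- jump produces the term K (a + b).
  have h2 := expAbs_test (ofReal_abs_re_pos hk) hφ (-K * a) (K * b)
  have e1 : -K * (-K * a) = (k : ℂ) ^ 2 * a := by rw [← hK]; ring
  have e2 : K * (K * b) = (k : ℂ) ^ 2 * b := by rw [← hK]; ring
  rw [← hKd, e1, e2, ← smul_mulS, inner_smul_right] at h2
  simp only [map_add, map_smul, hg1, gradExp, comp_zero_vec, comp_one_vec, ← hKd, mulS_mulS,
    mul_comm a, mul_comm b, inner_add_right, inner_smul_right]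
  have e3 : Complex.I * k * (Complex.I / k) = -1 := by
    field_simp
    exact Complex.I_sq
  have e4 := I_mul_mul_self k
  linear_combination h1 + c * h2 - inner ℂ (lpOf φ) (mulS a b g') * e3
    - c * inner ℂ (lpOf φ) (mulS a b (expLp K)) * e4

lemma hasWeakDeriv_div_add_gradExp {k : ℝ} (hk : k ≠ 0) (a b : ℂ) {g : L2} {g' : X}
    (hg : HasWeakDeriv (comp 0 g) g') (hg1 : comp 1 g = (Complex.I / k) • g') {c : ℂ}
    (hc : (b - a) * trace (comp 0 g) g' + c * ((|k| : ℝ) : ℂ) * (a + b) = 0) :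
    HasWeakDeriv (mulS a b (comp 0 (g + c • gradExp k)))
      (-(Complex.I * k) • mulS a b (comp 1 (g + c • gradExp k))) := by
  intro φ hφ
  have h := inner_div_add_gradExp hk a b hg hg1 c hφ
  rw [hc, zero_mul] at h
  exact eq_neg_of_add_eq_zero_left h

/-- The divergence free solution of `∇_k × ∇_k × g = f` on the whole line, with bounds. -/
lemma exists_curlCurl_eq {k : ℝ} (hk : k ≠ 0) (f : rangeSpace k) :
    ∃ (g : L2) (g' m p : X), HasWeakDeriv (comp 0 g) g' ∧ comp 1 g = (Complex.I / k) • g' ∧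
      CurlCurlData k g f m p ∧ ‖g‖ ≤ 3 / k ^ 2 * ‖f‖ ∧
      2 * ((|k| : ℝ) : ℂ) * trace (comp 0 g) g' =
        inner ℂ (expLp ((|k| : ℝ) : ℂ)) (comp 0 (f : L2)) := by
  have hk' : (k : ℂ) ≠ 0 := Complex.ofReal_ne_zero.mpr hk
  have hK := ofReal_abs_re_pos hk
  obtain ⟨v, v', hv, hv'⟩ := exists_resolvent_const hK (comp 0 (f : L2))
  obtain ⟨y, y', hy, hy'⟩ := exists_resolvent_const hK (comp 2 (f : L2))
  have htr := trace_resolvent hK hv hv'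
  rw [Complex.conj_ofReal] at htr
  rw [ofReal_abs_sq] at hv' hy'
  -- For divergence-free fields the operator acts as -∂² + k² on each component. The second
  -- component comes from the divergence condition and m from i k m = f₁.
  refine ⟨vec v ((Complex.I / k) • v') y, v', -(Complex.I / k) • comp 0 (f : L2), y', ?_, ?_, ?_,
    ?_, ?_⟩
  · rwa [comp_zero_vec]
  · rw [comp_one_vec]
  · constructor
    · rw [comp_one_vec, comp_zero_vec]
      convert hv'.smul (Complex.I / k) using 1
      match_scalars <;> field_simp
    · convert (hasWeakDeriv_comp_zero f).smul (-(Complex.I / k)) using 1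
      rw [smul_smul, ← neg_one_smul ℂ]
      congr 1
      field_simp
      linear_combination (-1 : ℂ) * Complex.I_sq
    · rw [smul_smul]
      convert (one_smul ℂ _).symm using 2
      field_simp
      linear_combination (-1 : ℂ) * Complex.I_sq
    · rwa [comp_two_vec]
    · rwa [comp_two_vec]
  · have hk2 : 0 < k ^ 2 := by positivity
    have hka : 0 < |k| := abs_pos.mpr hk
    have b0 : ‖v‖ ≤ 1 / k ^ 2 * ‖f‖ := by
      rw [one_div, le_inv_mul_iff₀ hk2]
      exact (resolvent_bounds hk hv hv').1.trans (norm_comp_le 0 (f : L2))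
    have b2 : ‖y‖ ≤ 1 / k ^ 2 * ‖f‖ := by
      rw [one_div, le_inv_mul_iff₀ hk2]
      exact (resolvent_bounds hk hy hy').1.trans (norm_comp_le 2 (f : L2))
    have b1 : ‖(Complex.I / k) • v'‖ ≤ 1 / k ^ 2 * ‖f‖ := by
      have h1 := (resolvent_bounds hk hv hv').2.trans (norm_comp_le 0 (f : L2))
      rw [norm_smul, norm_div, Complex.norm_I, Complex.norm_real, Real.norm_eq_abs, ← sq_abs k,
        one_div, one_div, inv_mul_le_iff₀ hka]
      have e : |k| * ((|k| ^ 2)⁻¹ * ‖f‖) = |k|⁻¹ * ‖f‖ := by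
        field_simp
      rw [e, le_inv_mul_iff₀ hka]
      exact h1
    refine (norm_le_sum_comp _).trans ?_
    rw [comp_zero_vec, comp_one_vec, comp_two_vec]
    calc _ ≤ 1 / k ^ 2 * ‖f‖ + 1 / k ^ 2 * ‖f‖ + 1 / k ^ 2 * ‖f‖ := by gcongr
      _ = 3 / k ^ 2 * ‖f‖ := by ring
  · rwa [comp_zero_vec]

/-- Fields in the kernel of the curl-curl operator are multiples of `∇_k exp (-|k| |x|)`. -/
lemma exists_eq_smul_gradExp {k : ℝ} (hk : k ≠ 0) {a b : ℂ} (ha : a ≠ 0) (hb : b ≠ 0)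
    {u : domain k a b} (hu : curlCurlOp k a b u = 0) :
    ∃ c : ℂ, (u : L2) = c • gradExp k ∧ c * (a + b) = 0 := by
  have hk' : (k : ℂ) ≠ 0 := Complex.ofReal_ne_zero.mpr hk
  have hIk : Complex.I * k ≠ 0 := mul_ne_zero Complex.I_ne_zero hk'
  have hK0 : ((|k| : ℝ) : ℂ) ≠ 0 := Complex.ofReal_ne_zero.mpr (abs_pos.mpr hk).ne'
  have hKsq := ofReal_abs_sq k
  have hK := ofReal_abs_re_pos hk
  obtain ⟨m, p, hd⟩ := curlCurlOp_eq_iff.mp hu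
  rw [ZeroMemClass.coe_zero] at hd
  have hdiv := hasWeakDeriv_mulS_of_mem_domain u
  have hm : m = 0 := by
    have := hd.zero_eq
    rw [map_zero, eq_comm, smul_eq_zero] at this
    exact this.resolve_left hIk
  have hu2 : comp 2 (u : L2) = 0 := by
    have h1 := (resolvent_bounds hk hd.deriv_two hd.deriv_p).1
    rw [map_zero, norm_zero] at h1
    have h2 : 0 < k ^ 2 := by positivity
    exact norm_le_zero_iff.mp (nonpos_of_mul_nonpos_right h1 h2)
  set y : X := comp 1 (u : L2) with hy
  set y' : X := (Complex.I * k) • comp 0 (u : L2) with hy'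
  have hyd : HasWeakDeriv y y' := by
    have := hd.deriv_one
    rwa [hm, zero_add] at this
  set K : ℂ := ((|k| : ℝ) : ℂ) with hKd
  set e : X := expLp K with he
  have hed : HasWeakDeriv e (mulS (-K) K e) := hasWeakDeriv_expLp hK
  set t : ℂ := trace y y' with ht
  -- Here y = u₂ satisfies (W̃ y')' = k² W̃ y. Subtracting a multiple of the exponential gives a
  -- function of trace zero, which may be divided by the step W̃ and still be an admissible test
  -- function.
  set z : X := y - t • e with hz
  set z' : X := y' - t • mulS (-K) K e with hz'
  have hzd : HasWeakDeriv z z' := hyd.sub (hed.smul t)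
  have hztr : trace z z' = 0 := by
    rw [hz, hz', trace_sub, trace_smul, trace_expLp hK, mul_one, ← ht, sub_self]
  have h1 : inner ℂ z' y' + (k : ℂ) ^ 2 * inner ℂ z y = 0 := by
    have hζ := hzd.mulS hztr (conj a)⁻¹ (conj b)⁻¹
    have hY : HasWeakDeriv (mulS a b y') ((k : ℂ) ^ 2 • mulS a b y) := by
      convert hdiv.smul (Complex.I * k) using 1
      · rw [hy', map_smul]
      · rw [smul_smul, mul_neg, I_mul_mul_self, neg_neg]
    have h2 := hζ.inner_eq hY
    have ea : conj ((conj a)⁻¹) * a = 1 := by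
      rw [map_inv₀, Complex.conj_conj, inv_mul_cancel₀ ha]
    have eb : conj ((conj b)⁻¹) * b = 1 := by
      rw [map_inv₀, Complex.conj_conj, inv_mul_cancel₀ hb]
    rw [inner_mulS_left, inner_smul_right, inner_mulS_left, mulS_mulS, mulS_mulS, ea, eb,
      mulS_self, mulS_self, one_smul, one_smul] at h2
    linear_combination h2
  have h2 : inner ℂ z' (mulS (-K) K e) + (k : ℂ) ^ 2 * inner ℂ z e = 0 := by
    have h3 := hzd.inner_mulS hed (-K) K
    have e1 : -K * -K = (k : ℂ) ^ 2 := by rw [← hKsq]; ring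
    have e2 : K * K = (k : ℂ) ^ 2 := by rw [← hKsq]; ring
    rw [hztr, map_zero, zero_mul, mul_zero, mulS_mulS, e1, e2, mulS_self, inner_smul_right] at h3
    exact h3
  -- Both y and the exponential satisfy this weak equation against z, hence so does their
  -- combination z itself, and z = 0.
  have h3 : inner ℂ z' z' + (k : ℂ) ^ 2 * inner ℂ z z = 0 := by
    have e1 : inner ℂ z' z' = inner ℂ z' y' - t * inner ℂ z' (mulS (-K) K e) := by
      rw [← inner_smul_right z' _ t, ← inner_sub_right]
    have e2 : inner ℂ z z = inner ℂ z y - t * inner ℂ z e := by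
      rw [← inner_smul_right z _ t, ← inner_sub_right]
    rw [e1, e2]
    linear_combination h1 - t * h2
  have h4 : ‖z'‖ ^ 2 + k ^ 2 * ‖z‖ ^ 2 = 0 := by
    rw [inner_self_eq_norm_sq_to_K, inner_self_eq_norm_sq_to_K] at h3
    have h5 : ((‖z'‖ ^ 2 + k ^ 2 * ‖z‖ ^ 2 : ℝ) : ℂ) = ((0 : ℝ) : ℂ) := by
      push_cast
      exact h3
    exact Complex.ofReal_injective h5
  have hk2 : 0 < k ^ 2 := by positivity
  have hz0 : z = 0 := by
    have h5 : k ^ 2 * ‖z‖ ^ 2 = 0 := by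
      have := mul_nonneg hk2.le (sq_nonneg ‖z‖)
      have := sq_nonneg ‖z'‖
      linarith
    exact norm_eq_zero.mp (pow_eq_zero_iff two_ne_zero |>.mp
      ((mul_eq_zero.mp h5).resolve_left hk2.ne'))
  have hz0' : z' = 0 := by
    rw [hz0, norm_zero] at h4
    exact norm_eq_zero.mp (pow_eq_zero_iff two_ne_zero |>.mp (by linarith))
  have hyt : y = t • e := sub_eq_zero.mp hz0
  have hyt' : y' = t • mulS (-K) K e := sub_eq_zero.mp hz0'
  set c : ℂ := t / (Complex.I * k) with hc
  have huc : (u : L2) = c • gradExp k := by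
    refine ext_comp ?_ ?_ ?_
    · rw [map_smul, gradExp, comp_zero_vec, ← hKd, ← he]
      have : (Complex.I * k) • comp 0 (u : L2) =
          (Complex.I * k) • (c • mulS (-K) K e) := by
        rw [smul_smul, hc, mul_div_cancel₀ _ hIk]
        exact hyt'
      exact smul_right_injective _ hIk this
    · rw [map_smul, gradExp, comp_one_vec, ← hKd, ← he, smul_smul, hc, div_mul_cancel₀ _ hIk]
      exact hyt
    · rw [map_smul, gradExp, comp_two_vec, smul_zero, hu2]
  refine ⟨c, huc, ?_⟩
  -- The interface condition has not been used in full yet: tested with a function equal to 1 at 0,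
  -- it gives c |k| (a + b) = 0.
  have h5 := inner_div_add_gradExp hk a b (g := 0) (g' := 0)
    (by rw [map_zero]; exact hasWeakDeriv_zero) (by rw [map_zero, smul_zero]) c isTest_cutoff
  have h6 := hdiv cutoff isTest_cutoff
  rw [hy, huc] at h6
  have h0 : trace (comp 0 (0 : L2)) 0 = 0 := by
    simp only [trace, map_zero, inner_zero_right, add_zero, neg_zero]
  rw [zero_add, h6, h0, cutoff_zero, map_one, mul_zero, zero_add, mul_one,
    neg_add_cancel] at h5
  have h7 : K * (c * (a + b)) = 0 := by linear_combination -h5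
  exact (mul_eq_zero.mp h7).resolve_left hK0

lemma norm_trace_le {k : ℝ} (hk : k ≠ 0) {g : L2} {g' : X} {f : rangeSpace k}
    (h : 2 * ((|k| : ℝ) : ℂ) * trace (comp 0 g) g' =
      inner ℂ (expLp ((|k| : ℝ) : ℂ)) (comp 0 (f : L2))) :
    ‖trace (comp 0 g) g'‖ ≤ ‖expLp ((|k| : ℝ) : ℂ)‖ / (2 * |k|) * ‖f‖ := by
  have hk2 : 0 < 2 * |k| := by positivity
  rw [div_mul_eq_mul_div, le_div_iff₀ hk2]
  have h1 : ‖trace (comp 0 g) g'‖ * (2 * |k|) =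
      ‖inner ℂ (expLp ((|k| : ℝ) : ℂ)) (comp 0 (f : L2))‖ := by
    rw [← h, norm_mul, norm_mul, Complex.norm_real, Real.norm_eq_abs, abs_abs]
    simp
    ring
  rw [h1]
  refine (norm_inner_le_norm _ _).trans ?_
  gcongr
  exact norm_comp_le 0 _

/-- For `a + b ≠ 0` the curl-curl operator is boundedly invertible. -/
lemma curlCurlOp_bijective {k : ℝ} (hk : k ≠ 0) {a b : ℂ} (ha : a ≠ 0) (hb : b ≠ 0)
    (hab : a + b ≠ 0) : Function.Bijective (curlCurlOp k a b) ∧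
      ∃ c : ℝ, 0 < c ∧ ∀ u : domain k a b, ‖(u : L2)‖ ≤ c * ‖curlCurlOp k a b u‖ := by
  have hK0 : ((|k| : ℝ) : ℂ) ≠ 0 := Complex.ofReal_ne_zero.mpr (abs_pos.mpr hk).ne'
  have hinj : Function.Injective (curlCurlOp k a b) := by
    rw [injective_iff_map_eq_zero]
    intro u hu
    obtain ⟨c, hc, hc0⟩ := exists_eq_smul_gradExp hk ha hb hu
    rw [(mul_eq_zero.mp hc0).resolve_right hab, zero_smul] at hc
    exact Subtype.ext hc
  set C : ℝ := 3 / k ^ 2 + ‖expLp ((|k| : ℝ) : ℂ)‖ / (2 * |k|) *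
    (‖(a - b) / (((|k| : ℝ) : ℂ) * (a + b))‖ * ‖gradExp k‖) with hC
  have hsurj : ∀ f : rangeSpace k, ∃ u : domain k a b, curlCurlOp k a b u = f ∧
      ‖(u : L2)‖ ≤ C * ‖f‖ := by
    intro f
    obtain ⟨g, g', m, p, hg, hg1, hd, hb1, htr⟩ := exists_curlCurl_eq hk f
    -- With c = r t the interface strength (b - a) t + c |k| (a + b) vanishes.
    set r : ℂ := (a - b) / (((|k| : ℝ) : ℂ) * (a + b)) with hr
    set t : ℂ := trace (comp 0 g) g' with ht
    have hdiv := hasWeakDeriv_div_add_gradExp hk a b hg hg1 (c := r * t) (by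
      rw [hr]
      field_simp
      ring)
    have hdata := hd.add ((curlCurlData_gradExp hk).smul (r * t))
    rw [smul_zero, add_zero] at hdata
    refine ⟨⟨_, mem_domain_iff.mpr ⟨⟨_, _, _, hdata⟩, hdiv⟩⟩,
      curlCurlOp_eq_iff.mpr ⟨_, _, hdata⟩, ?_⟩
    have htb := norm_trace_le hk htr
    calc ‖g + (r * t) • gradExp k‖ ≤ ‖g‖ + ‖r‖ * ‖t‖ * ‖gradExp k‖ := by
          refine (norm_add_le _ _).trans (le_of_eq ?_)
          rw [norm_smul, norm_mul]
      _ ≤ 3 / k ^ 2 * ‖f‖ + ‖r‖ * (‖expLp ((|k| : ℝ) : ℂ)‖ / (2 * |k|) * ‖f‖) * ‖gradExp k‖ := by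
          gcongr
      _ = C * ‖f‖ := by rw [hC]; ring
  refine ⟨⟨hinj, fun f => (hsurj f).imp fun u hu => hu.1⟩, C, by positivity, fun u => ?_⟩
  obtain ⟨u', hu', hn⟩ := hsurj (curlCurlOp k a b u)
  rwa [hinj hu'] at hn

/-- The functional on `rangeSpace k` whose kernel is the range of the curl-curl operator when
`a + b = 0`. -/
def interfaceFunctional (k : ℝ) : rangeSpace k →L[ℂ] ℂ :=
  innerSL ℂ (expLp ((|k| : ℝ) : ℂ)) ∘L comp 0 ∘L (rangeSpace k).subtypeL

lemma interfaceFunctional_apply (k : ℝ) (f : rangeSpace k) :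
    interfaceFunctional k f = inner ℂ (expLp ((|k| : ℝ) : ℂ)) (comp 0 (f : L2)) := rfl

lemma expLp_ne_zero {κ : ℂ} (hκ : 0 < κ.re) : expLp κ ≠ 0 := by
  intro h
  have := mulS_expLp_ne_zero hκ (r := 1) (s := 0) one_ne_zero
  rw [h, map_zero] at this
  exact this rfl

lemma interfaceFunctional_surjective {k : ℝ} (hk : k ≠ 0) :
    Function.Surjective (interfaceFunctional k) := by
  have hk' : (k : ℂ) ≠ 0 := Complex.ofReal_ne_zero.mpr hk
  have hK := ofReal_abs_re_pos hk
  set e := expLp ((|k| : ℝ) : ℂ) with he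
  set e' := mulS (-((|k| : ℝ) : ℂ)) ((|k| : ℝ) : ℂ) e with he'
  -- A divergence-free field with first component exp(-|k||x|), on which the functional equals ‖e‖²
  -- ≠ 0.
  have hmem : vec e ((Complex.I / k) • e') 0 ∈ rangeSpace k := by
    rw [mem_rangeSpace_iff, comp_zero_vec, comp_one_vec, smul_smul]
    convert hasWeakDeriv_expLp hK using 1
    convert one_smul ℂ _ using 2
    field_simp
    linear_combination (-1 : ℂ) * Complex.I_sq
  have hne : interfaceFunctional k ⟨_, hmem⟩ ≠ 0 := by
    rw [interfaceFunctional_apply, comp_zero_vec]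
    exact inner_self_ne_zero.mpr (expLp_ne_zero hK)
  intro c
  refine ⟨(c / interfaceFunctional k ⟨_, hmem⟩) • ⟨_, hmem⟩, ?_⟩
  rw [map_smul, smul_eq_mul, div_mul_cancel₀ _ hne]

/-! ### The curl-curl operator in the case a + b = 0. -/

section AntiSymmetric

variable {k : ℝ} {a b : ℂ}

lemma gradExp_ne_zero (hk : k ≠ 0) : gradExp k ≠ 0 := by
  intro h
  have h1 := congrArg (comp 1) h
  rw [gradExp, comp_one_vec, map_zero, smul_eq_zero] at h1
  exact h1.elim (mul_ne_zero Complex.I_ne_zero (Complex.ofReal_ne_zero.mpr hk))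
    (expLp_ne_zero (ofReal_abs_re_pos hk))

lemma exists_domain_eq_gradExp (hk : k ≠ 0) (hab : a + b = 0) :
    ∃ E : domain k a b, (E : L2) = gradExp k ∧ curlCurlOp k a b E = 0 := by
  have hdiv := hasWeakDeriv_div_add_gradExp hk a b (g := 0) (g' := 0) (c := 1)
    (by rw [map_zero]; exact hasWeakDeriv_zero) (by rw [map_zero, smul_zero]) (by
      rw [hab, mul_zero, add_zero]
      simp only [trace, map_zero, inner_zero_right, add_zero, neg_zero, mul_zero])
  rw [zero_add, one_smul] at hdiv
  have hd := curlCurlData_gradExp hk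
  exact ⟨⟨gradExp k, mem_domain_iff.mpr ⟨⟨_, _, _, hd⟩, hdiv⟩⟩, rfl,
    curlCurlOp_eq_iff.mpr ⟨_, _, hd⟩⟩

lemma ker_curlCurlOp (hk : k ≠ 0) (ha : a ≠ 0) (hb : b ≠ 0) {E : domain k a b}
    (hE : (E : L2) = gradExp k) (hE0 : curlCurlOp k a b E = 0) :
    LinearMap.ker (curlCurlOp k a b) = Submodule.span ℂ {E} := by
  ext u
  rw [LinearMap.mem_ker, Submodule.mem_span_singleton]
  constructor
  · intro hu
    obtain ⟨c, hc, -⟩ := exists_eq_smul_gradExp hk ha hb hu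
    exact ⟨c, Subtype.ext (by rw [Submodule.coe_smul, hE, hc])⟩
  · rintro ⟨c, rfl⟩
    rw [map_smul, hE0, smul_zero]

/-- For b = -a the coefficient is W̃ = a sgn x, so e = exp(-|k||x|) satisfies e' = -(|k|/a) W̃ e.
Testing both u₂' = m + i k u₁ and the divergence condition with e gives two expressions in ⟨e, W̃u₂⟩
and ⟨e, u₁⟩, which combine to ⟨e, m⟩ = 0 because |k|² = k². -/
lemma interfaceFunctional_curlCurlOp (hk : k ≠ 0) (ha : a ≠ 0) (hab : a + b = 0)
    (u : domain k a b) : interfaceFunctional k (curlCurlOp k a b u) = 0 := by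
  obtain rfl : b = -a := (neg_eq_of_add_eq_zero_right hab).symm
  obtain ⟨m, p, hd⟩ := exists_curlCurlData u
  have hdiv := hasWeakDeriv_mulS_of_mem_domain u
  have hK := ofReal_abs_re_pos hk
  have hKsq := ofReal_abs_sq k
  have hK0 : ((|k| : ℝ) : ℂ) ≠ 0 := Complex.ofReal_ne_zero.mpr (abs_pos.mpr hk).ne'
  have hKc : conj ((|k| : ℝ) : ℂ) = ((|k| : ℝ) : ℂ) := Complex.conj_ofReal _
  rw [interfaceFunctional_apply, hd.zero_eq]
  set K : ℂ := ((|k| : ℝ) : ℂ) with hKd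
  set e : X := expLp K with he
  have hed : HasWeakDeriv e (mulS (-K) K e) := hasWeakDeriv_expLp hK
  have h1 := hed.inner_eq hd.deriv_one
  have h2 := hed.inner_eq hdiv
  have e1 : conj (-K) * a = -K * a := by rw [map_neg, hKc]
  have e2 : conj K * -a = -K * a := by rw [hKc]; ring
  have e3 : mulS (conj (-K)) (conj K) (comp 1 (u : L2)) =
      (-K / a) • mulS a (-a) (comp 1 (u : L2)) := by
    rw [smul_mulS, map_neg, hKc]
    congr 2
    · rw [div_mul_cancel₀ _ ha]
    · rw [neg_div, neg_mul_neg, div_mul_cancel₀ _ ha]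
  rw [inner_mulS_left, mulS_mulS, e1, e2, mulS_self, inner_smul_right, inner_smul_right] at h2
  rw [inner_mulS_left, e3, inner_smul_right, inner_add_right, inner_smul_right] at h1
  rw [inner_smul_right]
  have e4 := I_mul_mul_self k
  have e5 : K / a * a = K := div_mul_cancel₀ _ ha
  have e6 : a * (K / a) = K := by rw [mul_comm]; exact e5
  set y := inner ℂ e (mulS a (-a) (comp 1 (u : L2)))
  set x := inner ℂ e (comp 0 (u : L2))
  set n := inner ℂ e m
  have h3 : K * K * x = -(Complex.I * k) * (K / a) * y := by
    have : a * (K * K * x) = a * (-(Complex.I * k) * (K / a) * y) := by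
      linear_combination (-K) * h2 + Complex.I * k * y * e6
    exact mul_left_cancel₀ ha this
  have h1' : n = -(Complex.I * k * x) + K / a * y := by
    have e7 : -K / a = -(K / a) := neg_div _ _
    rw [e7] at h1
    linear_combination h1
  rw [h1']
  linear_combination (-x) * e4 + h3 - x * hKsq

/-- The functional is 2|k| times the trace of the first component of the whole-line solution. If it
vanishes, that solution already satisfies the interface condition. -/
lemma range_curlCurlOp (hk : k ≠ 0) (ha : a ≠ 0) (hab : a + b = 0) :
    LinearMap.range (curlCurlOp k a b) =
      LinearMap.ker (interfaceFunctional k : rangeSpace k →ₗ[ℂ] ℂ) := by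
  have hK0 : ((|k| : ℝ) : ℂ) ≠ 0 := Complex.ofReal_ne_zero.mpr (abs_pos.mpr hk).ne'
  ext f
  rw [LinearMap.mem_range, LinearMap.mem_ker]
  constructor
  · rintro ⟨u, rfl⟩
    exact interfaceFunctional_curlCurlOp hk ha hab u
  · intro hf
    change interfaceFunctional k f = 0 at hf
    obtain ⟨g, g', m, p, hg, hg1, hd, -, htr⟩ := exists_curlCurl_eq hk f
    rw [← interfaceFunctional_apply, hf] at htr
    have ht : trace (comp 0 g) g' = 0 :=
      (mul_eq_zero.mp htr).resolve_left (mul_ne_zero two_ne_zero hK0)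
    have hdiv := hasWeakDeriv_div_add_gradExp hk a b hg hg1 (c := 0) (by
      rw [ht, mul_zero, zero_mul, zero_mul, add_zero])
    rw [zero_smul, add_zero] at hdiv
    exact ⟨⟨g, mem_domain_iff.mpr ⟨⟨_, _, _, hd⟩, hdiv⟩⟩, curlCurlOp_eq_iff.mpr ⟨_, _, hd⟩⟩

/-- Modulo its kernel, the curl-curl operator is bounded below. -/
lemma exists_norm_sub_smul_gradExp_le (hk : k ≠ 0) (ha : a ≠ 0) (hb : b ≠ 0) (hab : a + b = 0)
    (u : domain k a b) :
    ∃ c : ℂ, ‖(u : L2) - c • gradExp k‖ ≤ 3 / k ^ 2 * ‖curlCurlOp k a b u‖ := by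
  have hK0 : ((|k| : ℝ) : ℂ) ≠ 0 := Complex.ofReal_ne_zero.mpr (abs_pos.mpr hk).ne'
  obtain ⟨g, g', m, p, hg, hg1, hd, hbd, htr⟩ := exists_curlCurl_eq hk (curlCurlOp k a b u)
  rw [← interfaceFunctional_apply, interfaceFunctional_curlCurlOp hk ha hab] at htr
  have ht : trace (comp 0 g) g' = 0 :=
    (mul_eq_zero.mp htr).resolve_left (mul_ne_zero two_ne_zero hK0)
  have hdiv := hasWeakDeriv_div_add_gradExp hk a b hg hg1 (c := 0) (by
    rw [ht, mul_zero, zero_mul, zero_mul, add_zero])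
  rw [zero_smul, add_zero] at hdiv
  set v : domain k a b := ⟨g, mem_domain_iff.mpr ⟨⟨_, _, _, hd⟩, hdiv⟩⟩
  have hv : curlCurlOp k a b v = curlCurlOp k a b u := curlCurlOp_eq_iff.mpr ⟨_, _, hd⟩
  obtain ⟨c, hc, -⟩ := exists_eq_smul_gradExp hk ha hb (u := u - v)
    (by rw [map_sub, hv, sub_self])
  refine ⟨c, ?_⟩
  rw [← hc, Submodule.coe_sub, sub_sub_cancel]
  exact hbd

end AntiSymmetric

end Maxwell1D

end

noncomputable section

/-! ### Spectral consequences for operator pencils -/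

lemma not_finiteDimensional_of_linearIndependent {D : Type*} [AddCommGroup D] [Module ℂ D]
    {K : Submodule ℂ D} {u : ℕ → D} (hu : LinearIndependent ℂ u) (hK : ∀ n, u n ∈ K) :
    ¬ FiniteDimensional ℂ K := by
  intro hfin
  have h : LinearIndependent ℂ (fun n => (⟨u n, hK n⟩ : K)) :=
    LinearIndependent.of_comp K.subtype hu
  exact not_finite_iff_infinite.mpr (inferInstance : Infinite ℕ) h.finite

section LinearOperators

variable {D R : Type*} [AddCommGroup D] [Module ℂ D] [NormedAddCommGroup R] [InnerProductSpace ℂ R]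
  {T : D →ₗ[ℂ] R}

lemma isClosed_range_and_finiteDimensional_of_surjective (h : Function.Surjective T) :
    IsClosed (LinearMap.range T : Set R) ∧ FiniteDimensional ℂ (R ⧸ LinearMap.range T) := by
  rw [LinearMap.range_eq_top.mpr h]
  exact ⟨by rw [Submodule.top_coe]; exact isClosed_univ, inferInstance⟩

lemma isFredholmOp_of_bijective (h : Function.Bijective T) :
    IsFredholmOp T ∧ fredholmIndex T = 0 := by
  have hs := isClosed_range_and_finiteDimensional_of_surjective h.2
  have hk : LinearMap.ker T = ⊥ := LinearMap.ker_eq_bot.mpr h.1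
  refine ⟨⟨hs.1, ?_, hs.2⟩, ?_⟩
  · rw [hk]
    infer_instance
  · rw [fredholmIndex, hk, LinearMap.range_eq_top.mpr h.2, finrank_bot,
      Module.finrank_zero_of_subsingleton, sub_self]

/-- An operator whose kernel is spanned by one vector and whose range is the kernel of one
continuous functional is Fredholm of index zero. -/
lemma isFredholmOp_of_ker_eq_span_of_range_eq_ker {E : D} (hE : E ≠ 0)
    (hker : LinearMap.ker T = Submodule.span ℂ {E}) {ℓ : R →L[ℂ] ℂ} (hℓ : Function.Surjective ℓ)
    (hran : LinearMap.range T = LinearMap.ker (ℓ : R →ₗ[ℂ] ℂ)) :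
    Module.finrank ℂ (LinearMap.ker T) = 1 ∧ Module.finrank ℂ (R ⧸ LinearMap.range T) = 1 ∧
      IsFredholmOp T ∧ fredholmIndex T = 0 := by
  have h1 : Module.finrank ℂ (LinearMap.ker T) = 1 := by
    rw [hker]
    exact finrank_span_singleton hE
  have h2 : Module.finrank ℂ (R ⧸ LinearMap.range T) = 1 := by
    rw [hran, ((ℓ : R →ₗ[ℂ] ℂ).quotKerEquivOfSurjective hℓ).finrank_eq, Module.finrank_self]
  have h3 : IsClosed (LinearMap.range T : Set R) := by
    rw [hran]
    exact ℓ.isClosed_ker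
  refine ⟨h1, h2, ⟨h3, Module.finite_of_finrank_pos (by rw [h1]; exact one_pos),
    Module.finite_of_finrank_pos (by rw [h2]; exact one_pos)⟩, ?_⟩
  rw [fredholmIndex, h1, h2, sub_self]

end LinearOperators

namespace OperatorPencil

variable {H R : Type*} [NormedAddCommGroup H] [InnerProductSpace ℂ H]
  [NormedAddCommGroup R] [InnerProductSpace ℂ R] {P : OperatorPencil H R} {ω : ℂ}

lemma mem_spec_of_notMem (hω : ω ∈ P.Ω) (h : 1 ∉ P.lamResolventSet ω) : ω ∈ P.spec :=
  ⟨hω, fun h' => h h'.2⟩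

lemma mem_essSpec5_of_lamResolventSet_eq_empty (hω : ω ∈ P.Ω) (h : P.lamResolventSet ω = ∅) :
    ω ∈ P.essSpec5 := by
  refine ⟨hω, fun h' => ?_⟩
  obtain ⟨lam, -, hl⟩ := h'
  rw [h] at hl
  exact hl

/-- The kernel vectors are common to all λ, so the λ-resolvent set is empty; this is what gives
`essSpec5`. The sequence itself is a Weyl sequence. -/
lemma mem_spectra_of_orthonormal_kernel (hω : ω ∈ P.Ω) {E : ℕ → P.dom ω}
    (hE : Orthonormal ℂ (fun n => (E n : H))) (h0 : ∀ lam n, P.op ω lam (E n) = 0) :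
    ω ∈ P.spec ∧ ω ∈ P.pointSpecInf ∧ ω ∈ P.weylSpec ∧
      ¬ FiniteDimensional ℂ (LinearMap.ker (P.op ω 1)) ∧ ω ∈ P.essSpec5 := by
  have hne : E 0 ≠ 0 := by
    intro h
    have : ‖(E 0 : H)‖ = 1 := hE.1 0
    rw [h, ZeroMemClass.coe_zero, norm_zero] at this
    exact zero_ne_one this
  have hinf : ¬ FiniteDimensional ℂ (LinearMap.ker (P.op ω 1)) :=
    not_finiteDimensional_of_linearIndependent
      (LinearIndependent.of_comp (P.dom ω).subtype hE.linearIndependent) (fun n => h0 1 n)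
  have hres : P.lamResolventSet ω = ∅ := by
    rw [Set.eq_empty_iff_forall_notMem]
    rintro lam ⟨hb, -⟩
    exact hne (hb.1 (by rw [h0, map_zero]))
  refine ⟨mem_spec_of_notMem hω (by rw [hres]; exact Set.notMem_empty _),
    ⟨⟨hω, E 0, hne, h0 1 0⟩, Or.inl hinf⟩,
    ⟨hω, E, hE.1, hE.tendsto_inner_zero, ?_⟩, hinf,
    mem_essSpec5_of_lamResolventSet_eq_empty hω hres⟩
  simp_rw [h0, norm_zero]
  exact tendsto_const_nhds

lemma notMem_spectra_of_mem_lamResolventSet (hω : ω ∈ P.Ω) (h : 1 ∈ P.lamResolventSet ω) :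
    ω ∉ P.spec ∧ ω ∉ P.pointSpec ∧ ω ∉ P.weylSpec ∧ ω ∉ P.essSpec5 := by
  refine ⟨fun hs => hs.2 ⟨hω, h⟩, ?_, ?_, ?_⟩
  · rintro ⟨-, u, hu, hu0⟩
    exact hu (h.1.1 (by rw [hu0, map_zero]))
  · rintro ⟨-, u, hu, -, hlim⟩
    obtain ⟨c, -, hb⟩ := h.2
    have h1 : Tendsto (fun n => c * ‖P.op ω 1 (u n)‖) atTop (𝓝 0) := by
      simpa using hlim.const_mul c
    have h2 : (1 : ℝ) ≤ 0 := ge_of_tendsto' h1 fun n => (hu n).symm.le.trans (hb (u n))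
    exact absurd h2 (by norm_num)
  · rintro ⟨-, hd⟩
    have hF := (isFredholmOp_of_bijective h.1).1
    exact hd ⟨1, mem_connectedComponentIn ⟨hF.1, Or.inl hF.2.1⟩, h⟩

lemma one_notMem_lamResolventSet_of_mem_weylSpec (h : ω ∈ P.weylSpec) :
    1 ∉ P.lamResolventSet ω := fun h' =>
  (notMem_spectra_of_mem_lamResolventSet h.1 h').2.2.1 h

end OperatorPencil

/-! ### The Maxwell operator at ω = 0 and ranges that are not closed of finite codimension. -/

namespace Maxwell1D

open scoped ComplexConjugate

lemma multOp_zero (k : ℝ) (a b : ℂ) : multOp k 0 a b = 0 := by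
  ext1 u
  refine Subtype.ext ?_
  change (0 : ℂ) ^ 2 • mulStep a b (u : L2) = 0
  rw [zero_pow two_ne_zero, zero_smul]

lemma maxwellOp_zero (k : ℝ) (a b lam : ℂ) : maxwellOp k 0 a b lam = curlCurlOp k a b := by
  rw [maxwellOp, multOp_zero, smul_zero, sub_zero]

lemma exists_side_eq_zero {a b : ℂ} (h : a = 0 ∨ b = 0) :
    ∃ σ : ℝ, (σ = 1 ∨ σ = -1) ∧ stepFun a b σ = 0 := by
  rcases h with rfl | rfl
  · exact ⟨1, Or.inl rfl, by rw [stepFun, if_pos one_pos]⟩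
  · exact ⟨-1, Or.inr rfl, by rw [stepFun, if_neg (by norm_num)]⟩

lemma stepFun_one (a b : ℂ) : stepFun a b 1 = a := if_pos one_pos

lemma stepFun_neg_one (a b : ℂ) : stepFun a b (-1) = b := if_neg (by norm_num)

/-- If `W - k²` is nonnegative on one side, then the range of the Maxwell operator is not a closed
subspace of finite codimension. -/
lemma not_isClosed_range_maxwellOp {k ξ : ℝ} {ω a b : ℂ} {σ : ℝ} (hσ : σ = 1 ∨ σ = -1)
    (hc : ω ^ 2 * stepFun a b σ = (k : ℂ) ^ 2 + (ξ : ℂ) ^ 2) :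
    ¬(IsClosed (LinearMap.range (maxwellOp k ω a b 1) : Set (rangeSpace k)) ∧
      FiniteDimensional ℂ (rangeSpace k ⧸ LinearMap.range (maxwellOp k ω a b 1))) := by
  obtain ⟨E, F, -, hF, hlim, hb⟩ := exists_orthonormal_approx_kernel hσ hc
  exact not_isClosed_range_and_finiteDimensional_quotient _ hF hlim
    fun u => ⟨‖(u : L2)‖, fun n => hb u n⟩

lemma exists_eq_add_sq_of_mem_halfLine {k : ℝ} {z : ℂ} (hz : z ∈ halfLine k) :
    ∃ ξ : ℝ, z = (k : ℂ) ^ 2 + (ξ : ℂ) ^ 2 := by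
  obtain ⟨t, ht, rfl⟩ := hz
  refine ⟨√(t - k ^ 2), ?_⟩
  rw [← Complex.ofReal_pow √_, Real.sq_sqrt (sub_nonneg.mpr ht)]
  push_cast
  ring

/-! ### The case `k = 0` with nonvanishing coefficients -/

lemma hasWeakDeriv_zero_right {u : X} (h : HasWeakDeriv u 0) : u = 0 :=
  HasWeakDeriv.eq_zero_of_deriv_eq_smul (c := 0) (by rwa [Complex.ofReal_zero, zero_smul])

/-- For k = 0 the system decouples: u₂'' = 0, u₃'' = 0 and (W̃u₁)' = 0. An L² function with zero
weak derivative vanishes, and W̃ is invertible. -/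
lemma curlCurlOp_zero_injective {a b : ℂ} (ha : a ≠ 0) (hb : b ≠ 0) :
    Function.Injective (curlCurlOp 0 a b) := by
  rw [injective_iff_map_eq_zero]
  intro u hu
  obtain ⟨m, p, hd⟩ := curlCurlOp_eq_iff.mp hu
  have hdiv := hasWeakDeriv_mulS_of_mem_domain u
  rw [ZeroMemClass.coe_zero] at hd
  have h1 := hd.deriv_one
  have h2 := hd.deriv_m
  have h3 := hd.deriv_two
  have h4 := hd.deriv_p
  simp only [Complex.ofReal_zero, mul_zero, zero_smul, neg_zero, map_zero, add_zero, sub_zero,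
    zero_pow two_ne_zero] at h1 h2 h3 h4 hdiv
  rw [hasWeakDeriv_zero_right h2] at h1
  rw [hasWeakDeriv_zero_right h4] at h3
  have h5 : comp 0 (u : L2) = 0 := by
    have h6 := congrArg (mulS a⁻¹ b⁻¹) (hasWeakDeriv_zero_right hdiv)
    rwa [mulS_mulS, inv_mul_cancel₀ ha, inv_mul_cancel₀ hb, mulS_self, one_smul, map_zero] at h6
  refine Subtype.ext (ext_comp ?_ ?_ ?_)
  · rw [h5, ZeroMemClass.coe_zero, map_zero]
  · rw [hasWeakDeriv_zero_right h1, ZeroMemClass.coe_zero, map_zero]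
  · rw [hasWeakDeriv_zero_right h3, ZeroMemClass.coe_zero, map_zero]

/-- If `f` is orthogonal to `v''` where `-v'' + v = f`, then `f = 0`. -/
lemma eq_zero_of_inner_resolvent {v v' f : X} (hv : HasWeakDeriv v v')
    (hv' : HasWeakDeriv v' (v - f)) (h : (inner ℂ (f - v) f).re ≤ 0) : f = 0 := by
  have h1 := hv'.inner_eq hv
  -- Since f - v = -v'', this is ‖v''‖² + ‖v'‖², so both norms vanish.
  have h2 : inner ℂ (f - v) f = inner ℂ (f - v) (f - v) + inner ℂ v' v' := by
    have h3 : inner ℂ (f - v) f = inner ℂ (f - v) (f - v) + inner ℂ (f - v) v := by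
      rw [← inner_add_right, sub_add_cancel]
    have h4 : inner ℂ (f - v) v = inner ℂ v' v' := by
      rw [← neg_sub v f, inner_neg_left, h1, neg_neg]
    rw [h3, h4]
  rw [h2, Complex.add_re] at h
  have h5 : (inner ℂ (f - v) (f - v)).re = ‖f - v‖ ^ 2 := (norm_sq_eq_re_inner (𝕜 := ℂ) _).symm
  have h6 : (inner ℂ v' v').re = ‖v'‖ ^ 2 := (norm_sq_eq_re_inner (𝕜 := ℂ) _).symm
  rw [h5, h6] at h
  have h7 : ‖f - v‖ = 0 :=
    pow_eq_zero_iff two_ne_zero |>.mp (by nlinarith [sq_nonneg ‖f - v‖, sq_nonneg ‖v'‖])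
  have h8 : ‖v'‖ = 0 :=
    pow_eq_zero_iff two_ne_zero |>.mp (by nlinarith [sq_nonneg ‖f - v‖, sq_nonneg ‖v'‖])
  rw [norm_eq_zero.mp h8] at hv
  rw [← sub_add_cancel f v, norm_eq_zero.mp h7, hasWeakDeriv_zero_right hv, add_zero]

/-- At k = 0 a divergence-free field has zero first component. For the other two, the range contains
-v'' with v = (1 - ∂²)⁻¹ f, and orthogonality to it forces f = 0. -/
lemma orthogonal_range_curlCurlOp_zero (a b : ℂ) :
    (LinearMap.range (curlCurlOp 0 a b))ᗮ = ⊥ := by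
  rw [Submodule.eq_bot_iff]
  intro f hf
  have hf0 : comp 0 (f : L2) = 0 := by
    have := hasWeakDeriv_comp_zero f
    rw [Complex.ofReal_zero, mul_zero, neg_zero, zero_smul] at this
    exact hasWeakDeriv_zero_right this
  obtain ⟨v, v', hv, hv'⟩ := exists_resolvent_const (κ := 1) (by simp) (comp 1 (f : L2))
  obtain ⟨y, y', hy, hy'⟩ := exists_resolvent_const (κ := 1) (by simp) (comp 2 (f : L2))
  rw [one_pow, one_smul] at hv' hy'
  have hmem : ∀ g₁ g₂ : X, vec 0 g₁ g₂ ∈ rangeSpace 0 := by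
    intro g₁ g₂
    rw [mem_rangeSpace_iff, comp_zero_vec, Complex.ofReal_zero, mul_zero, neg_zero, zero_smul]
    exact hasWeakDeriv_zero
  have hex : ∀ {v v' y y' f₁ f₂ : X}, HasWeakDeriv v v' → HasWeakDeriv v' (v - f₁) →
      HasWeakDeriv y y' → HasWeakDeriv y' (y - f₂) →
      (⟨vec 0 (f₁ - v) (f₂ - y), hmem _ _⟩ : rangeSpace 0) ∈
        LinearMap.range (curlCurlOp 0 a b) := by
    intro v v' y y' f₁ f₂ hv hv' hy hy'
    have hd : CurlCurlData 0 (vec 0 v y) (vec 0 (f₁ - v) (f₂ - y)) v' y' := by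
      constructor
      · rwa [comp_one_vec, comp_zero_vec, smul_zero, add_zero]
      · rwa [comp_one_vec, neg_sub]
      · rw [comp_zero_vec, Complex.ofReal_zero, mul_zero, zero_smul]
      · rwa [comp_two_vec]
      · rwa [comp_two_vec, comp_two_vec, Complex.ofReal_zero, zero_pow two_ne_zero, zero_smul,
          zero_sub, neg_sub]
    refine ⟨⟨vec 0 v y, mem_domain_iff.mpr ⟨⟨_, _, _, hd⟩, ?_⟩⟩,
      curlCurlOp_eq_iff.mpr ⟨_, _, hd⟩⟩
    rw [comp_zero_vec, map_zero, Complex.ofReal_zero, mul_zero, neg_zero, zero_smul]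
    exact hasWeakDeriv_zero
  have hin : ∀ g₁ g₂ : X, inner ℂ (⟨vec 0 g₁ g₂, hmem _ _⟩ : rangeSpace 0) f =
      inner ℂ g₁ (comp 1 (f : L2)) + inner ℂ g₂ (comp 2 (f : L2)) := by
    intro g₁ g₂
    change inner ℂ (vec 0 g₁ g₂) (f : L2) = _
    rw [inner_eq_sum_comp, Fin.sum_univ_three, comp_zero_vec, comp_one_vec, comp_two_vec,
      inner_zero_left, zero_add]
  have hz : HasWeakDeriv 0 ((0 : X) - 0) := by
    rw [sub_zero]
    exact hasWeakDeriv_zero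
  rw [Submodule.mem_orthogonal] at hf
  have h1 := hf _ (hex hv hv' hasWeakDeriv_zero hz)
  have h2 := hf _ (hex hasWeakDeriv_zero hz hy hy')
  rw [hin, sub_zero, inner_zero_left, add_zero] at h1
  rw [hin, sub_zero, inner_zero_left, zero_add] at h2
  refine Subtype.ext (ext_comp ?_ ?_ ?_)
  · rw [hf0, ZeroMemClass.coe_zero, map_zero]
  · rw [eq_zero_of_inner_resolvent hv hv' (by rw [h1, Complex.zero_re]), ZeroMemClass.coe_zero,
      map_zero]
  · rw [eq_zero_of_inner_resolvent hy hy' (by rw [h2, Complex.zero_re]), ZeroMemClass.coe_zero,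
      map_zero]

/-- A closed dense range would make the operator onto, against the wave packets of frequency 0. -/
lemma not_isClosed_range_curlCurlOp_zero (a b : ℂ) :
    ¬ IsClosed (LinearMap.range (curlCurlOp 0 a b) : Set (rangeSpace 0)) := by
  intro hcl
  have hc : CompleteSpace (LinearMap.range (curlCurlOp 0 a b)) := hcl.completeSpace_coe
  have htop : LinearMap.range (curlCurlOp 0 a b) = ⊤ :=
    (Submodule.orthogonal_eq_bot_iff).mp (orthogonal_range_curlCurlOp_zero a b)
  have h := not_isClosed_range_maxwellOp (k := 0) (ξ := 0) (ω := 0) (a := a) (b := b)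
    (σ := 1) (Or.inl rfl) (by simp)
  rw [maxwellOp_zero] at h
  exact h (isClosed_range_and_finiteDimensional_of_surjective (LinearMap.range_eq_top.mp htop))

end Maxwell1D

end

/-! ### Criteria for membership in the spectra of an abstract pencil. -/

noncomputable section

namespace OperatorPencil

variable {H R : Type*} [NormedAddCommGroup H] [InnerProductSpace ℂ H]
  [NormedAddCommGroup R] [InnerProductSpace ℂ R] {P : OperatorPencil H R} {ω : ℂ}

lemma notMem_pointSpecFin_of_mem_pointSpecInf (h : ω ∈ P.pointSpecInf) : ω ∉ P.pointSpecFin :=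
  fun h' => h'.2 h.2

lemma notMem_essSpec_of_isFredholmOp (h : IsFredholmOp (P.op ω 1))
    (hi : fredholmIndex (P.op ω 1) = 0) :
    ω ∉ P.essSpec1 ∧ ω ∉ P.essSpec2 ∧ ω ∉ P.essSpec3 ∧ ω ∉ P.essSpec4 :=
  ⟨fun h' => h'.2 ⟨h.1, Or.inl h.2.1⟩, fun h' => h'.2 ⟨h.1, h.2.1⟩, fun h' => h'.2 h,
    fun h' => h'.2 ⟨h, hi⟩⟩

lemma mem_essSpec_of_not_finiteDimensional_ker (hω : ω ∈ P.Ω)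
    (h : ¬ FiniteDimensional ℂ (LinearMap.ker (P.op ω 1))) :
    ω ∈ P.essSpec2 ∧ ω ∈ P.essSpec3 ∧ ω ∈ P.essSpec4 :=
  ⟨⟨hω, fun h' => h h'.2⟩, ⟨hω, fun h' => h h'.2.1⟩, ⟨hω, fun h' => h h'.1.2.1⟩⟩

lemma mem_essSpec_of_not_isClosed_range (hω : ω ∈ P.Ω)
    (h : ¬ IsClosed (LinearMap.range (P.op ω 1) : Set R)) :
    ω ∈ P.essSpec1 ∧ ω ∈ P.essSpec2 ∧ ω ∈ P.essSpec3 ∧ ω ∈ P.essSpec4 :=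
  ⟨⟨hω, fun h' => h h'.1⟩, ⟨hω, fun h' => h h'.1⟩, ⟨hω, fun h' => h h'.1⟩,
    ⟨hω, fun h' => h h'.1.1⟩⟩

lemma mem_essSpec1_iff_of_not_finiteDimensional_ker (hω : ω ∈ P.Ω)
    (h : ¬ FiniteDimensional ℂ (LinearMap.ker (P.op ω 1))) :
    ω ∈ P.essSpec1 ↔ ¬(IsClosed (LinearMap.range (P.op ω 1) : Set R) ∧
      FiniteDimensional ℂ (R ⧸ LinearMap.range (P.op ω 1))) := by
  refine ⟨fun h' hc => h'.2 ⟨hc.1, Or.inr hc.2⟩, fun h' => ⟨hω, fun hs => h' ⟨hs.1, ?_⟩⟩⟩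
  exact hs.2.resolve_left h

lemma notMem_discreteSpec_of_lamResolventSet_eq_empty (h : P.lamResolventSet ω = ∅) :
    ω ∉ P.discreteSpec := by
  rintro ⟨-, δ, hδ, hball⟩
  have hmem := hball (1 + ((δ / 2 : ℝ) : ℂ))
    (by
      rw [Metric.mem_ball, dist_eq_norm, add_sub_cancel_left, Complex.norm_real, Real.norm_eq_abs,
        abs_of_pos (half_pos hδ)]
      exact half_lt_self hδ)
    (by
      rw [Ne, add_eq_left, Complex.ofReal_eq_zero]
      exact (half_pos hδ).ne')
  rw [h] at hmem
  exact hmem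

/-- If `B(ω) = 0`, then the resolvent set in the `lam`-plane is empty or everything. -/
lemma lamResolventSet_eq_empty_of_B_eq_zero (hB : P.B ω = 0) (h : 1 ∉ P.lamResolventSet ω) :
    P.lamResolventSet ω = ∅ := by
  have hop : ∀ lam, P.op ω lam = P.op ω 1 := fun lam => by
    rw [op, op, hB, smul_zero, smul_zero]
  rw [Set.eq_empty_iff_forall_notMem]
  intro lam hl
  refine h ?_
  rw [lamResolventSet, Set.mem_ofPred_eq, hop lam] at hl
  exact hl

/-- If `B(ω) = 0`, all associated vectors are eigenvectors. -/
lemma not_infiniteAlgMult_of_B_eq_zero (hB : P.B ω = 0) {lam : ℂ}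
    (h : FiniteDimensional ℂ (LinearMap.ker (P.op ω lam))) : ¬ P.InfiniteAlgMult ω lam := by
  rintro (h' | ⟨u, hu, h0, -, hj⟩)
  · exact h' h
  · refine not_finiteDimensional_of_linearIndependent hu (K := LinearMap.ker (P.op ω lam)) ?_ h
    rintro (_ | j)
    · exact h0
    · rw [LinearMap.mem_ker, hj, hB, LinearMap.zero_apply]

/-- An associated vector also lies in the one-dimensional kernel, so it is a multiple of the
eigenvector. -/
lemma algSimple_of_B_eq_zero (hB : P.B ω = 0) {lam : ℂ}
    (h : Module.finrank ℂ (LinearMap.ker (P.op ω lam)) = 1) : P.AlgSimple ω lam := by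
  refine ⟨h, ?_⟩
  rintro ⟨u, v, hv, hv0, hu, hli⟩
  rw [hB, LinearMap.zero_apply] at hu
  obtain ⟨c, hc⟩ := (finrank_eq_one_iff_of_nonzero' (⟨v, hv⟩ : LinearMap.ker (P.op ω lam))
    (fun h0 => hv0 (congrArg Subtype.val h0))).mp h ⟨u, hu⟩
  have hc' : c • v = u := congrArg Subtype.val hc
  have := LinearIndependent.pair_iff.mp hli 1 (-c) (by rw [one_smul, neg_smul, hc', add_neg_cancel])
  exact one_ne_zero this.1

/-- A sequence which approaches a line is not weakly null, unless it tends to zero. -/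
lemma notMem_weylSpec_of_norm_sub_smul_le {g : H} (hg : g ≠ 0) {C : ℝ}
    (h : ∀ u : P.dom ω, ∃ c : ℂ, ‖(u : H) - c • g‖ ≤ C * ‖P.op ω 1 u‖) : ω ∉ P.weylSpec := by
  rintro ⟨-, u, hu, hw, hlim⟩
  choose c hc using fun n => h (u n)
  have hC : Tendsto (fun n => C * ‖P.op ω 1 (u n)‖) atTop (𝓝 0) := by
    simpa using hlim.const_mul C
  have hr : Tendsto (fun n => (u n : H) - c n • g) atTop (𝓝 0) :=
    squeeze_zero_norm hc hC
  have hin : Tendsto (fun n => inner ℂ g ((u n : H) - c n • g)) atTop (𝓝 0) := by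
    have h1 := (tendsto_const_nhds (x := g)).inner (𝕜 := ℂ) hr
    rwa [inner_zero_right] at h1
  -- Weak convergence tested against `g` forces the coefficients to zero, hence the sequence tends
  -- to zero in norm, against ‖u n‖ = 1.
  have hcn : Tendsto (fun n => c n * inner ℂ g g) atTop (𝓝 0) := by
    have h1 := (hw g).sub hin
    rw [sub_zero] at h1
    refine h1.congr fun n => ?_
    rw [inner_sub_right, inner_smul_right, sub_sub_cancel]
  have hgg : (inner ℂ g g : ℂ) ≠ 0 := inner_self_ne_zero.mpr hg
  have hc0 : Tendsto c atTop (𝓝 0) := by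
    have h1 := hcn.mul_const (inner ℂ g g : ℂ)⁻¹
    rw [zero_mul] at h1
    exact h1.congr fun n => mul_inv_cancel_right₀ hgg _
  have hu0 : Tendsto (fun n => ‖(u n : H)‖) atTop (𝓝 0) := by
    have h1 := (hr.add (hc0.smul_const g)).norm
    rw [zero_smul, add_zero, norm_zero] at h1
    exact h1.congr fun n => by rw [sub_add_cancel]
  simp_rw [hu] at hu0
  exact one_ne_zero (tendsto_nhds_unique tendsto_const_nhds hu0)

end OperatorPencil

/-! ### Classification of the points of Ω₀. -/

namespace Maxwell1D

variable {S : Set ℂ} {Vp Vm : ℂ → ℂ} {k : ℝ} {ω : ℂ}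

lemma pencil_op (S : Set ℂ) (Vp Vm : ℂ → ℂ) (k : ℝ) (ω lam : ℂ) :
    (pencil S Vp Vm k).op ω lam = maxwellOp k ω (Vp ω) (Vm ω) lam := rfl

lemma pencil_op_zero (S : Set ℂ) (Vp Vm : ℂ → ℂ) (k : ℝ) (lam : ℂ) :
    (pencil S Vp Vm k).op 0 lam = curlCurlOp k (Vp 0) (Vm 0) :=
  maxwellOp_zero k _ _ lam

lemma pencil_B_zero (S : Set ℂ) (Vp Vm : ℂ → ℂ) (k : ℝ) : (pencil S Vp Vm k).B 0 = 0 :=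
  multOp_zero k _ _

lemma eq_zero_of_mem_exceptionalSet (h : ω ∈ exceptionalSet S Vp Vm)
    (hV : ¬(Vp ω = 0 ∨ Vm ω = 0)) : ω = 0 := by
  rw [not_or] at hV
  rcases h.2 with h | h
  · exact pow_eq_zero_iff two_ne_zero |>.mp ((mul_eq_zero.mp h).resolve_right hV.1)
  · exact pow_eq_zero_iff two_ne_zero |>.mp ((mul_eq_zero.mp h).resolve_right hV.2)

/-- A vanishing coefficient makes the kernel infinite-dimensional. -/
lemma mem_spectra_of_side_eq_zero (k : ℝ) (hω : ω ∈ Sᶜ) (hV : Vp ω = 0 ∨ Vm ω = 0) :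
    ω ∈ (pencil S Vp Vm k).spec ∧ ω ∈ (pencil S Vp Vm k).pointSpecInf ∧
      ω ∈ (pencil S Vp Vm k).weylSpec ∧
      ¬ FiniteDimensional ℂ (LinearMap.ker ((pencil S Vp Vm k).op ω 1)) ∧
      ω ∈ (pencil S Vp Vm k).essSpec5 := by
  obtain ⟨σ, hσ, h0⟩ := exists_side_eq_zero hV
  obtain ⟨E, hE, hE0⟩ := exists_orthonormal_kernel k hσ h0
  exact OperatorPencil.mem_spectra_of_orthonormal_kernel (P := pencil S Vp Vm k) hω hE
    fun lam n => hE0 ω lam n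

/-- With one vanishing coefficient, the range is closed of finite codimension if and only if the
other side does not carry essential spectrum. -/
lemma not_isClosed_range_maxwellOp_iff (hk : k ≠ 0) {a b : ℂ} (hV : a = 0 ∨ b = 0) :
    ¬(IsClosed (LinearMap.range (maxwellOp k ω a b 1) : Set (rangeSpace k)) ∧
      FiniteDimensional ℂ (rangeSpace k ⧸ LinearMap.range (maxwellOp k ω a b 1))) ↔
      (a = 0 ∧ ω ^ 2 * b ∈ halfLine k) ∨ (b = 0 ∧ ω ^ 2 * a ∈ halfLine k) := by
  constructor
  · intro h
    by_contra hn
    rw [not_or] at hn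
    refine h (isClosed_range_and_finiteDimensional_of_surjective ?_)
    rcases hV with rfl | rfl
    · have := maxwellOp_surjective_of_half hk (p := 0) (q := 1) (Or.inr ⟨rfl, rfl⟩)
        (fun h => hn.1 ⟨rfl, h⟩)
      rwa [mul_zero, mul_one] at this
    · have := maxwellOp_surjective_of_half hk (p := 1) (q := 0) (Or.inl ⟨rfl, rfl⟩)
        (fun h => hn.2 ⟨rfl, h⟩)
      rwa [mul_zero, mul_one] at this
  · rintro (⟨-, h⟩ | ⟨-, h⟩)
    · obtain ⟨ξ, hξ⟩ := exists_eq_add_sq_of_mem_halfLine h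
      exact not_isClosed_range_maxwellOp (σ := -1) (Or.inr rfl) (by rw [stepFun_neg_one, hξ])
    · obtain ⟨ξ, hξ⟩ := exists_eq_add_sq_of_mem_halfLine h
      exact not_isClosed_range_maxwellOp (σ := 1) (Or.inl rfl) (by rw [stepFun_one, hξ])

lemma mem_essSpec1_iff_of_side_eq_zero (hk : k ≠ 0) (hω : ω ∈ Sᶜ) (hV : Vp ω = 0 ∨ Vm ω = 0) :
    ω ∈ (pencil S Vp Vm k).essSpec1 ↔
      (Vp ω = 0 ∧ ω ^ 2 * Vm ω ∈ halfLine k) ∨ (Vm ω = 0 ∧ ω ^ 2 * Vp ω ∈ halfLine k) :=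
  (OperatorPencil.mem_essSpec1_iff_of_not_finiteDimensional_ker (P := pencil S Vp Vm k) hω
    (mem_spectra_of_side_eq_zero k hω hV).2.2.2.1).trans (not_isClosed_range_maxwellOp_iff hk hV)

lemma one_mem_lamResolventSet_zero (hk : k ≠ 0) (hp : Vp 0 ≠ 0) (hm : Vm 0 ≠ 0)
    (hpm : Vp 0 + Vm 0 ≠ 0) : 1 ∈ (pencil S Vp Vm k).lamResolventSet 0 := by
  rw [OperatorPencil.lamResolventSet, Set.mem_ofPred_eq, pencil_op_zero]
  exact curlCurlOp_bijective hk hp hm hpm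

lemma isFredholmOp_pencil_op_zero (hk : k ≠ 0) (hp : Vp 0 ≠ 0) (hm : Vm 0 ≠ 0)
    (hpm : Vp 0 + Vm 0 = 0) :
    Module.finrank ℂ (LinearMap.ker ((pencil S Vp Vm k).op 0 1)) = 1 ∧
      Module.finrank ℂ (rangeSpace k ⧸ LinearMap.range ((pencil S Vp Vm k).op 0 1)) = 1 ∧
      IsFredholmOp ((pencil S Vp Vm k).op 0 1) ∧
      fredholmIndex ((pencil S Vp Vm k).op 0 1) = 0 := by
  obtain ⟨E, hE, hE0⟩ := exists_domain_eq_gradExp hk hpm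
  have hne : E ≠ 0 := fun h => gradExp_ne_zero hk (by rw [← hE, h, ZeroMemClass.coe_zero])
  rw [pencil_op_zero]
  exact isFredholmOp_of_ker_eq_span_of_range_eq_ker hne (ker_curlCurlOp hk hp hm hE hE0)
    (interfaceFunctional_surjective hk) (range_curlCurlOp hk hp hpm)

/-- The interface eigenvalue `0` for `W̃₊(0) + W̃₋(0) = 0`. -/
lemma zero_mem_spectra_of_add_eq_zero (hk : k ≠ 0) (h0 : 0 ∈ Sᶜ) (hp : Vp 0 ≠ 0) (hm : Vm 0 ≠ 0)
    (hpm : Vp 0 + Vm 0 = 0) :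
    0 ∈ (pencil S Vp Vm k).spec ∧ 0 ∈ (pencil S Vp Vm k).pointSpecFin ∧
      0 ∈ (pencil S Vp Vm k).essSpec5 ∧ 0 ∉ (pencil S Vp Vm k).discreteSpec ∧
      0 ∉ (pencil S Vp Vm k).weylSpec := by
  obtain ⟨E, hE, hE0⟩ := exists_domain_eq_gradExp hk hpm
  have hne : E ≠ 0 := fun h => gradExp_ne_zero hk (by rw [← hE, h, ZeroMemClass.coe_zero])
  have hker : (pencil S Vp Vm k).op 0 1 E = 0 := by
    rw [pencil_op_zero]
    exact hE0
  have h1 : 1 ∉ (pencil S Vp Vm k).lamResolventSet 0 := fun h =>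
    hne (h.1.1 (hker.trans (map_zero _).symm))
  have hB := pencil_B_zero S Vp Vm k
  have hres := OperatorPencil.lamResolventSet_eq_empty_of_B_eq_zero hB h1
  refine ⟨OperatorPencil.mem_spec_of_notMem (P := pencil S Vp Vm k) h0 h1,
    ⟨⟨h0, E, hne, hker⟩, OperatorPencil.not_infiniteAlgMult_of_B_eq_zero hB
      (isFredholmOp_pencil_op_zero hk hp hm hpm).2.2.1.2.1⟩,
    OperatorPencil.mem_essSpec5_of_lamResolventSet_eq_empty (P := pencil S Vp Vm k) h0 hres,
    OperatorPencil.notMem_discreteSpec_of_lamResolventSet_eq_empty hres,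
    OperatorPencil.notMem_weylSpec_of_norm_sub_smul_le (gradExp_ne_zero hk) (C := 3 / k ^ 2) ?_⟩
  intro u
  rw [pencil_op_zero]
  exact exists_norm_sub_smul_gradExp_le hk hp hm hpm u

/-- The classification of the exceptional points for `k ≠ 0`. -/
lemma mem_spectra_iff (hk : k ≠ 0) (hω : ω ∈ exceptionalSet S Vp Vm) :
    (ω ∈ (pencil S Vp Vm k).spec ↔ (Vp ω = 0 ∨ Vm ω = 0) ∨ Vp ω + Vm ω = 0) ∧
    (ω ∈ (pencil S Vp Vm k).pointSpec ↔ (Vp ω = 0 ∨ Vm ω = 0) ∨ Vp ω + Vm ω = 0) ∧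
    (ω ∈ (pencil S Vp Vm k).essSpec5 ↔ (Vp ω = 0 ∨ Vm ω = 0) ∨ Vp ω + Vm ω = 0) ∧
    (ω ∈ (pencil S Vp Vm k).pointSpecFin ↔ ¬(Vp ω = 0 ∨ Vm ω = 0) ∧ Vp ω + Vm ω = 0) ∧
    ω ∉ (pencil S Vp Vm k).discreteSpec ∧
    (ω ∈ (pencil S Vp Vm k).pointSpecInf ↔ Vp ω = 0 ∨ Vm ω = 0) ∧
    (ω ∈ (pencil S Vp Vm k).essSpec2 ↔ Vp ω = 0 ∨ Vm ω = 0) ∧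
    (ω ∈ (pencil S Vp Vm k).essSpec3 ↔ Vp ω = 0 ∨ Vm ω = 0) ∧
    (ω ∈ (pencil S Vp Vm k).essSpec4 ↔ Vp ω = 0 ∨ Vm ω = 0) ∧
    (ω ∈ (pencil S Vp Vm k).weylSpec ↔ Vp ω = 0 ∨ Vm ω = 0) ∧
    (ω ∈ (pencil S Vp Vm k).essSpec1 ↔
      (Vp ω = 0 ∧ ω ^ 2 * Vm ω ∈ halfLine k) ∨ (Vm ω = 0 ∧ ω ^ 2 * Vp ω ∈ halfLine k)) := by
  by_cases hV : Vp ω = 0 ∨ Vm ω = 0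
  · obtain ⟨h1, h2, h3, h4, h5⟩ := mem_spectra_of_side_eq_zero k hω.1 hV
    obtain ⟨h6, h7, h8⟩ := OperatorPencil.mem_essSpec_of_not_finiteDimensional_ker
      (P := pencil S Vp Vm k) hω.1 h4
    have h9 := OperatorPencil.notMem_pointSpecFin_of_mem_pointSpecInf h2
    have h10 := mem_essSpec1_iff_of_side_eq_zero hk hω.1 hV
    have h11 := h2.1
    have h12 : ω ∉ (pencil S Vp Vm k).discreteSpec := fun h => h9 h.1
    clear h4
    tauto
  · obtain rfl := eq_zero_of_mem_exceptionalSet hω hV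
    obtain ⟨hp, hm⟩ := not_or.mp hV
    by_cases hpm : Vp 0 + Vm 0 = 0
    · obtain ⟨h1, h2, h3, h4, h5⟩ := zero_mem_spectra_of_add_eq_zero hk hω.1 hp hm hpm
      obtain ⟨-, -, hF, hi⟩ := isFredholmOp_pencil_op_zero (S := S) hk hp hm hpm
      obtain ⟨h6, h7, h8, h9⟩ := OperatorPencil.notMem_essSpec_of_isFredholmOp hF hi
      have h10 := h2.1
      have h11 : 0 ∉ (pencil S Vp Vm k).pointSpecInf := fun h => h2.2 h.2
      clear hF hi
      tauto
    · have hr := one_mem_lamResolventSet_zero (S := S) hk hp hm hpm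
      obtain ⟨h1, h2, h3, h4⟩ := OperatorPencil.notMem_spectra_of_mem_lamResolventSet
        (P := pencil S Vp Vm k) hω.1 hr
      obtain ⟨hF, hi⟩ := isFredholmOp_of_bijective hr.1
      obtain ⟨h6, h7, h8, h9⟩ := OperatorPencil.notMem_essSpec_of_isFredholmOp hF hi
      have h10 : 0 ∉ (pencil S Vp Vm k).pointSpecInf := fun h => h2 h.1
      have h11 : 0 ∉ (pencil S Vp Vm k).pointSpecFin := fun h => h2 h.1
      have h12 : 0 ∉ (pencil S Vp Vm k).discreteSpec := fun h => h11 h.1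
      clear hr hF hi
      tauto

/-- The classification of the exceptional points for `k = 0`. -/
lemma mem_spectra_zero_iff (hω : ω ∈ exceptionalSet S Vp Vm) :
    ω ∈ (pencil S Vp Vm 0).spec ∧ ω ∉ (pencil S Vp Vm 0).pointSpecFin ∧
    (ω ∈ (pencil S Vp Vm 0).pointSpecInf ↔ Vp ω = 0 ∨ Vm ω = 0) ∧
    ω ∈ (pencil S Vp Vm 0).essSpec1 ∧ ω ∈ (pencil S Vp Vm 0).essSpec2 ∧
    ω ∈ (pencil S Vp Vm 0).essSpec3 ∧ ω ∈ (pencil S Vp Vm 0).essSpec4 ∧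
    ω ∈ (pencil S Vp Vm 0).essSpec5 ∧ ω ∈ (pencil S Vp Vm 0).weylSpec := by
  by_cases hV : Vp ω = 0 ∨ Vm ω = 0
  · obtain ⟨h1, h2, h3, h4, h5⟩ := mem_spectra_of_side_eq_zero 0 hω.1 hV
    obtain ⟨h6, h7, h8⟩ := OperatorPencil.mem_essSpec_of_not_finiteDimensional_ker
      (P := pencil S Vp Vm 0) hω.1 h4
    refine ⟨h1, OperatorPencil.notMem_pointSpecFin_of_mem_pointSpecInf h2, iff_of_true h2 hV, ?_,
      h6, h7, h8, h5, h3⟩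
    rw [OperatorPencil.mem_essSpec1_iff_of_not_finiteDimensional_ker (P := pencil S Vp Vm 0)
      hω.1 h4, pencil_op]
    obtain ⟨σ, hσ, h0⟩ := exists_side_eq_zero hV
    -- For k = 0 the side where W = 0 already meets [k², ∞), so packets of frequency 0 on that side
    -- suffice, whatever the other side is.
    exact not_isClosed_range_maxwellOp (ξ := 0) hσ (by rw [h0]; simp)
  · obtain rfl := eq_zero_of_mem_exceptionalSet hω hV
    obtain ⟨hp, hm⟩ := not_or.mp hV
    have hB := pencil_B_zero S Vp Vm 0
    have hpt : 0 ∉ (pencil S Vp Vm 0).pointSpec := by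
      rintro ⟨-, u, hu, hu0⟩
      rw [pencil_op_zero] at hu0
      exact hu (curlCurlOp_zero_injective hp hm (hu0.trans (map_zero _).symm))
    obtain ⟨h1, h2, h3, h4⟩ := OperatorPencil.mem_essSpec_of_not_isClosed_range
      (P := pencil S Vp Vm 0) (ω := 0) hω.1 (by
        rw [pencil_op_zero]
        exact not_isClosed_range_curlCurlOp_zero _ _)
    have hW : 0 ∈ (pencil S Vp Vm 0).weylSpec := by
      -- At ω = 0 one has W = 0 = k² + ξ² on both sides; the right one is chosen.
      obtain ⟨E, -, hE, -, hlim, -⟩ := exists_orthonormal_approx_kernel (k := 0) (ξ := 0) (ω := 0)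
        (a := Vp 0) (b := Vm 0) (σ := 1) (Or.inl rfl) (by simp)
      exact ⟨hω.1, E, hE.1, hE.tendsto_inner_zero, hlim⟩
    have h5 := OperatorPencil.one_notMem_lamResolventSet_of_mem_weylSpec hW
    exact ⟨OperatorPencil.mem_spec_of_notMem (P := pencil S Vp Vm 0) hω.1 h5, fun h => hpt h.1,
      iff_of_false (fun h => hpt h.1) hV, h1, h2, h3, h4,
      OperatorPencil.mem_essSpec5_of_lamResolventSet_eq_empty (P := pencil S Vp Vm 0) hω.1
        (OperatorPencil.lamResolventSet_eq_empty_of_B_eq_zero hB h5), hW⟩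

end Maxwell1D

end

/-! ### Assembly from the pointwise classification. -/

theorem theorem2p2 (S : Set ℂ) (Vp Vm : ℂ → ℂ) :
    let Ω₀ : Set ℂ := Maxwell1D.exceptionalSet S Vp Vm
    -- part a)
    (∀ k : ℝ, k ≠ 0 →
      let P := Maxwell1D.pencil S Vp Vm k
      -- spectrum
      ((0 ∈ Sᶜ ∧ Vp 0 ≠ 0 ∧ Vm 0 ≠ 0 ∧ Vp 0 + Vm 0 ≠ 0) → P.spec ∩ Ω₀ = Ω₀ \ {0}) ∧
      (¬ (0 ∈ Sᶜ ∧ Vp 0 ≠ 0 ∧ Vm 0 ≠ 0 ∧ Vp 0 + Vm 0 ≠ 0) → P.spec ∩ Ω₀ = Ω₀) ∧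
      -- eigenvalues of finite multiplicity
      P.pointSpecFin ∩ Ω₀ = {ω | ω ∈ Ω₀ ∧ ω ^ 2 * Vp ω = 0 ∧ ω ^ 2 * Vm ω = 0 ∧
        Vp ω ≠ 0 ∧ Vm ω ≠ 0 ∧ Vp ω + Vm ω = 0} ∧
      ((0 ∈ Sᶜ ∧ Vp 0 ≠ 0 ∧ Vm 0 ≠ 0 ∧ Vp 0 + Vm 0 = 0) → P.pointSpecFin ∩ Ω₀ = {0}) ∧
      (¬ (0 ∈ Sᶜ ∧ Vp 0 ≠ 0 ∧ Vm 0 ≠ 0 ∧ Vp 0 + Vm 0 = 0) → P.pointSpecFin ∩ Ω₀ = ∅) ∧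
      -- eigenvalues of infinite multiplicity
      P.pointSpecInf ∩ Ω₀ = {ω | ω ∈ Ω₀ ∧ (Vp ω = 0 ∨ Vm ω = 0)} ∧
      P.pointSpec ∩ Ω₀ = P.spec ∩ Ω₀ ∧
      -- the eigenvalue 0
      ((P.pointSpecFin ∩ Ω₀).Nonempty →
        P.AlgSimple 0 1 ∧
        IsClosed (LinearMap.range (P.op 0 1) : Set (Maxwell1D.rangeSpace k)) ∧
        Module.finrank ℂ (Maxwell1D.rangeSpace k ⧸ LinearMap.range (P.op 0 1)) = 1 ∧
        IsFredholmOp (P.op 0 1) ∧ fredholmIndex (P.op 0 1) = 0) ∧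
      -- discrete spectrum
      P.discreteSpec ∩ Ω₀ = ∅ ∧
      -- essential spectra and Weyl spectrum
      P.essSpec2 ∩ Ω₀ = P.pointSpecInf ∩ Ω₀ ∧
      P.essSpec3 ∩ Ω₀ = P.pointSpecInf ∩ Ω₀ ∧
      P.essSpec4 ∩ Ω₀ = P.pointSpecInf ∩ Ω₀ ∧
      P.weylSpec ∩ Ω₀ = P.pointSpecInf ∩ Ω₀ ∧
      P.essSpec1 ∩ Ω₀ = {ω | ω ∈ Ω₀ ∧
        ((Vp ω = 0 ∧ ω ^ 2 * Vm ω ∈ Maxwell1D.halfLine k) ∨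
          (Vm ω = 0 ∧ ω ^ 2 * Vp ω ∈ Maxwell1D.halfLine k))} ∧
      P.essSpec5 ∩ Ω₀ = P.spec ∩ Ω₀) ∧
    -- part b)
    (
      let P := Maxwell1D.pencil S Vp Vm 0
      P.spec ∩ Ω₀ = Ω₀ ∧
      P.pointSpecFin ∩ Ω₀ = ∅ ∧
      P.discreteSpec ∩ Ω₀ = ∅ ∧
      P.pointSpecInf ∩ Ω₀ = {ω | ω ∈ Ω₀ ∧ (Vp ω = 0 ∨ Vm ω = 0)} ∧
      P.essSpec1 ∩ Ω₀ = Ω₀ ∧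
      P.essSpec2 ∩ Ω₀ = Ω₀ ∧
      P.essSpec3 ∩ Ω₀ = Ω₀ ∧
      P.essSpec4 ∩ Ω₀ = Ω₀ ∧
      P.essSpec5 ∩ Ω₀ = Ω₀ ∧
      P.weylSpec ∩ Ω₀ = Ω₀) := by
  intro Ω₀
  constructor
  · intro k hk P
    have key : ∀ ω ∈ Ω₀, _ := fun ω hω =>
      Maxwell1D.mem_spectra_iff (S := S) (Vp := Vp) (Vm := Vm) hk hω
    have hzero : ∀ ω ∈ Ω₀, ¬(Vp ω = 0 ∨ Vm ω = 0) → ω = 0 := fun ω hω hV =>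
      Maxwell1D.eq_zero_of_mem_exceptionalSet hω hV
    have hmem : ∀ {ω : ℂ}, ω ∈ Ω₀ → ω ∈ Sᶜ := fun hω => hω.1
    have hmem0 : 0 ∈ Sᶜ → 0 ∈ Ω₀ := fun h => ⟨h, Or.inl (by simp)⟩
    -- Finite multiplicity requires both values of W̃ to be nonzero, so it can occur only at ω = 0.
    -- All the items on finite multiplicity reduce to this.
    have hfin : ∀ ω, ω ∈ P.pointSpecFin ∩ Ω₀ ↔
        ω = 0 ∧ 0 ∈ Sᶜ ∧ Vp 0 ≠ 0 ∧ Vm 0 ≠ 0 ∧ Vp 0 + Vm 0 = 0 := by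
      intro ω
      constructor
      · rintro ⟨h, hω⟩
        obtain ⟨hV, hpm⟩ := (key ω hω).2.2.2.1.mp h
        obtain rfl := hzero ω hω hV
        exact ⟨rfl, hmem hω, (not_or.mp hV).1, (not_or.mp hV).2, hpm⟩
      · rintro ⟨rfl, h0, hp, hm, hpm⟩
        exact ⟨(key 0 (hmem0 h0)).2.2.2.1.mpr ⟨not_or.mpr ⟨hp, hm⟩, hpm⟩, hmem0 h0⟩
    refine ⟨?_, ?_, ?_, ?_, ?_, ?_, ?_, ?_, ?_, ?_, ?_, ?_, ?_, ?_, ?_⟩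
    · rintro ⟨-, hp, hm, hpm⟩
      ext ω
      refine and_comm.trans (and_congr_right fun hω => (key ω hω).1.trans ⟨?_, fun h => ?_⟩)
      · rintro h (rfl : ω = 0)
        exact h.elim (fun h => h.elim hp hm) hpm
      · by_contra hn
        exact h (hzero ω hω (not_or.mp hn).1)
    · intro h
      refine Set.inter_eq_right.mpr fun ω hω => (key ω hω).1.mpr ?_
      by_contra hn
      obtain ⟨hV, hpm⟩ := not_or.mp hn
      obtain rfl := hzero ω hω hV
      exact h ⟨hmem hω, (not_or.mp hV).1, (not_or.mp hV).2, hpm⟩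
    · ext ω
      rw [hfin]
      constructor
      · rintro ⟨rfl, h0, hp, hm, hpm⟩
        exact ⟨hmem0 h0, by simp, by simp, hp, hm, hpm⟩
      · rintro ⟨hω, -, -, hp, hm, hpm⟩
        obtain rfl := hzero ω hω (not_or.mpr ⟨hp, hm⟩)
        exact ⟨rfl, hmem hω, hp, hm, hpm⟩
    · intro h
      ext ω
      rw [hfin, Set.mem_singleton_iff]
      exact and_iff_left h
    · intro h
      rw [Set.eq_empty_iff_forall_notMem]
      intro ω hω
      exact h ((hfin ω).mp hω).2
    · ext ω
      exact and_comm.trans (and_congr_right fun hω => (key ω hω).2.2.2.2.2.1)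
    · ext ω
      exact and_congr_left fun hω => (key ω hω).2.1.trans (key ω hω).1.symm
    · rintro ⟨ω, hω⟩
      obtain ⟨-, -, hp, hm, hpm⟩ := (hfin ω).mp hω
      obtain ⟨h1, h2, h3, h4⟩ := Maxwell1D.isFredholmOp_pencil_op_zero (S := S) hk hp hm hpm
      exact ⟨OperatorPencil.algSimple_of_B_eq_zero (Maxwell1D.pencil_B_zero S Vp Vm k) h1, h3.1, h2,
        h3, h4⟩
    · rw [Set.eq_empty_iff_forall_notMem]
      rintro ω ⟨h, hω⟩
      exact (key ω hω).2.2.2.2.1 h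
    · ext ω
      exact and_congr_left fun hω =>
        (key ω hω).2.2.2.2.2.2.1.trans (key ω hω).2.2.2.2.2.1.symm
    · ext ω
      exact and_congr_left fun hω =>
        (key ω hω).2.2.2.2.2.2.2.1.trans (key ω hω).2.2.2.2.2.1.symm
    · ext ω
      exact and_congr_left fun hω =>
        (key ω hω).2.2.2.2.2.2.2.2.1.trans (key ω hω).2.2.2.2.2.1.symm
    · ext ω
      exact and_congr_left fun hω =>
        (key ω hω).2.2.2.2.2.2.2.2.2.1.trans (key ω hω).2.2.2.2.2.1.symm
    · ext ω
      exact and_comm.trans (and_congr_right fun hω => (key ω hω).2.2.2.2.2.2.2.2.2.2)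
    · ext ω
      exact and_congr_left fun hω => (key ω hω).2.2.1.trans (key ω hω).1.symm
  · intro P
    have key : ∀ ω ∈ Ω₀, _ := fun ω hω =>
      Maxwell1D.mem_spectra_zero_iff (S := S) (Vp := Vp) (Vm := Vm) hω
    refine ⟨Set.inter_eq_right.mpr fun ω hω => (key ω hω).1, ?_, ?_, ?_,
      Set.inter_eq_right.mpr fun ω hω => (key ω hω).2.2.2.1,
      Set.inter_eq_right.mpr fun ω hω => (key ω hω).2.2.2.2.1,
      Set.inter_eq_right.mpr fun ω hω => (key ω hω).2.2.2.2.2.1,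
      Set.inter_eq_right.mpr fun ω hω => (key ω hω).2.2.2.2.2.2.1,
      Set.inter_eq_right.mpr fun ω hω => (key ω hω).2.2.2.2.2.2.2.1,
      Set.inter_eq_right.mpr fun ω hω => (key ω hω).2.2.2.2.2.2.2.2⟩
    · rw [Set.eq_empty_iff_forall_notMem]
      rintro ω ⟨h, hω⟩
      exact (key ω hω).2.1 h
    · rw [Set.eq_empty_iff_forall_notMem]
      rintro ω ⟨h, hω⟩
      exact (key ω hω).2.1 h.1
    · ext ω
      exact and_comm.trans (and_congr_right fun hω => (key ω hω).2.2.1)
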